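/- A chiral vertex operator algebra is a graded complex vector space $V=\bigoplus_{\Delta\ge 0}V_\Delta$ with $\dim V_0=1$, $\dim V_\Delta<\infty$, nonzero vectors $|0\rangle\in V_0$, $T\in V_2$, and linear maps $v\mapsto J_n(v)\in\operatorname{End}V$ $(n\in\mathbb Z)$ of degree $-n$, such that: $J_0(|0\rangle)=\mathrm{id}$, $J_n(|0\rangle)=0$ for $n\ne0$; $J_{-\Delta}(v)|0\rangle=v$ and $J_n(v)|0\rangle=0$ for $v\in V_\Delta$, $n>-\Delta$; the $T(n)=J_n(T)$ satisfy $[T(m),T(n)]=(m-n)T(m+n)+\frac{m^3-m}{12}\delta_{m+n,0}c_V$ for some $c_V\in\mathbb C$, and $T(0)v=\Delta v$, $J_n(T(-1)v)=-(n+\Delta)J_n(v)$ for $v\in V_\Delta$; and, for $v_i\in V_{\Delta_i}$ and $m,n\in\mathbb Z$, the commutator formula $$[J_m(v_1),J_n(v_2)]=\sum_{j=0}^{\Delta_1+\Delta_2-1}\tbinom{m+\Delta_1-1}{j}J_{m+n}(J_{j-\Delta_1+1}(v_1)v_2)$$ and the associativity formula $$J_m(J_n(v_1)v_2)=\sum_{j\ge0}(-1)^j\tbinom{n+\Delta_1-1}{j}\Bigl(J_{n-j}(v_1)J_{m-n+j}(v_2)-(-1)^{n+\Delta_1-1}J_{m+\Delta_1-j-1}(v_2)J_{j-\Delta_1+1}(v_1)\Bigr)$$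 hold. It is $C_2$-finite if $\dim V/C_2(V)<\infty$, where $C_2(V)$ is spanned by the $J_{-\Delta-p}(v)m$ with $v\in V_\Delta$, $m\in V$, $p\ge1$. The current Lie algebra $\mathfrak g(V)$ is the quotient of $V\otimes\mathbb C((\xi))$ by the elements $T(-1)v\otimes f+v\otimes f'$; the class of $v\otimes f$ is denoted $J(v,f)$, and for $v_i\in V_{\Delta_i}$ the bracket is $$[J(v_1,f_1),J(v_2,f_2)]=\sum_{m=0}^{\Delta_1+\Delta_2-1}\tfrac1{m!}J\bigl(J_{m-\Delta_1+1}(v_1)v_2,\,f_1^{(m)}f_2\bigr).$$ For $v\in V_\Delta$ put $J_n(v)=J(v,\xi^{n+\Delta-1})$. Let $F^p\mathfrak g(V)$ be spanned by the $J(v,f)$ with $v\in V_\Delta$, $f\in\xi^{p+\Delta-1}\mathbb C[[\xi]]$, put $$F^pU(\mathfrak g(V))=\sum_{p_1+\dots+p_r\ge p}F^{p_1}\mathfrak g(V)\cdots F^{p_r}\mathfrak g(V),\qquad F^p_NU(\mathfrak g(V))=\sum_{q\ge N}F^{p-q}U(\mathfrak g(V))\cdot F^{q}U(\mathfrak g(V)),$$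 and let $\widehat U=\bigcup_pF^p\widehat U$ with $F^p\widehat U=\varprojlim_NF^pU(\mathfrak g(V))/F^p_NU(\mathfrak g(V))$. The current algebra $\mathcal U(V)$ is the quotient of the complete algebra $\widehat U$ by the closed two-sided ideal generated by $J_0(|0\rangle)-1$ and the differences of the two sides of the associativity formula, read in $\widehat U$; $F^p\mathcal U(V)$ is the image of $F^p\widehat U$. Put $\mathfrak J=\mathcal U(V)F^1\mathcal U(V)$; the zero-mode algebra is $A_0(V)=F^0\mathcal U(V)/(\mathfrak J\cap F^0\mathcal U(V))$. A $V$-module is a finitely generated $\mathcal U(V)$-module $M$ such that $F^0\mathcal U(V)m$ is finite dimensional for every $m\in M$. For a $\mathcal U(V)$-module $M$ and $h\in\mathbb C$ let $M_{(h)}$ be the generalized eigenspace of $T(0)$ for the eigenvalue $h$, and let $\mathcal{HW}(M)=\{m\in M: J_n(v)m=0\text{ for all }v\in V_\Delta,\ \Delta\ge0,\ n>0\}$. Theorem. Let $V$ be a $C_2$-finite chiral vertex operator algebra. (1) The zero-mode algebra $A_0(V)$ is finite dimensional. (2) The category of finite dimensional $A_0(V)$-modules has, up to isomorphism, only finitely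 many simple objects. (3) For every $V$-module $M$ the space $\mathcal{HW}(M)$ is finite dimensional; it is an $A_0(V)$-module through the action of $F^0\mathcal U(V)$, and $\mathcal{HW}$ (with restriction of homomorphisms) is a functor from the category of $V$-modules to the category of finite dimensional $A_0(V)$-modules. (4) Let $W$ be a simple $A_0(V)$-module. Then $M(W)=\mathcal U(V)\otimes_{F^0\mathcal U(V)}W$ is a $V$-module and has a unique maximal proper $V$-submodule $N(W)$, which is the sum of all proper $V$-submodules, and $L(W)=M(W)/N(W)$ is a simple $V$-module. (5) $W\mapsto L(W)$ induces a bijection from the isomorphism classes of finite dimensional simple $A_0(V)$-modules to the isomorphism classes of simple $V$-modules. (6) Let $M$ be a $\mathcal U(V)$-module such that $M=\bigoplus_{h\in P}M_{(h)}$ with $P=\bigcup_i(h_i+\mathbb Z_{\ge0})$ for finitely many complex numbers $h_i$ with $h_i-h_j\notin\mathbb Z$ for $i\ne j$. Then $M$ is a $V$-module if and only if $\dim M_{(h)}<\infty$ for all $h\in\mathbb C$. (7) Every $V$-module $M$ has a composition series $0=F_0M\subset F_1M\subset\dots\subset F_nM=M$ in which all $F_iM$ are $V$-modules and all $F_iM/F_{i-1}M$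 $(1\le i\le n)$ are simple $V$-modules. -/

import Mathlib

open scoped TensorProduct LaurentSeries ModuleCat
open CategoryTheory

universe u w

noncomputable section

/-- A chiral vertex operator algebra `(V, J, T)` over `ℂ`. The space `V` is graded by the
subspaces `wt Δ`, `J n v` is the `n`-th mode `J_n(v)`, which lowers the weight by `n`. -/
structure ChiralVOA (V : Type u) [AddCommGroup V] [Module ℂ V] where
  /-- the homogeneous subspaces `V_Δ` -/
  wt : ℕ → Submodule ℂ V
  isInternal : DirectSum.IsInternal wt
  finrank_wt_zero : Module.finrank ℂ (wt 0) = 1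
  finiteDimensional_wt : ∀ Δ, FiniteDimensional ℂ (wt Δ)
  /-- the vacuum -/
  vac : V
  vac_mem : vac ∈ wt 0
  vac_ne_zero : vac ≠ 0
  /-- the Virasoro vector -/
  T : V
  T_mem : T ∈ wt 2
  T_ne_zero : T ≠ 0
  /-- the modes `J_n(v)` -/
  J : ℤ → V →ₗ[ℂ] Module.End ℂ V
  J_mem : ∀ (n : ℤ) (v : V) (k l : ℕ), (l : ℤ) = k - n → ∀ x ∈ wt k, J n v x ∈ wt l
  J_eq_zero : ∀ (n : ℤ) (v : V) (k : ℕ), (k : ℤ) - n < 0 → ∀ x ∈ wt k, J n v x = 0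
  J_vac_zero : J 0 vac = 1
  J_vac : ∀ n : ℤ, n ≠ 0 → J n vac = 0
  J_create : ∀ (Δ : ℕ), ∀ v ∈ wt Δ, J (-(Δ : ℤ)) v vac = v
  J_annihilate : ∀ (Δ : ℕ), ∀ v ∈ wt Δ, ∀ n : ℤ, -(Δ : ℤ) < n → J n v vac = 0
  /-- the central charge -/
  c : ℂ
  virasoro : ∀ m n : ℤ, J m T * J n T - J n T * J m T =
    ((m : ℂ) - n) • J (m + n) T +
      if m + n = 0 then ((((m : ℂ) ^ 3 - m) / 12) * c) • (1 : Module.End ℂ V) else 0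
  T_zero : ∀ (Δ : ℕ), ∀ v ∈ wt Δ, J 0 T v = (Δ : ℂ) • v
  translation : ∀ (Δ : ℕ), ∀ v ∈ wt Δ, ∀ n : ℤ,
    J n (J (-1) T v) = (-((n : ℂ) + Δ)) • J n v
  commutator : ∀ (Δ₁ Δ₂ : ℕ), ∀ v₁ ∈ wt Δ₁, ∀ v₂ ∈ wt Δ₂, ∀ m n : ℤ,
    J m v₁ * J n v₂ - J n v₂ * J m v₁ =
      ∑ j ∈ Finset.range (Δ₁ + Δ₂),
        ((Ring.choose (m + Δ₁ - 1) j : ℤ) : ℂ) • J (m + n) (J (j - Δ₁ + 1) v₁ v₂)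
  /-- The associativity formula. Applied to a vector the sum over `j` has only finitely many
  nonzero terms, so it equals all sufficiently long partial sums. -/
  associativity : ∀ (Δ₁ Δ₂ : ℕ), ∀ v₁ ∈ wt Δ₁, ∀ v₂ ∈ wt Δ₂, ∀ (m n : ℤ) (x : V),
    ∀ᶠ K : ℕ in Filter.atTop, J m (J n v₁ v₂) x =
      ∑ j ∈ Finset.range K, ((-1 : ℂ) ^ j * ((Ring.choose (n + Δ₁ - 1) j : ℤ) : ℂ)) •
        (J (n - j) v₁ (J (m - n + j) v₂ x) -
          (-1 : ℂ) ^ (n + Δ₁ - 1) • J (m + Δ₁ - j - 1) v₂ (J (j - Δ₁ + 1) v₁ x))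

namespace ChiralVOA

variable {V : Type u} [AddCommGroup V] [Module ℂ V] (A : ChiralVOA V)

/-- `C_2(V)`, spanned by the vectors `J_{-Δ-p}(v) m` with `v ∈ V_Δ`, `m ∈ V`, `p ≥ 1`. -/
def C2 : Submodule ℂ V :=
  Submodule.span ℂ {x | ∃ (Δ : ℕ) (v : V) (m : V) (p : ℕ), v ∈ A.wt Δ ∧ 1 ≤ p ∧
    x = A.J (-(Δ : ℤ) - p) v m}

/-- Zhu's finiteness condition `dim V / C_2(V) < ∞`. -/
def IsC2Finite : Prop := FiniteDimensional ℂ (V ⧸ A.C2)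

/-! ### The universal enveloping algebra of the current Lie algebra -/

/-- Defining relations of `U(𝔤(V))` on the tensor algebra of `Ṽ⁽¹⁾ = V ⊗ ℂ((ξ))`
(the factor `(dξ)^{1-Δ}` only records the weight `Δ`): the image of
`∇ (v ⊗ f) = T(-1)v ⊗ f + v ⊗ f'` is zero, so that the generators form
`𝔤(V) = Ṽ⁽¹⁾ / ∇ Ṽ⁽⁰⁾`, and the commutator of two generators is their Lie bracket
`∑ₘ (1/m!) J_{m-Δ₁+1}(v₁)v₂ ⊗ f₁⁽ᵐ⁾ f₂`.
Note that `LaurentSeries.hasseDeriv ℂ m f` is `(1/m!) f⁽ᵐ⁾`. -/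
inductive EnvRel : TensorAlgebra ℂ (V ⊗[ℂ] ℂ⸨X⸩) → TensorAlgebra ℂ (V ⊗[ℂ] ℂ⸨X⸩) → Prop
  | nabla (v : V) (f : ℂ⸨X⸩) :
      EnvRel (TensorAlgebra.ι ℂ
        (A.J (-1) A.T v ⊗ₜ[ℂ] f + v ⊗ₜ[ℂ] LaurentSeries.hasseDeriv ℂ 1 f)) 0
  | bracket (Δ₁ Δ₂ : ℕ) (v₁ v₂ : V) (h₁ : v₁ ∈ A.wt Δ₁) (h₂ : v₂ ∈ A.wt Δ₂) (f₁ f₂ : ℂ⸨X⸩) :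
      EnvRel
        (TensorAlgebra.ι ℂ (v₁ ⊗ₜ[ℂ] f₁) * TensorAlgebra.ι ℂ (v₂ ⊗ₜ[ℂ] f₂) -
          TensorAlgebra.ι ℂ (v₂ ⊗ₜ[ℂ] f₂) * TensorAlgebra.ι ℂ (v₁ ⊗ₜ[ℂ] f₁))
        (TensorAlgebra.ι ℂ (∑ m ∈ Finset.range (Δ₁ + Δ₂),
          A.J (m - Δ₁ + 1) v₁ v₂ ⊗ₜ[ℂ] (LaurentSeries.hasseDeriv ℂ m f₁ * f₂)))

/-- The universal enveloping algebra `U(𝔤(V))` of the current Lie algebra `𝔤(V)`: the tensor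
algebra on `𝔤(V)` modulo the relations `x y - y x = [x, y]`. -/
def Env : Type u := RingQuot A.EnvRel

instance : Ring A.Env := inferInstanceAs (Ring (RingQuot A.EnvRel))
instance : Algebra ℂ A.Env := inferInstanceAs (Algebra ℂ (RingQuot A.EnvRel))

/-- The projection of the tensor algebra of `Ṽ⁽¹⁾` onto `U(𝔤(V))`. -/
def envMk : TensorAlgebra ℂ (V ⊗[ℂ] ℂ⸨X⸩) →ₐ[ℂ] A.Env := RingQuot.mkAlgHom ℂ A.EnvRel

/-- The element `J(v, f)` of `𝔤(V)` in `U(𝔤(V))`. -/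
def cur (v : V) (f : ℂ⸨X⸩) : A.Env := A.envMk (TensorAlgebra.ι ℂ (v ⊗ₜ[ℂ] f))

/-- `J_n(v) = J(v, ξ^{n+Δ-1})` for `v` of weight `Δ`. -/
def mode (Δ n : ℤ) (v : V) : A.Env := A.cur v (HahnSeries.single (n + Δ - 1) 1)

/-- The subset of `F^p 𝔤(V)` formed by the `J(v, f)` with `v ∈ V_Δ`, `f ∈ ξ^{p+Δ-1} ℂ[[ξ]]`. -/
def genFil (p : ℤ) : Set A.Env :=
  {x | ∃ (Δ : ℕ) (v : V) (f : ℂ⸨X⸩), v ∈ A.wt Δ ∧ (∀ k : ℤ, k < p + Δ - 1 → f.coeff k = 0) ∧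
    x = A.cur v f}

/-- `F^p 𝔤(V)`, as a subspace of `U(𝔤(V))`. -/
def lieFil (p : ℤ) : Submodule ℂ A.Env := Submodule.span ℂ (A.genFil p)

/-- `F^p U(𝔤(V)) = ∑_{p₁+⋯+p_r ≥ p} F^{p₁}𝔤(V) ⋯ F^{p_r}𝔤(V)`; the empty product gives
`ℂ 1 ⊆ F^p` for `p ≤ 0`. -/
def envFil (p : ℤ) : Submodule ℂ A.Env :=
  Submodule.span ℂ {x | ∃ l : List (ℤ × A.Env), (∀ a ∈ l, a.2 ∈ A.lieFil a.1) ∧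
    p ≤ (l.map Prod.fst).sum ∧ x = (l.map Prod.snd).prod}

/-- The filtration `F^p_N U(𝔤(V)) = ∑_{q ≥ N} F^{p-q} U(𝔤(V)) · F^q U(𝔤(V))`, which defines the
linear topology of `F^p U(𝔤(V))`. By the triangular decomposition
`F^p U(𝔤(V)) = ∑_{p₁+p₂=p, p₁≤0≤p₂} F^{p₁}U(𝔤(V)_{<0}) · F^{p₂}U(𝔤(V)_{≥0})`
it equals `∑_{p₁+p₂=p, p₁≤0, p₂≥N} F^{p₁}U(𝔤(V)_{<0}) · F^{p₂}U(𝔤(V)_{≥0})` for `N ≥ 0`. -/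
def envTop (p N : ℤ) : Submodule ℂ A.Env :=
  ⨆ q : ℤ, ⨆ _ : N ≤ q, A.envFil (p - q) * A.envFil q

lemma envFil_mul_le (p q : ℤ) : A.envFil p * A.envFil q ≤ A.envFil (p + q) := by
  rw [envFil, envFil, Submodule.span_mul_span]
  apply Submodule.span_le.2
  rintro _ ⟨_, ⟨l, hl, hp, rfl⟩, _, ⟨l', hl', hq, rfl⟩, rfl⟩
  refine Submodule.subset_span ⟨l ++ l', ?_, ?_, ?_⟩
  · intro a ha
    rcases List.mem_append.1 ha with h | h
    · exact hl a h
    · exact hl' a h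
  · simp only [List.map_append, List.sum_append]
    omega
  · simp

lemma envFil_anti {p q : ℤ} (h : p ≤ q) : A.envFil q ≤ A.envFil p := by
  apply Submodule.span_mono
  rintro x ⟨l, hl, hq, rfl⟩
  exact ⟨l, hl, h.trans hq, rfl⟩

lemma one_mem_envFil {p : ℤ} (hp : p ≤ 0) : (1 : A.Env) ∈ A.envFil p :=
  Submodule.subset_span ⟨[], by simp, by simpa using hp, by simp⟩

lemma envTop_le_envFil (p N : ℤ) : A.envTop p N ≤ A.envFil p := by
  refine iSup₂_le fun q _ => (A.envFil_mul_le _ _).trans (le_of_eq ?_)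
  rw [sub_add_cancel]

lemma envTop_anti_right (p : ℤ) {N N' : ℤ} (h : N ≤ N') : A.envTop p N' ≤ A.envTop p N :=
  iSup₂_le fun q hq => le_iSup₂_of_le q (h.trans hq) le_rfl

lemma envTop_anti_left {p p' : ℤ} (h : p ≤ p') (N : ℤ) : A.envTop p' N ≤ A.envTop p N :=
  iSup₂_le fun q hq => le_iSup₂_of_le q hq
    (mul_le_mul' (A.envFil_anti (by omega)) le_rfl)

lemma mul_mem_envTop {p q N : ℤ} {x y : A.Env} (hx : x ∈ A.envFil p) (hy : y ∈ A.envFil q)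
    (hN : N ≤ q) : x * y ∈ A.envTop (p + q) N := by
  refine (le_iSup₂_of_le (f := fun r (_ : N ≤ r) => A.envFil (p + q - r) * A.envFil r)
    q hN ?_) (Submodule.mul_mem_mul hx hy)
  rw [add_sub_cancel_right]

lemma envFil_mul_envTop_le (p q N : ℤ) : A.envFil p * A.envTop q N ≤ A.envTop (p + q) N := by
  rw [envTop, Submodule.mul_iSup]
  refine iSup_le fun r => ?_
  rw [Submodule.mul_iSup]
  refine iSup_le fun hr => ?_
  rw [← mul_assoc]
  refine le_iSup₂_of_le r hr (mul_le_mul' ((A.envFil_mul_le _ _).trans ?_) le_rfl)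
  exact le_of_eq (by rw [add_sub_assoc])

lemma envTop_mul_envFil_le (p q N : ℤ) :
    A.envTop p N * A.envFil q ≤ A.envTop (p + q) (N + q) := by
  rw [envTop, Submodule.iSup_mul]
  refine iSup_le fun r => ?_
  rw [Submodule.iSup_mul]
  refine iSup_le fun hr => ?_
  rw [mul_assoc]
  refine le_iSup₂_of_le (r + q) (by omega)
    ((mul_le_mul' le_rfl (A.envFil_mul_le _ _)).trans ?_)
  exact le_of_eq (by rw [add_sub_add_right_eq_sub])

/-! ### The completion -/

/-- Cauchy sequences in `F^p U(𝔤(V))` for the linear topology defined by the `F^p_N`. -/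
def cauchyFil (p : ℤ) : Submodule ℂ (ℕ → A.Env) where
  carrier := {x | (∀ i, x i ∈ A.envFil p) ∧
    ∀ N : ℤ, ∃ K : ℕ, ∀ i ≥ K, ∀ j ≥ K, x i - x j ∈ A.envTop p N}
  zero_mem' := ⟨fun _ => zero_mem _, fun N => ⟨0, fun _ _ _ _ => by simp⟩⟩
  add_mem' := by
    rintro x y ⟨hx, hx'⟩ ⟨hy, hy'⟩
    refine ⟨fun i => add_mem (hx i) (hy i), fun N => ?_⟩
    obtain ⟨K, hK⟩ := hx' N
    obtain ⟨L, hL⟩ := hy' N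
    refine ⟨max K L, fun i hi j hj => ?_⟩
    have h := add_mem (hK i (le_of_max_le_left hi) j (le_of_max_le_left hj))
      (hL i (le_of_max_le_right hi) j (le_of_max_le_right hj))
    simpa only [Pi.add_apply, add_sub_add_comm] using h
  smul_mem' := by
    rintro a x ⟨hx, hx'⟩
    refine ⟨fun i => Submodule.smul_mem _ a (hx i), fun N => ?_⟩
    obtain ⟨K, hK⟩ := hx' N
    refine ⟨K, fun i hi j hj => ?_⟩
    simpa only [Pi.smul_apply, ← smul_sub] using Submodule.smul_mem _ a (hK i hi j hj)

/-- Sequences in `F^p U(𝔤(V))` which converge to zero for the topology defined by the `F^p_N`. -/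
def nullFil (p : ℤ) : Submodule ℂ (ℕ → A.Env) where
  carrier := {x | (∀ i, x i ∈ A.envFil p) ∧ ∀ N : ℤ, ∃ K : ℕ, ∀ i ≥ K, x i ∈ A.envTop p N}
  zero_mem' := ⟨fun _ => zero_mem _, fun N => ⟨0, fun _ _ => zero_mem _⟩⟩
  add_mem' := by
    rintro x y ⟨hx, hx'⟩ ⟨hy, hy'⟩
    refine ⟨fun i => add_mem (hx i) (hy i), fun N => ?_⟩
    obtain ⟨K, hK⟩ := hx' N
    obtain ⟨L, hL⟩ := hy' N
    exact ⟨max K L, fun i hi =>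
      add_mem (hK i (le_of_max_le_left hi)) (hL i (le_of_max_le_right hi))⟩
  smul_mem' := by
    rintro a x ⟨hx, hx'⟩
    refine ⟨fun i => Submodule.smul_mem _ a (hx i), fun N => ?_⟩
    obtain ⟨K, hK⟩ := hx' N
    exact ⟨K, fun i hi => Submodule.smul_mem _ a (hK i hi)⟩

lemma cauchyFil_anti {p q : ℤ} (h : p ≤ q) : A.cauchyFil q ≤ A.cauchyFil p := by
  rintro x ⟨hx, hx'⟩
  refine ⟨fun i => A.envFil_anti h (hx i), fun N => ?_⟩
  obtain ⟨K, hK⟩ := hx' N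
  exact ⟨K, fun i hi j hj => A.envTop_anti_left h N (hK i hi j hj)⟩

lemma nullFil_anti {p q : ℤ} (h : p ≤ q) : A.nullFil q ≤ A.nullFil p := by
  rintro x ⟨hx, hx'⟩
  refine ⟨fun i => A.envFil_anti h (hx i), fun N => ?_⟩
  obtain ⟨K, hK⟩ := hx' N
  exact ⟨K, fun i hi => A.envTop_anti_left h N (hK i hi)⟩

lemma const_mem_cauchyFil {p : ℤ} {x : A.Env} (hx : x ∈ A.envFil p) :
    (fun _ => x) ∈ A.cauchyFil p :=
  ⟨fun _ => hx, fun N => ⟨0, fun _ _ _ _ => by simp⟩⟩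

lemma mul_mem_cauchyFil {p q : ℤ} {x y : ℕ → A.Env} (hx : x ∈ A.cauchyFil p)
    (hy : y ∈ A.cauchyFil q) : x * y ∈ A.cauchyFil (p + q) := by
  obtain ⟨hx, hx'⟩ := hx
  obtain ⟨hy, hy'⟩ := hy
  refine ⟨fun i => A.envFil_mul_le p q (Submodule.mul_mem_mul (hx i) (hy i)), fun N => ?_⟩
  obtain ⟨K, hK⟩ := hx' (N - q)
  obtain ⟨L, hL⟩ := hy' N
  refine ⟨max K L, fun i hi j hj => ?_⟩
  have h1 := A.envFil_mul_envTop_le p q N (Submodule.mul_mem_mul (hx i)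
    (hL i (le_of_max_le_right hi) j (le_of_max_le_right hj)))
  have h2 := A.envTop_mul_envFil_le p q (N - q) (Submodule.mul_mem_mul
    (hK i (le_of_max_le_left hi) j (le_of_max_le_left hj)) (hy j))
  rw [sub_add_cancel] at h2
  have h3 := add_mem h1 h2
  have e : x i * (y i - y j) + (x i - x j) * y j = (x * y) i - (x * y) j := by
    simp only [Pi.mul_apply]
    noncomm_ring
  rwa [e] at h3

lemma cauchyFil_mul_nullFil {p q : ℤ} {x y : ℕ → A.Env} (hx : x ∈ A.cauchyFil p)
    (hy : y ∈ A.nullFil q) : x * y ∈ A.nullFil (p + q) := by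
  refine ⟨fun i => A.envFil_mul_le p q (Submodule.mul_mem_mul (hx.1 i) (hy.1 i)), fun N => ?_⟩
  obtain ⟨L, hL⟩ := hy.2 N
  exact ⟨L, fun i hi => A.envFil_mul_envTop_le p q N (Submodule.mul_mem_mul (hx.1 i) (hL i hi))⟩

lemma nullFil_mul_cauchyFil {p q : ℤ} {x y : ℕ → A.Env} (hx : x ∈ A.nullFil p)
    (hy : y ∈ A.cauchyFil q) : x * y ∈ A.nullFil (p + q) := by
  refine ⟨fun i => A.envFil_mul_le p q (Submodule.mul_mem_mul (hx.1 i) (hy.1 i)), fun N => ?_⟩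
  obtain ⟨L, hL⟩ := hx.2 (N - q)
  refine ⟨L, fun i hi => ?_⟩
  have h := A.envTop_mul_envFil_le p q (N - q) (Submodule.mul_mem_mul (hL i hi) (hy.1 i))
  rwa [sub_add_cancel] at h

/-- The algebra of all Cauchy sequences, `⋃_p` of the Cauchy sequences in `F^p U(𝔤(V))`. -/
def cauchyAlg : Subalgebra ℂ (ℕ → A.Env) where
  carrier := {x | ∃ p, x ∈ A.cauchyFil p}
  mul_mem' := by
    rintro x y ⟨p, hx⟩ ⟨q, hy⟩
    exact ⟨p + q, A.mul_mem_cauchyFil hx hy⟩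
  add_mem' := by
    rintro x y ⟨p, hx⟩ ⟨q, hy⟩
    exact ⟨min p q, add_mem (A.cauchyFil_anti (min_le_left p q) hx)
      (A.cauchyFil_anti (min_le_right p q) hy)⟩
  algebraMap_mem' := by
    intro r
    refine ⟨0, A.const_mem_cauchyFil (x := algebraMap ℂ A.Env r) ?_⟩
    rw [Algebra.algebraMap_eq_smul_one]
    exact Submodule.smul_mem _ r (A.one_mem_envFil le_rfl)

/-- The ideal of null sequences. -/
def nullIdeal : Ideal A.cauchyAlg where
  carrier := {x | ∃ p, (x : ℕ → A.Env) ∈ A.nullFil p}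
  zero_mem' := ⟨0, zero_mem _⟩
  add_mem' := by
    rintro x y ⟨p, hx⟩ ⟨q, hy⟩
    exact ⟨min p q, add_mem (A.nullFil_anti (min_le_left p q) hx)
      (A.nullFil_anti (min_le_right p q) hy)⟩
  smul_mem' := by
    rintro ⟨x, p, hx⟩ ⟨y, hy0⟩ ⟨q, hy⟩
    exact ⟨p + q, A.cauchyFil_mul_nullFil hx hy⟩

instance : A.nullIdeal.IsTwoSided where
  mul_mem_of_left := by
    rintro ⟨x, hx0⟩ ⟨y, q, hy⟩ ⟨p, hx⟩
    exact ⟨p + q, A.nullFil_mul_cauchyFil hx hy⟩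

/-- The completed enveloping algebra
`Û(𝔤(V)) = ⋃_p lim_N F^p U(𝔤(V)) / F^p_N U(𝔤(V))`,
realised by Cauchy sequences modulo null sequences. -/
def CEnv : Type u := A.cauchyAlg ⧸ A.nullIdeal

instance : Ring A.CEnv := inferInstanceAs (Ring (A.cauchyAlg ⧸ A.nullIdeal))
instance : Algebra ℂ A.CEnv := inferInstanceAs (Algebra ℂ (A.cauchyAlg ⧸ A.nullIdeal))

/-- The class of a Cauchy sequence. -/
def cenvMk : A.cauchyAlg →ₐ[ℂ] A.CEnv := Ideal.Quotient.mkₐ ℂ A.nullIdeal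

/-- `F^p Û(𝔤(V)) = lim_N F^p U(𝔤(V)) / F^p_N U(𝔤(V))`. -/
def cenvFil (p : ℤ) : Submodule ℂ A.CEnv :=
  ((A.cauchyFil p).comap A.cauchyAlg.val.toLinearMap).map
    A.cenvMk.toLinearMap

/-- The kernel `F^p_N Û(𝔤(V))` of `F^p Û(𝔤(V)) → F^p U(𝔤(V)) / F^p_N U(𝔤(V))`. -/
def cenvTop (p N : ℤ) : Set A.CEnv :=
  {y | ∃ x : A.cauchyAlg, (x : ℕ → A.Env) ∈ A.cauchyFil p ∧
    (∃ K : ℕ, ∀ i ≥ K, (x : ℕ → A.Env) i ∈ A.envTop p N) ∧ A.cenvMk x = y}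

/-- The element of `Û(𝔤(V))` defined by a Cauchy sequence in some `F^p U(𝔤(V))`. -/
def toCEnv (x : ℕ → A.Env) (hx : ∃ p, x ∈ A.cauchyFil p) : A.CEnv :=
  A.cenvMk ⟨x, hx⟩

lemma cur_mem_envFil {p : ℤ} {Δ : ℕ} {v : V} (hv : v ∈ A.wt Δ) {f : ℂ⸨X⸩}
    (hf : ∀ k : ℤ, k < p + Δ - 1 → f.coeff k = 0) : A.cur v f ∈ A.envFil p := by
  refine Submodule.subset_span ⟨[(p, A.cur v f)], ?_, by simp, by simp⟩
  intro a ha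
  rw [List.mem_singleton.1 ha]
  exact Submodule.subset_span ⟨Δ, v, f, hv, hf, rfl⟩

lemma mode_mem_envFil {Δ : ℕ} {v : V} (hv : v ∈ A.wt Δ) (n : ℤ) :
    A.mode Δ n v ∈ A.envFil n :=
  A.cur_mem_envFil hv fun _ hk => HahnSeries.coeff_single_of_ne hk.ne

lemma mode_J_mem_envFil {Δ₂ : ℕ} {v₁ v₂ : V} (h₂ : v₂ ∈ A.wt Δ₂) (m n : ℤ) :
    A.mode (Δ₂ - n) m (A.J n v₁ v₂) ∈ A.envFil m := by
  rcases lt_or_ge ((Δ₂ : ℤ) - n) 0 with h | h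
  · rw [A.J_eq_zero n v₁ Δ₂ h v₂ h₂]
    simp [mode, cur]
  · obtain ⟨l, hl⟩ := Int.eq_ofNat_of_zero_le h
    rw [hl]
    exact A.mode_mem_envFil (A.J_mem n v₁ Δ₂ l hl.symm v₂ h₂) m

/-- The element `J_n(v)`, `v ∈ V_Δ`, of `Û(𝔤(V))`. -/
def cmode {Δ : ℕ} {v : V} (hv : v ∈ A.wt Δ) (n : ℤ) : A.CEnv :=
  A.toCEnv (fun _ => A.mode Δ n v) ⟨n, A.const_mem_cauchyFil (A.mode_mem_envFil hv n)⟩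

/-- The `j`-th term of the sum in the associativity formula. -/
def assocTerm (Δ₁ Δ₂ : ℕ) (v₁ v₂ : V) (m n : ℤ) (j : ℕ) : A.Env :=
  ((-1 : ℂ) ^ j * ((Ring.choose (n + Δ₁ - 1) j : ℤ) : ℂ)) •
    (A.mode Δ₁ (n - j) v₁ * A.mode Δ₂ (m - n + j) v₂ -
      (-1 : ℂ) ^ (n + Δ₁ - 1) • (A.mode Δ₂ (m + Δ₁ - j - 1) v₂ * A.mode Δ₁ (j - Δ₁ + 1) v₁))

/-- The difference of `J_m(J_n(v₁)v₂)` and the `K`-th partial sum of the associativity formula. -/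
def assocSeq (Δ₁ Δ₂ : ℕ) (v₁ v₂ : V) (m n : ℤ) (K : ℕ) : A.Env :=
  A.mode (Δ₂ - n) m (A.J n v₁ v₂) - ∑ j ∈ Finset.range K, A.assocTerm Δ₁ Δ₂ v₁ v₂ m n j

lemma assocTerm_mem {Δ₁ Δ₂ : ℕ} {v₁ v₂ : V} (h₁ : v₁ ∈ A.wt Δ₁) (h₂ : v₂ ∈ A.wt Δ₂)
    (m n : ℤ) (j : ℕ) {N : ℤ} (hN : N ≤ m - n + j) (hN' : N ≤ j - Δ₁ + 1) :
    A.assocTerm Δ₁ Δ₂ v₁ v₂ m n j ∈ A.envTop m N := by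
  have a := A.mul_mem_envTop (A.mode_mem_envFil h₁ (n - j)) (A.mode_mem_envFil h₂ (m - n + j)) hN
  have b := A.mul_mem_envTop (A.mode_mem_envFil h₂ (m + Δ₁ - j - 1))
    (A.mode_mem_envFil h₁ (j - Δ₁ + 1)) hN'
  rw [show n - (j : ℤ) + (m - n + j) = m by ring] at a
  rw [show m + (Δ₁ : ℤ) - j - 1 + (j - Δ₁ + 1) = m by ring] at b
  exact Submodule.smul_mem _ _ (sub_mem a (Submodule.smul_mem _ _ b))

lemma assocSeq_mem {Δ₁ Δ₂ : ℕ} {v₁ v₂ : V} (h₁ : v₁ ∈ A.wt Δ₁) (h₂ : v₂ ∈ A.wt Δ₂)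
    (m n : ℤ) : A.assocSeq Δ₁ Δ₂ v₁ v₂ m n ∈ A.cauchyFil m := by
  constructor
  · intro K
    refine sub_mem (A.mode_J_mem_envFil h₂ m n) (sum_mem fun j _ => ?_)
    exact A.envTop_le_envFil _ _ (A.assocTerm_mem h₁ h₂ m n j (min_le_left _ _) (min_le_right _ _))
  · intro N
    have key : ∀ i j : ℕ, (N - (m - n)).toNat + (N + Δ₁).toNat ≤ i → i ≤ j →
        A.assocSeq Δ₁ Δ₂ v₁ v₂ m n i - A.assocSeq Δ₁ Δ₂ v₁ v₂ m n j ∈ A.envTop m N := by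
      intro i j hi hij
      simp only [assocSeq, sub_sub_sub_cancel_left]
      rw [← Finset.sum_Ico_eq_sub _ hij]
      refine sum_mem fun k hk => ?_
      have := (Finset.mem_Ico.1 hk).1
      exact A.assocTerm_mem h₁ h₂ m n k (by omega) (by omega)
    refine ⟨(N - (m - n)).toNat + (N + Δ₁).toNat, fun i hi j hj => ?_⟩
    rcases le_total i j with h | h
    · exact key i j hi h
    · rw [← neg_sub]
      exact neg_mem (key j i hj h)

/-! ### The current algebra -/

/-- The generators of the ideal `𝔅(V)`: `J_0(|0⟩) - 1` and the associativity relations. -/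
def relGens : Set A.CEnv :=
  {x | x = A.cmode A.vac_mem 0 - 1} ∪
  {x | ∃ (Δ₁ Δ₂ : ℕ) (v₁ v₂ : V) (h₁ : v₁ ∈ A.wt Δ₁) (h₂ : v₂ ∈ A.wt Δ₂) (m n : ℤ),
    x = A.toCEnv (A.assocSeq Δ₁ Δ₂ v₁ v₂ m n) ⟨m, A.assocSeq_mem h₁ h₂ m n⟩}

/-- A left ideal `I` of `Û(𝔤(V))` is closed if `I ∩ F^p Û(𝔤(V))` is closed in `F^p Û(𝔤(V))` for
all `p`, with respect to the topology in which the `F^p_N Û(𝔤(V))` form a basis of neighbourhoods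
of zero. -/
def IsClosedIdeal (I : Ideal A.CEnv) : Prop :=
  ∀ (p : ℤ), ∀ x ∈ A.cenvFil p,
    (∀ N : ℤ, ∃ b ∈ I, b ∈ A.cenvFil p ∧ x - b ∈ A.cenvTop p N) → x ∈ I

/-- The ideal `𝔅(V)`: the (closed) two-sided ideal of the complete algebra `Û(𝔤(V))` generated by
`J_0(|0⟩) - 1` and the associativity relations. -/
def relIdeal : Ideal A.CEnv :=
  sInf {I | I.IsTwoSided ∧ A.IsClosedIdeal I ∧ A.relGens ⊆ I}

instance : A.relIdeal.IsTwoSided where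
  mul_mem_of_left := by
    intro a b ha
    refine Submodule.mem_sInf.2 fun I hI => ?_
    have := hI.1
    exact Ideal.mul_mem_right b I (Submodule.mem_sInf.1 ha I hI)

/-- The current algebra `𝒰(V) = Û(𝔤(V)) / 𝔅(V)`. -/
def CurrentAlgebra : Type u := A.CEnv ⧸ A.relIdeal

instance : Ring A.CurrentAlgebra := inferInstanceAs (Ring (A.CEnv ⧸ A.relIdeal))
instance : Algebra ℂ A.CurrentAlgebra := inferInstanceAs (Algebra ℂ (A.CEnv ⧸ A.relIdeal))

/-- The projection `Û(𝔤(V)) → 𝒰(V)`. -/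
def toCurrent : A.CEnv →ₐ[ℂ] A.CurrentAlgebra := Ideal.Quotient.mkₐ ℂ A.relIdeal

/-- The filtration `F^p 𝒰(V)`, the image of `F^p Û(𝔤(V))`. -/
def fil (p : ℤ) : Submodule ℂ A.CurrentAlgebra := (A.cenvFil p).map A.toCurrent.toLinearMap

/-- The element `J_n(v)`, `v ∈ V_Δ`, of `𝒰(V)`. -/
def umode {Δ : ℕ} {v : V} (hv : v ∈ A.wt Δ) (n : ℤ) : A.CurrentAlgebra :=
  A.toCurrent (A.cmode hv n)

lemma mul_mem_fil {p q : ℤ} {x y : A.CurrentAlgebra} (hx : x ∈ A.fil p) (hy : y ∈ A.fil q) :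
    x * y ∈ A.fil (p + q) := by
  obtain ⟨_, ⟨x, hx, rfl⟩, rfl⟩ := hx
  obtain ⟨_, ⟨y, hy, rfl⟩, rfl⟩ := hy
  refine ⟨_, ⟨x * y, A.mul_mem_cauchyFil hx hy, rfl⟩, ?_⟩
  simp only [AlgHom.toLinearMap_apply, map_mul]

lemma algebraMap_mem_fil (r : ℂ) : algebraMap ℂ A.CurrentAlgebra r ∈ A.fil 0 := by
  refine ⟨algebraMap ℂ A.CEnv r, ⟨algebraMap ℂ A.cauchyAlg r, ?_, ?_⟩, ?_⟩
  · refine A.const_mem_cauchyFil (x := algebraMap ℂ A.Env r) ?_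
    rw [Algebra.algebraMap_eq_smul_one]
    exact Submodule.smul_mem _ r (A.one_mem_envFil le_rfl)
  · simp only [AlgHom.toLinearMap_apply, AlgHom.commutes]
  · simp only [AlgHom.toLinearMap_apply, AlgHom.commutes]

/-- The subalgebra `F^0 𝒰(V)`. -/
def filZero : Subalgebra ℂ A.CurrentAlgebra where
  carrier := A.fil 0
  mul_mem' {x y} hx hy := by
    have h := A.mul_mem_fil (p := 0) (q := 0) (x := x) (y := y) hx hy
    rwa [add_zero] at h
  add_mem' {x y} hx hy := (A.fil 0).add_mem (x := x) (y := y) hx hy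
  algebraMap_mem' r := A.algebraMap_mem_fil r

/-! ### The zero-mode algebra -/

/-- The left ideal `𝔍 = 𝒰(V) F^1 𝒰(V)`. -/
def leftIdealJ : Ideal A.CurrentAlgebra := Ideal.span (A.fil 1 : Set A.CurrentAlgebra)

lemma leftIdealJ_mul_mem {x a : A.CurrentAlgebra} (hx : x ∈ A.leftIdealJ) (ha : a ∈ A.fil 0) :
    x * a ∈ A.leftIdealJ := by
  refine Submodule.span_induction (p := fun x _ => x * a ∈ A.leftIdealJ) ?_ ?_ ?_ ?_ hx
  · intro y hy
    refine Submodule.subset_span ?_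
    have h := A.mul_mem_fil (p := 1) (q := 0) hy ha
    rwa [add_zero] at h
  · simp
  · intro y z _ _ hy hz
    rw [add_mul]
    exact add_mem hy hz
  · intro b y _ hy
    rw [smul_eq_mul, mul_assoc]
    exact Ideal.mul_mem_left _ b hy

/-- The two-sided ideal `𝔍⁰ = 𝔍 ∩ F^0 𝒰(V)` of `F^0 𝒰(V)`. -/
def idealJZero : Ideal A.filZero := A.leftIdealJ.comap A.filZero.val

instance : A.idealJZero.IsTwoSided where
  mul_mem_of_left := by
    intro a b ha
    exact A.leftIdealJ_mul_mem (x := (a : A.CurrentAlgebra)) ha b.2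

/-- The zero-mode algebra `A_0(V) = F^0 𝒰(V) / 𝔍⁰`. -/
def ZeroMode : Type u := A.filZero ⧸ A.idealJZero

instance : Ring A.ZeroMode := inferInstanceAs (Ring (A.filZero ⧸ A.idealJZero))
instance : Algebra ℂ A.ZeroMode := inferInstanceAs (Algebra ℂ (A.filZero ⧸ A.idealJZero))

/-- The projection `F^0 𝒰(V) → A_0(V)`. -/
def toZeroMode : A.filZero →ₐ[ℂ] A.ZeroMode := Ideal.Quotient.mkₐ ℂ A.idealJZero

/-! ### Modules -/

/-- The subspace `F^0 𝒰(V) m`. -/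
def filZeroOrbit {M : Type w} [AddCommGroup M] [Module ℂ M] [Module A.CurrentAlgebra M]
    [IsScalarTower ℂ A.CurrentAlgebra M] (m : M) : Submodule ℂ M :=
  (A.fil 0).map (LinearMap.toSpanSingleton A.CurrentAlgebra M m |>.restrictScalars ℂ)

section Modules

variable (M : Type w) [AddCommGroup M] [Module ℂ M] [Module A.CurrentAlgebra M]
  [IsScalarTower ℂ A.CurrentAlgebra M]

/-- A `𝒰(V)`-module is a `V`-module if it is finitely generated and all `F^0 𝒰(V) m` are finite
dimensional. -/
structure IsVModule : Prop where
  finite : Module.Finite A.CurrentAlgebra M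
  finiteDimensional : ∀ m : M, FiniteDimensional ℂ (A.filZeroOrbit m)

/-- Simple `V`-modules. -/
structure IsSimpleVModule : Prop where
  isVModule : A.IsVModule M
  isSimple : IsSimpleModule A.CurrentAlgebra M

/-- The action of `T(0)`. -/
def actT0 : Module.End ℂ M := Algebra.lsmul ℂ ℂ M (A.umode A.T_mem 0)

/-- The generalized eigenspace `M_(h) = {m | (T(0) - h)^k m = 0 for some k > 0}`. -/
def genEigenspace (h : ℂ) : Submodule ℂ M := (A.actT0 M).maxGenEigenspace h

/-- The set `⋃_i (h_i + ℤ_{≥0})` of a finite set of complex numbers `h_i`. -/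
def cone (S : Finset ℂ) : Set ℂ := {h | ∃ s ∈ S, ∃ n : ℕ, h = s + n}

/-- `M = ⨁_{h ∈ P(M)} M_(h)` with `P(M) = ⋃_i (h_i + ℤ_{≥0})` for finitely many complex numbers
`h_i` whose differences are not integers. -/
def IsGradedModule : Prop :=
  ∃ S : Finset ℂ, (∀ s ∈ S, ∀ t ∈ S, s ≠ t → ∀ n : ℤ, s - t ≠ n) ∧
    DirectSum.IsInternal (fun h : cone S => A.genEigenspace M h)

/-- The space of highest weight vectors `ℋ𝒲(M) = {m | J_n(v) m = 0 for all n > 0}`. -/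
def HW : Submodule ℂ M where
  carrier := {m | ∀ (Δ : ℕ) (v : V) (hv : v ∈ A.wt Δ) (n : ℤ), 0 < n → A.umode hv n • m = 0}
  zero_mem' _ _ _ _ _ := smul_zero _
  add_mem' hx hy Δ v hv n hn := by rw [smul_add, hx Δ v hv n hn, hy Δ v hv n hn, add_zero]
  smul_mem' c x hx Δ v hv n hn := by rw [smul_comm, hx Δ v hv n hn, smul_zero]

end Modules

section Induced

variable (W : Type w) [AddCommGroup W] [Module A.ZeroMode W]

/-- The relations `u a ⊗ w = u ⊗ a w` for `a ∈ F^0 𝒰(V)`, which acts on `W` through `A_0(V)`. -/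
def inducedRel : Submodule A.CurrentAlgebra (A.CurrentAlgebra ⊗[ℤ] W) :=
  Submodule.span A.CurrentAlgebra {x | ∃ (u : A.CurrentAlgebra) (a : A.filZero) (y : W),
    x = (u * (a : A.CurrentAlgebra)) ⊗ₜ[ℤ] y - u ⊗ₜ[ℤ] (A.toZeroMode a • y)}

/-- The induced module `M(W) = 𝒰(V) ⊗_{F^0 𝒰(V)} W`. -/
abbrev Induced : Type (max u w) := (A.CurrentAlgebra ⊗[ℤ] W) ⧸ A.inducedRel W

/-- `N` is a proper `V`-submodule of `M(W)`. -/
def IsProperVSubmodule (N : Submodule A.CurrentAlgebra (A.Induced W)) : Prop :=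
  A.IsVModule N ∧ N ≠ ⊤

/-- The sum `N(W)` of all proper `V`-submodules of `M(W)`. -/
def maxSub : Submodule A.CurrentAlgebra (A.Induced W) :=
  sSup {N | A.IsProperVSubmodule W N}

/-- `L(W) = M(W) / N(W)`. -/
abbrev LMod : Type (max u w) := A.Induced W ⧸ A.maxSub W

end Induced

/-! ### Categories -/

/-- The category `ℳod(V)` of `V`-modules. -/
abbrev VModCat := ObjectProperty.FullSubcategory
  (fun M : ModuleCat.{w} A.CurrentAlgebra => A.IsVModule M)

/-- The category `ℳod(A_0(V))` of finite dimensional `A_0(V)`-modules. -/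
abbrev ZeroModCat := ObjectProperty.FullSubcategory
  (fun W : ModuleCat.{w} A.ZeroMode => FiniteDimensional ℂ W)

end ChiralVOA

end

/-!
Write `𝒰` for the current algebra. Everything rests on the fact that finitely many modes suffice.
By `C_2`-finiteness there is a `Δ₀` such that all vectors of weight at least `Δ₀` lie in `C_2(V)`;
the generating modes are the `J_d(u)` and `J_{-d}(u)` for `1 ≤ d ≤ Δ₀` and `u` in a basis of
`⨁_{Δ < Δ₀} V_Δ`. The associativity formula splits a mode of an element `J_{-Δ-p}(a)b` of `C_2(V)` into
products of modes of `a` and `b`, whose weights add up to less, and commutators with `T(1)` and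
`T(-1)` reach the modes of large degree of vectors of small weight. So every monomial of positive
degree is, up to arbitrarily small terms, a combination of terms ending in one of the generating
modes (`um_mem_lgen`, `emb_mem_lgen`), with a similar statement for negative degrees. As the
generating modes are finite in number, the coefficients can be summed in the complete algebra
(`exists_coeff_of_mem_top`); hence the left ideal `𝔍` is open.

In degree zero the same induction shows that `F^0 𝒰` is spanned, modulo a neighbourhood of zero
contained in `𝔍`, by the `J_0(v)` with `v` of weight at most `Δ₀`
(`exists_finiteDimensional_fil_zero_le`), so `A_0(V)` is finite dimensional and has finitely many
simple modules, which all occur in a composition series of `A_0(V)`.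

In a module `M` in which all `F^0 𝒰 m` are finite dimensional, the generating modes of positive
degree act nilpotently on each vector, because they shift the eigenvalues of `T(0)`. Two
consequences carry the structure theory. Finite dimensional subspaces generate only finite
dimensional pieces `F^p 𝒰 X`, so a `V`-module has finite dimensional generalized eigenspaces
(`IsVModule.finiteDimensional_genEigenspace`). And `M ≠ 0` contains a highest weight vector, on
which `T(0)` has one of the finitely many eigenvalues it has in `A_0(V)`. Applied to subquotients
this says that a submodule is determined within a larger one by its generalized eigenspaces for
these eigenvalues, so `V`-modules have finite length (`IsVModule.isNoetherian_isArtinian`).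

Finally, `𝒰` is the sum of `F^0 𝒰` and the subspace `negPart` spanned by `𝔍` and the monomials of
negative degree; they meet in `𝔍⁰`, as one sees from the eigenvalues of `ad T(0)` on `𝒰 / 𝔍`. The
resulting projection `𝒰 → A_0(V)` yields a projection `M(W) → W`. For simple `W`, on which `T(0)`
acts by a scalar, a submodule of `M(W)` not killed by this projection contains a nonzero element
of `1 ⊗ W` and is everything (`inducedProj_eq_zero`). So there is a largest proper submodule, the
highest weight vectors of `L(W)` are the classes of `1 ⊗ W` (`exists_unit_of_mem_HW`), and `W` is
recovered from `L(W)`.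
-/

noncomputable section

namespace ChiralVOA

variable {V : Type u} [AddCommGroup V] [Module ℂ V] (A : ChiralVOA V)


/-! ### The enveloping algebra: modes, commutators and truncation -/

/-- The generator map `V ⊗ ℂ((ξ)) → U(𝔤(V))`, of which `cur` is the uncurried form. -/
def curLin : V ⊗[ℂ] ℂ⸨X⸩ →ₗ[ℂ] A.Env := A.envMk.toLinearMap ∘ₗ TensorAlgebra.ι ℂ

lemma cur_eq_curLin (v : V) (f : ℂ⸨X⸩) : A.cur v f = A.curLin (v ⊗ₜ f) := rfl

lemma cur_add_left (v w : V) (f : ℂ⸨X⸩) : A.cur (v + w) f = A.cur v f + A.cur w f := by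
  simp only [cur_eq_curLin, TensorProduct.add_tmul, map_add]

lemma cur_add_right (v : V) (f g : ℂ⸨X⸩) : A.cur v (f + g) = A.cur v f + A.cur v g := by
  simp only [cur_eq_curLin, TensorProduct.tmul_add, map_add]

lemma cur_smul_left (c : ℂ) (v : V) (f : ℂ⸨X⸩) : A.cur (c • v) f = c • A.cur v f := by
  simp only [cur_eq_curLin, ← TensorProduct.smul_tmul', map_smul]

lemma cur_smul_right (c : ℂ) (v : V) (f : ℂ⸨X⸩) : A.cur v (c • f) = c • A.cur v f := by
  simp only [cur_eq_curLin, TensorProduct.tmul_smul, map_smul]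

lemma cur_zero_left (f : ℂ⸨X⸩) : A.cur 0 f = 0 := by
  simp only [cur_eq_curLin, TensorProduct.zero_tmul, map_zero]

lemma cur_translation (v : V) (f : ℂ⸨X⸩) :
    A.cur (A.J (-1) A.T v) f = -A.cur v (LaurentSeries.hasseDeriv ℂ 1 f) := by
  have h := RingQuot.mkAlgHom_rel ℂ (EnvRel.nabla (A := A) v f)
  rw [map_zero, TensorAlgebra.ι .. |>.map_add, map_add] at h
  exact eq_neg_of_add_eq_zero_left h

lemma cur_commutator {Δ₁ Δ₂ : ℕ} {v₁ v₂ : V} (h₁ : v₁ ∈ A.wt Δ₁) (h₂ : v₂ ∈ A.wt Δ₂)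
    (f₁ f₂ : ℂ⸨X⸩) :
    A.cur v₁ f₁ * A.cur v₂ f₂ - A.cur v₂ f₂ * A.cur v₁ f₁ =
      ∑ j ∈ Finset.range (Δ₁ + Δ₂),
        A.cur (A.J (j - Δ₁ + 1) v₁ v₂) (LaurentSeries.hasseDeriv ℂ j f₁ * f₂) := by
  have h := RingQuot.mkAlgHom_rel ℂ (EnvRel.bracket (A := A) Δ₁ Δ₂ v₁ v₂ h₁ h₂ f₁ f₂)
  rw [map_sub, map_mul, map_mul, map_sum, map_sum] at h
  exact h

/-- Homogeneity for an integral weight: `v` lies in `V_k`, where `V_k = 0` for `k < 0`. -/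
def IsHom (k : ℤ) (v : V) : Prop := (∃ l : ℕ, (l : ℤ) = k ∧ v ∈ A.wt l) ∨ v = 0

variable {A}

lemma isHom_of_mem {l : ℕ} {v : V} (h : v ∈ A.wt l) : A.IsHom l v := Or.inl ⟨l, rfl, h⟩

lemma IsHom.J {k : ℤ} {x : V} (h : A.IsHom k x) (n : ℤ) (v : V) : A.IsHom (k - n) (A.J n v x) := by
  rcases h with ⟨l, rfl, hv⟩ | rfl
  · rcases lt_or_ge ((l : ℤ) - n) 0 with h | h
    · exact Or.inr (A.J_eq_zero n v l h x hv)
    · obtain ⟨m, hm⟩ := Int.eq_ofNat_of_zero_le h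
      exact Or.inl ⟨m, hm.symm, A.J_mem n v l m hm.symm x hv⟩
  · exact Or.inr (map_zero _)

variable (A)

lemma mode_zero (Δ n : ℤ) : A.mode Δ n 0 = 0 := A.cur_zero_left _

lemma mode_add (Δ n : ℤ) (v w : V) : A.mode Δ n (v + w) = A.mode Δ n v + A.mode Δ n w :=
  A.cur_add_left _ _ _

lemma mode_smul (Δ n : ℤ) (c : ℂ) (v : V) : A.mode Δ n (c • v) = c • A.mode Δ n v :=
  A.cur_smul_left _ _ _

lemma IsHom.mode_mem_envFil {A : ChiralVOA V} {k : ℤ} {v : V} (h : A.IsHom k v) (n : ℤ) :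
    A.mode k n v ∈ A.envFil n := by
  rcases h with ⟨l, rfl, hv⟩ | rfl
  · exact A.mode_mem_envFil hv n
  · rw [mode_zero]; exact zero_mem _

lemma smul_single_one (c : ℂ) (n : ℤ) :
    c • (HahnSeries.single n 1 : ℂ⸨X⸩) = HahnSeries.single n c := by
  ext k
  rcases eq_or_ne k n with rfl | h
  · simp
  · simp [HahnSeries.coeff_single_of_ne h]

/-- The commutator formula for modes, in the enveloping algebra. -/
lemma mode_commutator {Δ₁ Δ₂ : ℕ} {v₁ v₂ : V} (h₁ : v₁ ∈ A.wt Δ₁) (h₂ : v₂ ∈ A.wt Δ₂)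
    (m n : ℤ) :
    A.mode Δ₁ m v₁ * A.mode Δ₂ n v₂ - A.mode Δ₂ n v₂ * A.mode Δ₁ m v₁ =
      ∑ j ∈ Finset.range (Δ₁ + Δ₂), ((Ring.choose (m + Δ₁ - 1) j : ℤ) : ℂ) •
        A.mode (Δ₂ - (j - Δ₁ + 1)) (m + n) (A.J (j - Δ₁ + 1) v₁ v₂) := by
  rw [mode, mode, A.cur_commutator h₁ h₂]
  refine Finset.sum_congr rfl fun j _ => ?_
  rw [LaurentSeries.hasseDeriv_single, HahnSeries.single_mul_single, mode, ← cur_smul_right]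
  rw [smul_single_one]
  congr 2
  · ring_nf
  · simp

lemma mode_translation (Δ : ℤ) (v : V) (n : ℤ) :
    A.mode (Δ + 1) n (A.J (-1) A.T v) = (-((n : ℂ) + Δ)) • A.mode Δ n v := by
  rw [mode, cur_translation, LaurentSeries.hasseDeriv_single, mode, ← cur_smul_right,
    ← neg_one_smul ℂ, ← cur_smul_right, smul_single_one,
    show n + (Δ + 1) - 1 - ((1 : ℕ) : ℤ) = n + Δ - 1 by push_cast; ring, Ring.choose_one_right',
    pow_one, zsmul_one, ← smul_single_one (Int.cast _), smul_smul, smul_single_one]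
  congr 2
  push_cast
  ring

/-- Every vector is a sum of homogeneous ones. -/
lemma iSup_wt : ⨆ Δ, A.wt Δ = ⊤ := A.isInternal.submodule_iSup_eq_top

lemma exists_mem_envFil (x : A.Env) : ∃ p, x ∈ A.envFil p := by
  have hadd : ∀ x y : A.Env, (∃ p, x ∈ A.envFil p) → (∃ p, y ∈ A.envFil p) →
      ∃ p, x + y ∈ A.envFil p := by
    rintro x y ⟨p, hx⟩ ⟨q, hy⟩
    exact ⟨min p q, add_mem (A.envFil_anti (min_le_left _ _) hx)
      (A.envFil_anti (min_le_right _ _) hy)⟩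
  obtain ⟨x, rfl⟩ := RingQuot.mkAlgHom_surjective ℂ A.EnvRel x
  change ∃ p, A.envMk x ∈ _
  induction x using TensorAlgebra.induction with
  | algebraMap r =>
    refine ⟨0, ?_⟩
    rw [AlgHom.commutes, Algebra.algebraMap_eq_smul_one]
    exact Submodule.smul_mem _ _ (A.one_mem_envFil le_rfl)
  | ι x =>
    change ∃ p, A.curLin x ∈ _
    induction x using TensorProduct.induction_on with
    | zero => exact ⟨0, by rw [map_zero]; exact zero_mem _⟩
    | add x y hx hy => rw [map_add]; exact hadd _ _ hx hy
    | tmul v f =>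
      have hv : v ∈ ⨆ Δ, A.wt Δ := by rw [iSup_wt]; trivial
      induction hv using Submodule.iSup_induction' with
      | mem Δ v hv =>
        refine ⟨f.order - Δ + 1, A.cur_mem_envFil hv fun k hk => ?_⟩
        exact HahnSeries.coeff_eq_zero_of_lt_order (by omega)
      | zero => exact ⟨0, by rw [TensorProduct.zero_tmul, map_zero]; exact zero_mem _⟩
      | add v w _ _ hv hw => rw [TensorProduct.add_tmul, map_add]; exact hadd _ _ hv hw
  | mul x y hx hy =>
    obtain ⟨p, hx⟩ := hx
    obtain ⟨q, hy⟩ := hy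
    exact ⟨p + q, by rw [map_mul]; exact A.envFil_mul_le p q (Submodule.mul_mem_mul hx hy)⟩
  | add x y hx hy => rw [map_add]; exact hadd _ _ hx hy


/-- The monomials `J_{n₁}(v₁) ⋯ J_{n_r}(v_r)` in `r` modes of homogeneous vectors, of degree
`d = n₁ + ⋯ + n_r`, in the enveloping algebra. -/
inductive IsMonomial : ℕ → ℤ → A.Env → Prop
  | nil : IsMonomial 0 0 1
  | cons {Δ : ℕ} {v : V} (hv : v ∈ A.wt Δ) (n : ℤ) {r : ℕ} {d : ℤ} {x : A.Env}
      (hx : IsMonomial r d x) : IsMonomial (r + 1) (n + d) (A.mode Δ n v * x)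

variable {A} in
lemma IsMonomial.mul {r s : ℕ} {d e : ℤ} {x y : A.Env} (hx : A.IsMonomial r d x)
    (hy : A.IsMonomial s e y) : A.IsMonomial (r + s) (d + e) (x * y) := by
  induction hx with
  | nil => simpa using hy
  | cons hv n _ ih =>
    rw [mul_assoc, add_assoc n, Nat.add_right_comm]
    exact .cons hv n ih

variable {A} in
lemma IsMonomial.mem_envFil {r : ℕ} {d : ℤ} {x : A.Env} (hx : A.IsMonomial r d x) :
    x ∈ A.envFil d := by
  induction hx with
  | nil => exact A.one_mem_envFil le_rfl
  | cons hv n _ ih => exact A.envFil_mul_le _ _ (Submodule.mul_mem_mul (A.mode_mem_envFil hv n) ih)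

/-- The span of the monomials of degree at least `p` in the modes. -/
def envPoly (p : ℤ) : Submodule ℂ A.Env :=
  Submodule.span ℂ {x | ∃ r d, p ≤ d ∧ A.IsMonomial r d x}

lemma envPoly_le_envFil (p : ℤ) : A.envPoly p ≤ A.envFil p :=
  Submodule.span_le.2 fun _ ⟨_, _, hd, hx⟩ => A.envFil_anti hd hx.mem_envFil

lemma envPoly_mul_le (p q : ℤ) : A.envPoly p * A.envPoly q ≤ A.envPoly (p + q) := by
  rw [envPoly, envPoly, Submodule.span_mul_span]
  refine Submodule.span_le.2 ?_
  rintro _ ⟨x, ⟨r, d, hd, hx⟩, y, ⟨s, e, he, hy⟩, rfl⟩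
  exact Submodule.subset_span ⟨_, _, add_le_add hd he, hx.mul hy⟩

/-- A current is a finite combination of modes up to a current of high filtration degree. -/
lemma genFil_subset_envPoly_sup (p N : ℤ) :
    A.genFil p ⊆ (A.envPoly p ⊔ A.envFil N : Submodule ℂ A.Env) := by
  rintro _ ⟨Δ, v, f, hv, hf, rfl⟩
  set g : ℂ⸨X⸩ := ∑ k ∈ Finset.Ico (p + Δ - 1) (N + Δ - 1), HahnSeries.single k (f.coeff k) with hg
  have hfg : A.cur v f = A.cur v g + A.cur v (f - g) := by
    rw [← cur_add_right, add_sub_cancel]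
  rw [hfg]
  refine Submodule.add_mem_sup ?_ (A.cur_mem_envFil hv fun k hk => ?_)
  · rw [hg, cur_eq_curLin, TensorProduct.tmul_sum, map_sum]
    refine sum_mem fun k hk => ?_
    rw [← smul_single_one, TensorProduct.tmul_smul, map_smul]
    refine Submodule.smul_mem _ _ (Submodule.subset_span ⟨1, k - Δ + 1 + 0, ?_, ?_⟩)
    · have := (Finset.mem_Ico.1 hk).1; omega
    · have h := IsMonomial.cons hv (k - Δ + 1) (IsMonomial.nil (A := A))
      rw [mul_one, mode, show k - (Δ : ℤ) + 1 + Δ - 1 = k by ring] at h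
      exact h
  · rw [HahnSeries.coeff_sub, hg, HahnSeries.coeff_sum]
    by_cases hk' : p + Δ - 1 ≤ k
    · rw [Finset.sum_eq_single k]
      · simp
      · intro j _ hj
        exact HahnSeries.coeff_single_of_ne hj.symm
      · intro h
        exact absurd (Finset.mem_Ico.2 ⟨hk', hk⟩) h
    · rw [hf k (by omega), Finset.sum_eq_zero, sub_zero]
      intro j hj
      exact HahnSeries.coeff_single_of_ne (by have := (Finset.mem_Ico.1 hj).1; omega)

lemma lieFil_le_envPoly_sup (p N : ℤ) : A.lieFil p ≤ A.envPoly p ⊔ A.envFil N :=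
  Submodule.span_le.2 (A.genFil_subset_envPoly_sup p N)

/-- Polynomials in the modes are dense in the enveloping algebra for the degree filtration. -/
lemma envFil_le_envPoly_sup (p N : ℤ) : A.envFil p ≤ A.envPoly p ⊔ A.envFil N := by
  have key : ∀ l : List (ℤ × A.Env), (∀ a ∈ l, a.2 ∈ A.lieFil a.1) → ∀ N : ℤ,
      (l.map Prod.snd).prod ∈ A.envPoly (l.map Prod.fst).sum ⊔ A.envFil N := by
    intro l
    induction l with
    | nil =>
      intro _ N
      exact Submodule.mem_sup_left (Submodule.subset_span ⟨0, 0, le_rfl, .nil⟩)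
    | cons a l ih =>
      intro hl N
      have hl' : ∀ b ∈ l, b.2 ∈ A.lieFil b.1 := fun b hb => hl b (List.mem_cons_of_mem _ hb)
      simp only [List.map_cons, List.prod_cons, List.sum_cons]
      set s := (l.map Prod.fst).sum
      have h₂ : (l.map Prod.snd).prod ∈ A.envFil s :=
        Submodule.subset_span ⟨l, hl', le_rfl, rfl⟩
      obtain ⟨y, hy, z, hz, hyz⟩ := Submodule.mem_sup.1
        (A.lieFil_le_envPoly_sup a.1 (N - s) (hl a List.mem_cons_self))
      obtain ⟨y', hy', z', hz', hyz'⟩ := Submodule.mem_sup.1 (ih hl' (N - a.1))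
      have e : a.2 * (l.map Prod.snd).prod =
          y * y' + (y * z' + z * (l.map Prod.snd).prod) := by
        rw [← hyz]
        conv_lhs => rw [add_mul]
        conv_lhs => arg 1; rw [← hyz']
        rw [mul_add, add_assoc]
      rw [e]
      refine Submodule.add_mem_sup (A.envPoly_mul_le _ _ (Submodule.mul_mem_mul hy hy'))
        (add_mem ?_ ?_)
      · have h := A.envFil_mul_le _ _
          (Submodule.mul_mem_mul (A.envPoly_le_envFil _ hy) hz')
        rwa [add_sub_cancel] at h
      · have h := A.envFil_mul_le _ _ (Submodule.mul_mem_mul hz h₂)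
        rwa [sub_add_cancel] at h
  refine Submodule.span_le.2 ?_
  rintro _ ⟨l, hl, hp, rfl⟩
  refine (sup_le_sup_right ?_ _ : _ ≤ A.envPoly p ⊔ A.envFil N) (key l hl N)
  exact Submodule.span_mono fun _ ⟨r, d, hd, hx⟩ => ⟨r, d, hp.trans hd, hx⟩

lemma envFil_le_envTop {p q N : ℤ} (hp : p ≤ q) (hN : N ≤ q) : A.envFil q ≤ A.envTop p N := by
  intro x hx
  have h := A.mul_mem_envTop (A.one_mem_envFil (p := p - q) (by omega)) hx hN
  rwa [one_mul, sub_add_cancel] at h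

/-! ### The topology of the current algebra -/

/-- The class in `𝒰(V)` of a Cauchy sequence. -/
def cls : A.cauchyAlg →ₐ[ℂ] A.CurrentAlgebra := A.toCurrent.comp A.cenvMk

/-- The map `U(𝔤(V)) → 𝒰(V)`. -/
def emb : A.Env →ₐ[ℂ] A.CurrentAlgebra :=
  A.cls.comp ((Pi.constAlgHom ℂ ℕ A.Env).codRestrict A.cauchyAlg fun x =>
    (A.exists_mem_envFil x).imp fun _ hx => A.const_mem_cauchyFil hx)

/-- The image in `𝒰(V)` of `F^p_N Û`; these subspaces form a basis of neighbourhoods of zero in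
`F^p 𝒰(V)`. -/
def top (p N : ℤ) : Submodule ℂ A.CurrentAlgebra :=
  Submodule.map A.cls.toLinearMap
    { carrier := {x | (x : ℕ → A.Env) ∈ A.cauchyFil p ∧
        ∃ K : ℕ, ∀ i ≥ K, (x : ℕ → A.Env) i ∈ A.envTop p N}
      zero_mem' := ⟨zero_mem _, 0, fun _ _ => zero_mem _⟩
      add_mem' := by
        rintro x y ⟨hx, K, hK⟩ ⟨hy, L, hL⟩
        exact ⟨add_mem hx hy, max K L, fun i hi =>
          add_mem (hK i (le_of_max_le_left hi)) (hL i (le_of_max_le_right hi))⟩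
      smul_mem' := by
        rintro c x ⟨hx, K, hK⟩
        exact ⟨Submodule.smul_mem _ c hx, K, fun i hi => Submodule.smul_mem _ c (hK i hi)⟩ }

lemma mem_top {p N : ℤ} {x : A.CurrentAlgebra} :
    x ∈ A.top p N ↔ ∃ σ : A.cauchyAlg, ((σ : ℕ → A.Env) ∈ A.cauchyFil p ∧
      ∃ K : ℕ, ∀ i ≥ K, (σ : ℕ → A.Env) i ∈ A.envTop p N) ∧ A.cls σ = x := Iff.rfl

lemma mem_fil {p : ℤ} {x : A.CurrentAlgebra} :
    x ∈ A.fil p ↔ ∃ σ : A.cauchyAlg, (σ : ℕ → A.Env) ∈ A.cauchyFil p ∧ A.cls σ = x := by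
  constructor
  · rintro ⟨_, ⟨σ, hσ, rfl⟩, rfl⟩
    exact ⟨σ, hσ, rfl⟩
  · rintro ⟨σ, hσ, rfl⟩
    exact ⟨_, ⟨σ, hσ, rfl⟩, rfl⟩

lemma exists_mem_fil (x : A.CurrentAlgebra) : ∃ p, x ∈ A.fil p := by
  obtain ⟨x, rfl⟩ := Ideal.Quotient.mk_surjective x
  obtain ⟨⟨σ, p, hσ⟩, rfl⟩ := Ideal.Quotient.mk_surjective x
  exact ⟨p, A.mem_fil.2 ⟨⟨σ, p, hσ⟩, hσ, rfl⟩⟩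

lemma fil_anti {p q : ℤ} (h : p ≤ q) : A.fil q ≤ A.fil p := by
  intro x hx
  obtain ⟨σ, hσ, rfl⟩ := A.mem_fil.1 hx
  exact A.mem_fil.2 ⟨σ, A.cauchyFil_anti h hσ, rfl⟩

lemma top_le_fil (p N : ℤ) : A.top p N ≤ A.fil p := by
  intro x hx
  obtain ⟨σ, hσ, rfl⟩ := A.mem_top.1 hx
  exact A.mem_fil.2 ⟨σ, hσ.1, rfl⟩

lemma fil_le_top {p q N : ℤ} (hp : p ≤ q) (hN : N ≤ q) : A.fil q ≤ A.top p N := by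
  intro x hx
  obtain ⟨σ, hσ, rfl⟩ := A.mem_fil.1 hx
  exact A.mem_top.2 ⟨σ, ⟨A.cauchyFil_anti hp hσ, 0, fun i _ =>
    A.envFil_le_envTop hp hN (hσ.1 i)⟩, rfl⟩

lemma top_anti_right (p : ℤ) {N N' : ℤ} (h : N ≤ N') : A.top p N' ≤ A.top p N := by
  intro x hx
  obtain ⟨σ, ⟨hσ, K, hK⟩, rfl⟩ := A.mem_top.1 hx
  exact A.mem_top.2 ⟨σ, ⟨hσ, K, fun i hi => A.envTop_anti_right p h (hK i hi)⟩, rfl⟩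

lemma top_anti_left {p p' : ℤ} (h : p ≤ p') (N : ℤ) : A.top p' N ≤ A.top p N := by
  intro x hx
  obtain ⟨σ, ⟨hσ, K, hK⟩, rfl⟩ := A.mem_top.1 hx
  exact A.mem_top.2 ⟨σ, ⟨A.cauchyFil_anti h hσ, K, fun i hi =>
    A.envTop_anti_left h N (hK i hi)⟩, rfl⟩

lemma fil_mul_top {p q N : ℤ} {x y : A.CurrentAlgebra} (hx : x ∈ A.fil p) (hy : y ∈ A.top q N) :
    x * y ∈ A.top (p + q) N := by
  obtain ⟨σ, hσ, rfl⟩ := A.mem_fil.1 hx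
  obtain ⟨τ, ⟨hτ, K, hK⟩, rfl⟩ := A.mem_top.1 hy
  exact A.mem_top.2 ⟨σ * τ, ⟨A.mul_mem_cauchyFil hσ hτ, K, fun i hi =>
    A.envFil_mul_envTop_le _ _ _ (Submodule.mul_mem_mul (hσ.1 i) (hK i hi))⟩, map_mul _ _ _⟩

lemma top_mul_fil {p q N : ℤ} {x y : A.CurrentAlgebra} (hx : x ∈ A.top p N) (hy : y ∈ A.fil q) :
    x * y ∈ A.top (p + q) (N + q) := by
  obtain ⟨σ, ⟨hσ, K, hK⟩, rfl⟩ := A.mem_top.1 hx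
  obtain ⟨τ, hτ, rfl⟩ := A.mem_fil.1 hy
  exact A.mem_top.2 ⟨σ * τ, ⟨A.mul_mem_cauchyFil hσ hτ, K, fun i hi =>
    A.envTop_mul_envFil_le _ _ _ (Submodule.mul_mem_mul (hK i hi) (hτ.1 i))⟩, map_mul _ _ _⟩

lemma fil_mul_fil_top {p q N : ℤ} {x y : A.CurrentAlgebra} (hx : x ∈ A.fil p) (hy : y ∈ A.fil q)
    (hN : N ≤ q) : x * y ∈ A.top (p + q) N := by
  obtain ⟨σ, hσ, rfl⟩ := A.mem_fil.1 hx
  obtain ⟨τ, hτ, rfl⟩ := A.mem_fil.1 hy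
  exact A.mem_top.2 ⟨σ * τ, ⟨A.mul_mem_cauchyFil hσ hτ, 0, fun i _ =>
    A.mul_mem_envTop (hσ.1 i) (hτ.1 i) hN⟩, map_mul _ _ _⟩

lemma emb_mem_fil {p : ℤ} {x : A.Env} (hx : x ∈ A.envFil p) : A.emb x ∈ A.fil p :=
  A.mem_fil.2 ⟨_, A.const_mem_cauchyFil hx, rfl⟩

lemma emb_mem_top {p N : ℤ} {x : A.Env} (hx : x ∈ A.envTop p N) : A.emb x ∈ A.top p N :=
  A.mem_top.2 ⟨_, ⟨A.const_mem_cauchyFil (A.envTop_le_envFil _ _ hx), 0, fun _ _ => hx⟩, rfl⟩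

/-- A Cauchy sequence converges to its class. -/
lemma exists_cls_sub_emb_mem {p : ℤ} {σ : A.cauchyAlg} (hσ : (σ : ℕ → A.Env) ∈ A.cauchyFil p)
    (N : ℤ) : ∃ K : ℕ, ∀ i ≥ K, A.cls σ - A.emb ((σ : ℕ → A.Env) i) ∈ A.top p N := by
  obtain ⟨K, hK⟩ := hσ.2 N
  refine ⟨K, fun i hi => ?_⟩
  rw [emb, AlgHom.comp_apply, ← map_sub]
  exact A.mem_top.2 ⟨_, ⟨sub_mem hσ (A.const_mem_cauchyFil (hσ.1 i)), K, fun j hj =>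
    hK j hj i hi⟩, rfl⟩

/-- The image of `U(𝔤(V))` is dense. -/
lemma exists_emb_of_mem_top {p N : ℤ} {x : A.CurrentAlgebra} (hx : x ∈ A.top p N) (N' : ℤ) :
    ∃ e ∈ A.envTop p N, x - A.emb e ∈ A.top p N' := by
  obtain ⟨σ, ⟨hσ, K, hK⟩, rfl⟩ := A.mem_top.1 hx
  obtain ⟨L, hL⟩ := A.exists_cls_sub_emb_mem hσ N'
  exact ⟨_, hK _ (le_max_left K L), hL _ (le_max_right K L)⟩

lemma exists_emb_of_mem_fil {p : ℤ} {x : A.CurrentAlgebra} (hx : x ∈ A.fil p) (N' : ℤ) :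
    ∃ e ∈ A.envFil p, x - A.emb e ∈ A.top p N' := by
  obtain ⟨e, he, h⟩ := A.exists_emb_of_mem_top (A.fil_le_top le_rfl le_rfl hx) N'
  exact ⟨e, A.envTop_le_envFil _ _ he, h⟩

/-- `F^p 𝒰(V)` is complete: a series with terms tending to zero converges. -/
lemma exists_sum_of_mem_top {p a : ℤ} (s : ℕ → A.CurrentAlgebra)
    (hs : ∀ n : ℕ, s n ∈ A.top p (a + n)) :
    ∃ x, ∀ n : ℕ, x - ∑ i ∈ Finset.range n, s i ∈ A.top p (a + n) := by
  -- approximants in `U(𝔤(V))` of the partial sums, the error being passed on to the next step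
  have step : ∀ (n : ℕ) (E : {E : A.Env // E ∈ A.envFil p ∧
        ∑ i ∈ Finset.range n, s i - A.emb E ∈ A.top p (a + n)}),
      ∃ E' : {E : A.Env // E ∈ A.envFil p ∧
        ∑ i ∈ Finset.range (n + 1), s i - A.emb E ∈ A.top p (a + (n + 1 : ℕ))},
        E'.1 - E.1 ∈ A.envTop p (a + n) := by
    rintro n ⟨E, hE, hE'⟩
    have h := add_mem hE' (hs n)
    obtain ⟨e, he, he'⟩ := A.exists_emb_of_mem_top h (a + (n + 1 : ℕ))
    refine ⟨⟨E + e, add_mem hE (A.envTop_le_envFil _ _ he), ?_⟩, ?_⟩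
    · rw [Finset.sum_range_succ, map_add]
      convert he' using 1
      abel
    · simpa using he
  choose F hF using step
  let E : ∀ n : ℕ, {E : A.Env // E ∈ A.envFil p ∧
        ∑ i ∈ Finset.range n, s i - A.emb E ∈ A.top p (a + n)} :=
    Nat.rec ⟨0, zero_mem _, by simp⟩ F
  have hE : ∀ n : ℕ, (E (n + 1)).1 - (E n).1 ∈ A.envTop p (a + n) := fun n => hF n (E n)
  have hE' : ∀ n m : ℕ, n ≤ m → (E m).1 - (E n).1 ∈ A.envTop p (a + n) := by
    intro n m h
    induction m, h using Nat.le_induction with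
    | base => simp
    | succ m h ih =>
      rw [← sub_add_sub_cancel _ (E m).1]
      exact add_mem (A.envTop_anti_right p (by omega) (hE m)) ih
  have hc : (fun n => (E n).1) ∈ A.cauchyFil p := by
    refine ⟨fun n => (E n).2.1, fun N => ⟨(N - a).toNat, fun i hi j hj => ?_⟩⟩
    rw [← sub_sub_sub_cancel_right _ _ (E (N - a).toNat).1]
    have h := sub_mem (hE' _ _ hi) (hE' _ _ hj)
    exact A.envTop_anti_right p (by omega) h
  refine ⟨A.cls ⟨fun n => (E n).1, p, hc⟩, fun n => ?_⟩
  obtain ⟨K, hK⟩ := A.exists_cls_sub_emb_mem (σ := ⟨fun n => (E n).1, p, hc⟩) hc (a + n)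
  have h₁ := hK _ (le_max_left K n)
  have h₂ := A.emb_mem_top (hE' n _ (le_max_right K n))
  rw [map_sub] at h₂
  have h₃ := sub_mem (add_mem h₁ h₂) (E n).2.2
  convert h₃ using 1
  abel

lemma isClosedIdeal_relIdeal : A.IsClosedIdeal A.relIdeal := by
  intro p x hx h
  refine Submodule.mem_sInf.2 fun I hI => hI.2.1 p x hx fun N => ?_
  obtain ⟨b, hb, h⟩ := h N
  exact ⟨b, Submodule.mem_sInf.1 hb I hI, h⟩

/-- `F^p 𝒰(V)` is separated, because the ideal of relations is closed. -/
lemma eq_zero_of_forall_mem_top {p : ℤ} {x : A.CurrentAlgebra} (h : ∀ N, x ∈ A.top p N) :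
    x = 0 := by
  obtain ⟨σ, hσ, rfl⟩ := A.mem_fil.1 (A.top_le_fil p 0 (h 0))
  refine Ideal.Quotient.eq_zero_iff_mem.2
    (A.isClosedIdeal_relIdeal p (A.cenvMk σ) ⟨σ, hσ, rfl⟩ fun N => ?_)
  obtain ⟨τ, ⟨hτ, K, hK⟩, h⟩ := A.mem_top.1 (h N)
  refine ⟨A.cenvMk σ - A.cenvMk τ, ?_, ⟨σ - τ, sub_mem hσ hτ, map_sub _ _ _⟩, ?_⟩
  · exact Ideal.Quotient.eq.1 (h.symm : A.toCurrent (A.cenvMk σ) = A.toCurrent (A.cenvMk τ))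
  · rw [sub_sub_cancel]
    exact ⟨τ, hτ, ⟨K, hK⟩, rfl⟩


/-! ### Modes in the current algebra -/

/-- The mode `J_n(v)` in `𝒰(V)`, where `v` is regarded as a vector of weight `Δ`. -/
def um (Δ n : ℤ) : V →ₗ[ℂ] A.CurrentAlgebra where
  toFun v := A.emb (A.mode Δ n v)
  map_add' v w := by rw [mode_add, map_add]
  map_smul' c v := by rw [mode_smul, map_smul]; rfl

lemma um_apply (Δ n : ℤ) (v : V) : A.um Δ n v = A.emb (A.mode Δ n v) := rfl

lemma IsHom.um_mem_fil {A : ChiralVOA V} {k : ℤ} {v : V} (h : A.IsHom k v) (n : ℤ) :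
    A.um k n v ∈ A.fil n := A.emb_mem_fil (h.mode_mem_envFil n)

lemma um_mem_fil {Δ : ℕ} {v : V} (h : v ∈ A.wt Δ) (n : ℤ) : A.um Δ n v ∈ A.fil n :=
  (isHom_of_mem h).um_mem_fil n

lemma um_commutator {Δ₁ Δ₂ : ℕ} {v₁ v₂ : V} (h₁ : v₁ ∈ A.wt Δ₁) (h₂ : v₂ ∈ A.wt Δ₂) (m n : ℤ) :
    A.um Δ₁ m v₁ * A.um Δ₂ n v₂ - A.um Δ₂ n v₂ * A.um Δ₁ m v₁ =
      ∑ j ∈ Finset.range (Δ₁ + Δ₂), ((Ring.choose (m + Δ₁ - 1) j : ℤ) : ℂ) •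
        A.um (Δ₂ - (j - Δ₁ + 1)) (m + n) (A.J (j - Δ₁ + 1) v₁ v₂) := by
  simp only [um_apply, ← map_mul, ← map_sub, A.mode_commutator h₁ h₂, map_sum, map_smul]

lemma um_translation (Δ : ℤ) (v : V) (n : ℤ) :
    A.um (Δ + 1) n (A.J (-1) A.T v) = (-((n : ℂ) + Δ)) • A.um Δ n v := by
  rw [um_apply, mode_translation, map_smul, um_apply]

lemma mem_relIdeal_of_mem_relGens {x : A.CEnv} (hx : x ∈ A.relGens) : x ∈ A.relIdeal :=
  Submodule.mem_sInf.2 fun _ hI => hI.2.2 hx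

lemma um_vac : A.um 0 0 A.vac = 1 := by
  have h := Ideal.Quotient.eq_zero_iff_mem.2 (A.mem_relIdeal_of_mem_relGens (Or.inl rfl))
  exact sub_eq_zero.1 ((map_sub A.toCurrent _ _).symm.trans h)

/-- The associativity formula holds in `𝒰(V)`: the series converges to the left-hand side. -/
lemma um_associativity {Δ₁ Δ₂ : ℕ} {v₁ v₂ : V} (h₁ : v₁ ∈ A.wt Δ₁) (h₂ : v₂ ∈ A.wt Δ₂)
    (m n N : ℤ) : ∃ K₀ : ℕ, ∀ K ≥ K₀, A.um (Δ₂ - n) m (A.J n v₁ v₂) -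
      ∑ j ∈ Finset.range K, A.emb (A.assocTerm Δ₁ Δ₂ v₁ v₂ m n j) ∈ A.top m N := by
  obtain ⟨K₀, hK⟩ := A.exists_cls_sub_emb_mem
    (σ := ⟨A.assocSeq Δ₁ Δ₂ v₁ v₂ m n, m, A.assocSeq_mem h₁ h₂ m n⟩) (A.assocSeq_mem h₁ h₂ m n) N
  refine ⟨K₀, fun K hK₀ => ?_⟩
  have h := hK K hK₀
  have h0 : A.cls ⟨A.assocSeq Δ₁ Δ₂ v₁ v₂ m n, m, A.assocSeq_mem h₁ h₂ m n⟩ = 0 :=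
    Ideal.Quotient.eq_zero_iff_mem.2
      (A.mem_relIdeal_of_mem_relGens (Or.inr ⟨Δ₁, Δ₂, v₁, v₂, h₁, h₂, m, n, rfl⟩))
  rw [h0, zero_sub] at h
  have h' := neg_mem h
  rw [neg_neg] at h'
  change A.emb (A.assocSeq Δ₁ Δ₂ v₁ v₂ m n K) ∈ _ at h'
  rwa [assocSeq, map_sub, map_sum] at h'

lemma emb_assocTerm (Δ₁ Δ₂ : ℕ) (v₁ v₂ : V) (m n : ℤ) (j : ℕ) :
    A.emb (A.assocTerm Δ₁ Δ₂ v₁ v₂ m n j) =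
      ((-1 : ℂ) ^ j * ((Ring.choose (n + Δ₁ - 1) j : ℤ) : ℂ)) •
      (A.um Δ₁ (n - j) v₁ * A.um Δ₂ (m - n + j) v₂ -
      (-1 : ℂ) ^ (n + Δ₁ - 1) • (A.um Δ₂ (m + Δ₁ - j - 1) v₂ * A.um Δ₁ (j - Δ₁ + 1) v₁)) := by
  simp only [assocTerm, map_smul, map_sub, map_mul, um_apply]

/-- To show that `J_m(J_n(v₁)v₂)` lies in a subspace that contains a neighbourhood of zero in
`F^m 𝒰(V)`, it suffices to treat the quadratic expressions of the associativity formula. -/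
lemma um_J_mem_of_forall {Δ₁ Δ₂ : ℕ} {v₁ v₂ : V} (h₁ : v₁ ∈ A.wt Δ₁) (h₂ : v₂ ∈ A.wt Δ₂)
    {m n N : ℤ} {P : Submodule ℂ A.CurrentAlgebra} (hP : A.top m N ≤ P)
    (hl : ∀ j : ℕ, A.um Δ₁ (n - j) v₁ * A.um Δ₂ (m - n + j) v₂ ∈ P)
    (hr : ∀ i : ℤ, A.um Δ₂ (m - i) v₂ * A.um Δ₁ i v₁ ∈ P) :
    A.um (Δ₂ - n) m (A.J n v₁ v₂) ∈ P := by
  obtain ⟨K, hK⟩ := A.um_associativity h₁ h₂ m n N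
  replace hK := hK K le_rfl
  rw [← sub_add_cancel (A.um (Δ₂ - n) m (A.J n v₁ v₂)) (∑ j ∈ Finset.range K, _)]
  refine add_mem (hP hK) (sum_mem fun j _ => ?_)
  rw [emb_assocTerm]
  refine Submodule.smul_mem _ _ (sub_mem (hl j) (Submodule.smul_mem _ _ ?_))
  have h := hr (j - Δ₁ + 1)
  rwa [show m - ((j : ℤ) - Δ₁ + 1) = m + Δ₁ - j - 1 by ring] at h

/-- The commutator of a Virasoro mode `T(m)`, `m + 1 ≤ 2`, with a mode. -/
lemma um_T_commutator {Δ : ℕ} {v : V} (hv : v ∈ A.wt Δ) (k : ℕ) (hk : k ≤ 2) (n : ℤ) :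
    A.um 2 (k - 1) A.T * A.um Δ n v - A.um Δ n v * A.um 2 (k - 1) A.T =
      (-((k - 1 + n : ℤ) + Δ : ℂ) + k * Δ) • A.um Δ (k - 1 + n) v +
        (k.choose 2 : ℂ) • A.um (Δ - 1) (k - 1 + n) (A.J 1 A.T v) := by
  have h := A.um_commutator A.T_mem hv (k - 1) n
  rw [Nat.cast_ofNat] at h
  rw [h]
  have h1 : ∀ j : ℕ, Ring.choose ((k : ℤ) - 1 + 2 - 1) j = (k.choose j : ℤ) := fun j => by
    rw [show (k : ℤ) - 1 + 2 - 1 = (k : ℤ) by ring, Ring.choose_natCast]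
  simp only [h1]
  rw [Finset.sum_subset (s₂ := Finset.range (3 + Δ)) (fun j hj => by
      rw [Finset.mem_range] at hj ⊢; omega), ← Finset.sum_subset (s₁ := Finset.range 3)]
  · simp only [Finset.sum_range_succ, Finset.sum_range_zero, zero_add]
    have e0 : ((0 : ℕ) : ℤ) - 2 + 1 = -1 := rfl
    have e1 : ((1 : ℕ) : ℤ) - 2 + 1 = 0 := rfl
    have e2 : ((2 : ℕ) : ℤ) - 2 + 1 = 1 := rfl
    rw [e0, e1, e2, sub_neg_eq_add, um_translation, A.T_zero Δ v hv, map_smul, sub_zero]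
    simp only [Nat.choose_zero_right, Nat.choose_one_right, Int.cast_natCast, smul_smul]
    push_cast
    rw [one_mul, ← add_smul]
  · intro j hj
    rw [Finset.mem_range] at hj ⊢
    omega
  · intro j _ hj
    rw [Finset.mem_range, not_lt] at hj
    rw [Nat.choose_eq_zero_of_lt (by omega)]
    simp
  · intro j hj hj'
    rw [Finset.mem_range] at hj hj'
    rw [A.J_eq_zero _ _ Δ (by omega) v hv]
    simp

lemma T_zero_commutator {Δ : ℕ} {v : V} (hv : v ∈ A.wt Δ) (n : ℤ) :
    A.um 2 0 A.T * A.um Δ n v - A.um Δ n v * A.um 2 0 A.T = (-n : ℂ) • A.um Δ n v := by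
  have h := A.um_T_commutator hv 1 (by norm_num) n
  norm_num at h
  simpa using h

/-! ### Commutators of modes and monomials -/

/-- The span of the monomials of degree `d` in `r` modes. -/
def monoSpan (r : ℕ) (d : ℤ) : Submodule ℂ A.Env := Submodule.span ℂ {x | A.IsMonomial r d x}

lemma mode_mem_monoSpan {k : ℤ} {v : V} (h : A.IsHom k v) (n : ℤ) :
    A.mode k n v ∈ A.monoSpan 1 n := by
  rcases h with ⟨l, rfl, hv⟩ | rfl
  · have h := IsMonomial.cons hv n (IsMonomial.nil (A := A))
    rw [mul_one, add_zero] at h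
    exact Submodule.subset_span h
  · rw [mode_zero]; exact zero_mem _

lemma monoSpan_mul_le (r s : ℕ) (d e : ℤ) :
    A.monoSpan r d * A.monoSpan s e ≤ A.monoSpan (r + s) (d + e) := by
  rw [monoSpan, monoSpan, Submodule.span_mul_span]
  refine Submodule.span_le.2 ?_
  rintro _ ⟨x, hx, y, hy, rfl⟩
  exact Submodule.subset_span (hx.mul hy)

/-- Commuting a mode past a monomial does not increase the number of factors of the monomial. -/
lemma mode_mul_sub_mem_monoSpan {Δ : ℕ} {v : V} (hv : v ∈ A.wt Δ) (n : ℤ) {r : ℕ} {d : ℤ}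
    {x : A.Env} (hx : A.IsMonomial r d x) :
    A.mode Δ n v * x - x * A.mode Δ n v ∈ A.monoSpan r (n + d) := by
  induction hx with
  | nil => rw [mul_one, one_mul, sub_self]; exact zero_mem _
  | @cons Δ' v' hv' n' r d x hx ih =>
    have e : A.mode Δ n v * (A.mode Δ' n' v' * x) - A.mode Δ' n' v' * x * A.mode Δ n v =
        (A.mode Δ n v * A.mode Δ' n' v' - A.mode Δ' n' v' * A.mode Δ n v) * x +
        A.mode Δ' n' v' * (A.mode Δ n v * x - x * A.mode Δ n v) := by noncomm_ring
    rw [e]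
    refine add_mem ?_ ?_
    · rw [A.mode_commutator hv hv', Finset.sum_mul]
      refine sum_mem fun j _ => ?_
      rw [smul_mul_assoc]
      refine Submodule.smul_mem _ _ ?_
      have h := A.monoSpan_mul_le _ _ _ _ (Submodule.mul_mem_mul
        (A.mode_mem_monoSpan ((isHom_of_mem hv').J (j - Δ + 1) v) (n + n'))
        (Submodule.subset_span hx))
      rwa [add_comm 1 r, add_assoc] at h
    · have h := A.monoSpan_mul_le _ _ _ _ (Submodule.mul_mem_mul
        (A.mode_mem_monoSpan (isHom_of_mem hv') n') ih)
      rwa [add_comm 1 r, add_left_comm] at h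

/-- The span in `𝒰(V)` of the monomials of degree `d` in the modes. -/
def hom (d : ℤ) : Submodule ℂ A.CurrentAlgebra :=
  Submodule.span ℂ {x | ∃ r y, A.IsMonomial r d y ∧ x = A.emb y}

lemma hom_le_fil (d : ℤ) : A.hom d ≤ A.fil d := by
  refine Submodule.span_le.2 ?_
  rintro _ ⟨r, y, hy, rfl⟩
  exact A.emb_mem_fil hy.mem_envFil

lemma mul_mem_hom {d e : ℤ} {x y : A.CurrentAlgebra} (hx : x ∈ A.hom d) (hy : y ∈ A.hom e) :
    x * y ∈ A.hom (d + e) := by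
  have h := Submodule.mul_mem_mul hx hy
  rw [hom, hom, Submodule.span_mul_span] at h
  refine Submodule.span_le.2 ?_ h
  rintro _ ⟨_, ⟨r, x, hx, rfl⟩, _, ⟨s, y, hy, rfl⟩, rfl⟩
  exact Submodule.subset_span ⟨_, _, hx.mul hy, (map_mul _ _ _).symm⟩

lemma um_mem_hom {k : ℤ} {v : V} (h : A.IsHom k v) (n : ℤ) : A.um k n v ∈ A.hom n := by
  rcases h with ⟨l, rfl, hv⟩ | rfl
  · have h := IsMonomial.cons hv n (IsMonomial.nil (A := A))
    rw [mul_one, add_zero] at h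
    exact Submodule.subset_span ⟨_, _, h, rfl⟩
  · rw [map_zero]; exact zero_mem _

/-- `ad T(0)` is multiplication by `-d` in degree `d`. -/
lemma T_zero_mul_of_mem_hom {d : ℤ} {x : A.CurrentAlgebra} (hx : x ∈ A.hom d) :
    A.um 2 0 A.T * x = x * A.um 2 0 A.T + (-d : ℂ) • x := by
  induction hx using Submodule.span_induction with
  | mem x hx =>
    obtain ⟨r, x, hx, rfl⟩ := hx
    induction hx with
    | nil => simp
    | @cons Δ v hv n r d x hx ih =>
      have h := A.T_zero_commutator hv n
      rw [sub_eq_iff_eq_add] at h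
      rw [map_mul, ← um_apply, ← mul_assoc, h, add_mul, mul_assoc, ih, mul_add, mul_assoc,
        smul_mul_assoc, mul_smul_comm, add_comm, add_assoc, ← add_smul]
      congr 2
      push_cast
      ring
  | zero => simp
  | add x y _ _ hx hy => rw [mul_add, hx, hy, add_mul, smul_add]; abel
  | smul c x _ hx => rw [mul_smul_comm, hx, smul_mul_assoc, smul_add, smul_comm]

/-- The span in `𝒰(V)` of the monomials of degree at least `p`. -/
def homGe (p : ℤ) : Submodule ℂ A.CurrentAlgebra := ⨆ d : ℤ, ⨆ _ : p ≤ d, A.hom d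

lemma emb_mem_homGe {p : ℤ} {x : A.Env} (hx : x ∈ A.envPoly p) : A.emb x ∈ A.homGe p := by
  induction hx using Submodule.span_induction with
  | mem x hx =>
    obtain ⟨r, d, hd, hx⟩ := hx
    exact Submodule.mem_iSup_of_mem d (Submodule.mem_iSup_of_mem hd
      (Submodule.subset_span ⟨r, x, hx, rfl⟩))
  | zero => rw [map_zero]; exact zero_mem _
  | add x y _ _ hx hy => rw [map_add]; exact add_mem hx hy
  | smul c x _ hx => rw [map_smul]; exact Submodule.smul_mem _ _ hx

/-- Polynomials in the modes are dense in `F^p 𝒰(V)`. -/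
lemma fil_le_homGe_sup (p N : ℤ) : A.fil p ≤ A.homGe p ⊔ A.top p N := by
  intro x hx
  obtain ⟨e, he, h⟩ := A.exists_emb_of_mem_fil hx N
  obtain ⟨y, hy, z, hz, rfl⟩ := Submodule.mem_sup.1 (A.envFil_le_envPoly_sup p (max p N) he)
  rw [← sub_add_cancel x (A.emb (y + z)), add_comm, map_add, add_assoc]
  exact Submodule.add_mem_sup (A.emb_mem_homGe hy) (add_mem
    (A.fil_le_top (le_max_left _ _) (le_max_right _ _) (A.emb_mem_fil hz)) (by rwa [← map_add]))

/-! ### Consequences of the finiteness condition in `V` -/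

/-- The part of weight `Δ` of `C_2(V)`. -/
def c2Part (Δ : ℕ) : Submodule ℂ V :=
  Submodule.span ℂ {x | ∃ (Δ₁ Δ₂ p : ℕ) (a b : V), a ∈ A.wt Δ₁ ∧ b ∈ A.wt Δ₂ ∧ 1 ≤ p ∧
    Δ₁ + p + Δ₂ = Δ ∧ x = A.J (-(Δ₁ : ℤ) - p) a b}

/-- The projections of `V` onto its homogeneous subspaces. -/
lemma exists_proj : ∃ pr : ℕ → V →ₗ[ℂ] V, (∀ Δ, ∀ v ∈ A.wt Δ, pr Δ v = v) ∧
    ∀ Δ Δ', Δ' ≠ Δ → ∀ v ∈ A.wt Δ', pr Δ v = 0 := by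
  let _ := A.isInternal.chooseDecomposition
  refine ⟨fun Δ => (A.wt Δ).subtype ∘ₗ DirectSum.component ℂ ℕ (fun i => A.wt i) Δ ∘ₗ
    (DirectSum.decomposeLinearEquiv A.wt).toLinearMap, fun Δ v hv => ?_, fun Δ Δ' h v hv => ?_⟩
  · exact DirectSum.decompose_of_mem_same A.wt hv
  · exact DirectSum.decompose_of_mem_ne A.wt hv h

/-- All vectors of weight at least `Δ₀` lie in `C_2(V)`; moreover `T` has weight below `Δ₀`. -/
structure IsC2Bound (Δ₀ : ℕ) : Prop where
  three_le : 3 ≤ Δ₀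
  wt_le : ∀ Δ ≥ Δ₀, A.wt Δ ≤ A.c2Part Δ

lemma exists_isC2Bound (hA : A.IsC2Finite) : ∃ Δ₀ : ℕ, A.IsC2Bound Δ₀ := by
  have : FiniteDimensional ℂ (V ⧸ A.C2) := hA
  obtain ⟨pr, hpr, hpr'⟩ := A.exists_proj
  have hC : ∀ Δ, ∀ x ∈ A.C2, pr Δ x ∈ A.c2Part Δ := by
    intro Δ x hx
    induction hx using Submodule.span_induction with
    | mem x hx =>
      obtain ⟨Δ₁, v, m, p, hv, hp, rfl⟩ := hx
      have hm : m ∈ ⨆ Δ, A.wt Δ := by rw [iSup_wt]; trivial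
      induction hm using Submodule.iSup_induction' with
      | mem Δ₂ m hm =>
        have h := A.J_mem (-(Δ₁ : ℤ) - p) v Δ₂ (Δ₁ + p + Δ₂) (by push_cast; ring) m hm
        by_cases e : Δ₁ + p + Δ₂ = Δ
        · rw [e] at h
          rw [hpr _ _ h]
          exact Submodule.subset_span ⟨Δ₁, Δ₂, p, v, m, hv, hm, hp, e, rfl⟩
        · rw [hpr' _ _ e _ h]
          exact zero_mem _
      | zero => simp
      | add x y _ _ hx hy => rw [map_add, map_add]; exact add_mem hx hy
    | zero => simp
    | add x y _ _ hx hy => rw [map_add]; exact add_mem hx hy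
    | smul c x _ hx => rw [map_smul]; exact Submodule.smul_mem _ _ hx
  -- the images of `⨁_{k < n} V_k` in the finite dimensional space `V / C_2(V)` stabilize
  let f : ℕ →o Submodule ℂ (V ⧸ A.C2) :=
    ⟨fun n => (⨆ k : ℕ, ⨆ _ : k < n, A.wt k).map A.C2.mkQ, fun m n h =>
      Submodule.map_mono (iSup_mono fun k => iSup_mono' fun hk => ⟨hk.trans_le h, le_rfl⟩)⟩
  obtain ⟨n, hn⟩ := monotone_stabilizes_iff_noetherian.2 inferInstance f
  refine ⟨max n 3, le_max_right _ _, fun Δ hΔ v hv => ?_⟩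
  have hΔn : n ≤ Δ := le_of_max_le_left hΔ
  have h : A.C2.mkQ v ∈ f n := by
    rw [hn (Δ + 1) (by omega)]
    exact Submodule.mem_map_of_mem (Submodule.mem_iSup_of_mem Δ
      (Submodule.mem_iSup_of_mem (Nat.lt_succ_self Δ) hv))
  obtain ⟨b, hb, hbv⟩ := h
  have hb0 : pr Δ b = 0 := by
    have : (⨆ k : ℕ, ⨆ _ : k < n, A.wt k) ≤ LinearMap.ker (pr Δ) :=
      iSup₂_le fun k hk x hx => hpr' Δ k (by omega) x hx
    exact this hb
  have hd : v - b ∈ A.C2 := (Submodule.Quotient.eq A.C2).1 hbv.symm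
  have := hC Δ _ hd
  rwa [map_sub, hb0, sub_zero, hpr Δ v hv] at this


/-! ### Finitely many modes generate -/

instance (Δ : ℕ) : FiniteDimensional ℂ (A.wt Δ) := A.finiteDimensional_wt Δ

/-- Index set of the generating modes: a member of a basis of `V_Δ` with `Δ < Δ₀`, and a degree
`d` with `1 ≤ d ≤ Δ₀` (encoded as `d - 1`). -/
abbrev Gen (Δ₀ : ℕ) : Type :=
  (Σ Δ : Fin Δ₀, Fin (Module.finrank ℂ (A.wt Δ))) × Fin Δ₀

variable {A} in
/-- The degree of a generating mode. -/
def Gen.deg {Δ₀ : ℕ} (k : A.Gen Δ₀) : ℤ := k.2 + 1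

variable {A} in
lemma Gen.one_le_deg {Δ₀ : ℕ} (k : A.Gen Δ₀) : 1 ≤ k.deg := by
  simp [Gen.deg]

variable {A} in
lemma Gen.deg_le {Δ₀ : ℕ} (k : A.Gen Δ₀) : k.deg ≤ Δ₀ := by
  have := k.2.2
  simp only [Gen.deg]
  omega

/-- The generating modes `J_{s d}(u)`, where the sign `s = 1` or `s = -1` distinguishes the modes
of positive degree from those of negative degree. -/
def gen {Δ₀ : ℕ} (s : ℤ) (k : A.Gen Δ₀) : A.CurrentAlgebra :=
  A.um (k.1.1 : ℕ) (s * k.deg) (Module.finBasis ℂ (A.wt k.1.1) k.1.2 : V)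

lemma gen_mem_hom {Δ₀ : ℕ} (s : ℤ) (k : A.Gen Δ₀) : A.gen s k ∈ A.hom (s * k.deg) :=
  A.um_mem_hom (isHom_of_mem (Subtype.property _)) _

lemma gen_mem_fil {Δ₀ : ℕ} (s : ℤ) (k : A.Gen Δ₀) : A.gen s k ∈ A.fil (s * k.deg) :=
  A.hom_le_fil _ (A.gen_mem_hom s k)

lemma gen_one_mem_fil {Δ₀ : ℕ} (k : A.Gen Δ₀) : A.gen 1 k ∈ A.fil k.deg := by
  simpa using A.gen_mem_fil 1 k

lemma um_mem_span_gen {Δ₀ Δ : ℕ} (hΔ : Δ < Δ₀) {v : V} (hv : v ∈ A.wt Δ) (s : ℤ) {d : ℕ}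
    (hd : 1 ≤ d) (hd' : d ≤ Δ₀) :
    A.um Δ (s * d) v ∈ Submodule.span ℂ
      {x | ∃ k : A.Gen Δ₀, k.deg = d ∧ A.gen s k = x} := by
  have h := (Module.finBasis ℂ (A.wt Δ)).sum_repr ⟨v, hv⟩
  have h' := congrArg (fun x : A.wt Δ => A.um Δ (s * d) x) h
  simp only [Submodule.coe_sum, Submodule.coe_smul, map_sum, map_smul] at h'
  rw [← h']
  refine sum_mem fun i _ => Submodule.smul_mem _ _ (Submodule.subset_span ?_)
  have e : Gen.deg (A := A) (Δ₀ := Δ₀) (⟨⟨Δ, hΔ⟩, i⟩, ⟨d - 1, by omega⟩) = d := by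
    simp only [Gen.deg]
    omega
  exact ⟨(⟨⟨Δ, hΔ⟩, i⟩, ⟨d - 1, by omega⟩), e, by simp only [gen, e]⟩

/-- `∑_k F^{q-d_k} 𝒰(V) g_k`, up to a neighbourhood of zero; here the `g_k` are the generating
modes of positive degree `d_k`. -/
def lgen (Δ₀ : ℕ) (q N : ℤ) : Submodule ℂ A.CurrentAlgebra :=
  (⨆ k : A.Gen Δ₀, A.fil (q - k.deg) * Submodule.span ℂ {A.gen 1 k}) ⊔ A.top q N

/-- `∑_k g'_k F^{q+d_k} 𝒰(V)`, up to a neighbourhood of zero; here the `g'_k` are the generating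
modes of negative degree `-d_k`. -/
def rgen (Δ₀ : ℕ) (q N : ℤ) : Submodule ℂ A.CurrentAlgebra :=
  (⨆ k : A.Gen Δ₀, Submodule.span ℂ {A.gen (-1) k} * A.fil (q + k.deg)) ⊔ A.top q N

lemma top_le_lgen (Δ₀ : ℕ) (q N : ℤ) : A.top q N ≤ A.lgen Δ₀ q N := le_sup_right

lemma top_le_rgen (Δ₀ : ℕ) (q N : ℤ) : A.top q N ≤ A.rgen Δ₀ q N := le_sup_right

lemma mul_mem_lgen {Δ₀ : ℕ} {p q N : ℤ} {x y : A.CurrentAlgebra} (hx : x ∈ A.fil p)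
    (hy : y ∈ A.lgen Δ₀ q N) : x * y ∈ A.lgen Δ₀ (p + q) N := by
  have : A.lgen Δ₀ q N ≤ (A.lgen Δ₀ (p + q) N).comap (LinearMap.mulLeft ℂ x) := by
    refine sup_le (iSup_le fun k => Submodule.mul_le.2 fun c hc g hg => ?_) fun t ht => ?_
    · refine Submodule.mem_sup_left (Submodule.mem_iSup_of_mem k ?_)
      rw [LinearMap.mulLeft_apply, ← mul_assoc]
      refine Submodule.mul_mem_mul ?_ hg
      rw [add_sub_assoc]
      exact A.mul_mem_fil hx hc
    · exact Submodule.mem_sup_right (A.fil_mul_top hx ht)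
  exact this hy

lemma mul_mem_rgen {Δ₀ : ℕ} {p q N N' : ℤ} {x y : A.CurrentAlgebra}
    (hx : x ∈ A.rgen Δ₀ q N') (hy : y ∈ A.fil p) (hN : N ≤ N' + p) :
    x * y ∈ A.rgen Δ₀ (q + p) N := by
  have : A.rgen Δ₀ q N' ≤ (A.rgen Δ₀ (q + p) N).comap (LinearMap.mulRight ℂ y) := by
    refine sup_le (iSup_le fun k => Submodule.mul_le.2 fun g hg c hc => ?_) fun t ht => ?_
    · refine Submodule.mem_sup_left (Submodule.mem_iSup_of_mem k ?_)
      rw [LinearMap.mulRight_apply, mul_assoc]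
      refine Submodule.mul_mem_mul hg ?_
      rw [add_right_comm]
      exact A.mul_mem_fil hc hy
    · exact Submodule.mem_sup_right (A.top_anti_right _ hN (A.top_mul_fil ht hy))
  exact this hx

lemma gen_mem_lgen {Δ₀ : ℕ} (k : A.Gen Δ₀) (N : ℤ) : A.gen 1 k ∈ A.lgen Δ₀ k.deg N := by
  refine Submodule.mem_sup_left (Submodule.mem_iSup_of_mem k ?_)
  rw [sub_self]
  have h1 : (1 : A.CurrentAlgebra) ∈ A.fil 0 := A.filZero.one_mem
  simpa using Submodule.mul_mem_mul h1 (Submodule.mem_span_singleton_self (R := ℂ) (A.gen 1 k))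

lemma gen_mem_rgen {Δ₀ : ℕ} (k : A.Gen Δ₀) (N : ℤ) : A.gen (-1) k ∈ A.rgen Δ₀ (-k.deg) N := by
  refine Submodule.mem_sup_left (Submodule.mem_iSup_of_mem k ?_)
  rw [neg_add_cancel]
  have h1 : (1 : A.CurrentAlgebra) ∈ A.fil 0 := A.filZero.one_mem
  simpa using Submodule.mul_mem_mul (Submodule.mem_span_singleton_self (R := ℂ) (A.gen (-1) k)) h1

lemma um_mem_lgen_of_le {Δ₀ Δ : ℕ} (hΔ : Δ < Δ₀) {v : V} (hv : v ∈ A.wt Δ) {q : ℤ}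
    (hq : 1 ≤ q) (hq' : q ≤ Δ₀) (N : ℤ) : A.um Δ q v ∈ A.lgen Δ₀ q N := by
  lift q to ℕ using by omega
  have h := A.um_mem_span_gen hΔ hv 1 (d := q) (by omega) (by omega)
  rw [one_mul] at h
  refine Submodule.span_le.2 ?_ h
  rintro _ ⟨k, hk, rfl⟩
  rw [← hk]
  exact A.gen_mem_lgen k N

lemma um_mem_rgen_of_le {Δ₀ Δ : ℕ} (hΔ : Δ < Δ₀) {v : V} (hv : v ∈ A.wt Δ) {q : ℤ}
    (hq : 1 ≤ q) (hq' : q ≤ Δ₀) (N : ℤ) : A.um Δ (-q) v ∈ A.rgen Δ₀ (-q) N := by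
  lift q to ℕ using by omega
  have h := A.um_mem_span_gen hΔ hv (-1) (d := q) (by omega) (by omega)
  rw [neg_one_mul] at h
  refine Submodule.span_le.2 ?_ h
  rintro _ ⟨k, hk, rfl⟩
  rw [← hk]
  exact A.gen_mem_rgen k N

/-- A bracket of modes lies in a subspace as soon as the modes of lower weight do. -/
lemma um_commutator_mem {Δ₁ Δ₂ : ℕ} {v₁ v₂ : V} (h₁ : v₁ ∈ A.wt Δ₁) (h₂ : v₂ ∈ A.wt Δ₂)
    {m n q : ℤ} (hq : m + n = q) {P : Submodule ℂ A.CurrentAlgebra}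
    (hP : ∀ (k : ℕ) (w : V), k < Δ₁ + Δ₂ → w ∈ A.wt k → A.um k q w ∈ P) :
    A.um Δ₁ m v₁ * A.um Δ₂ n v₂ - A.um Δ₂ n v₂ * A.um Δ₁ m v₁ ∈ P := by
  rw [A.um_commutator h₁ h₂, hq]
  refine sum_mem fun j _ => Submodule.smul_mem _ _ ?_
  rcases (isHom_of_mem h₂).J (j - Δ₁ + 1) v₁ with ⟨l, hl, hv⟩ | h
  · rw [← hl]
    exact hP l _ (by omega) hv
  · rw [h, map_zero]
    exact zero_mem _

/-- Modes of positive degree lie in the left ideal of the generating modes. The induction on the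
weight uses associativity for vectors in `C_2(V)`; in the finitely many remaining weights modes of
high degree are obtained from the brackets with `T(1)`. -/
lemma um_mem_lgen {Δ₀ : ℕ} (h₀ : A.IsC2Bound Δ₀) (N : ℤ) (Δ : ℕ) :
    ∀ v ∈ A.wt Δ, ∀ q : ℤ, 1 ≤ q → A.um Δ q v ∈ A.lgen Δ₀ q N := by
  induction Δ using Nat.strong_induction_on with
  | _ Δ ih =>
  intro v hv q hq
  rcases lt_or_ge Δ Δ₀ with hΔ | hΔ
  · induction q, hq using Int.leInduction with
    | base => exact A.um_mem_lgen_of_le hΔ hv le_rfl (by have := h₀.three_le; omega) N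
    | succ q hq ihq =>
      rcases le_or_gt (q + 1) Δ₀ with h | h
      · exact A.um_mem_lgen_of_le hΔ hv (by omega) h N
      have hT : A.um 2 1 A.T ∈ A.lgen Δ₀ 1 N :=
        A.um_mem_lgen_of_le (by have := h₀.three_le; omega) A.T_mem le_rfl (by omega) N
      have hc := A.um_T_commutator hv 2 le_rfl q
      rw [show ((2 : ℕ) : ℤ) - 1 = 1 by norm_num, add_comm 1 q] at hc
      have h1 := sub_mem (A.mul_mem_lgen (A.hom_le_fil _ (A.um_mem_hom (isHom_of_mem A.T_mem) 1))
        ihq) (show A.um Δ q v * A.um 2 1 A.T ∈ A.lgen Δ₀ (1 + q) N by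
          rw [add_comm]; exact A.mul_mem_lgen (A.um_mem_fil hv q) hT)
      rw [Nat.cast_ofNat, hc, add_comm 1 q] at h1
      have h2 : A.um (Δ - 1) (q + 1) (A.J 1 A.T v) ∈ A.lgen Δ₀ (q + 1) N := by
        rcases (isHom_of_mem hv).J 1 A.T with ⟨l, hl, hw⟩ | h
        · rw [← hl]
          exact ih l (by omega) _ hw _ (by omega)
        · rw [h, map_zero]; exact zero_mem _
      rw [Submodule.add_mem_iff_left _ (Submodule.smul_mem _ _ h2)] at h1
      refine (Submodule.smul_mem_iff _ ?_).1 h1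
      have : ((Δ : ℤ) - (q + 1) : ℤ) ≠ 0 := by omega
      intro h0
      apply this
      have h0' : (((Δ : ℤ) - (q + 1) : ℤ) : ℂ) = 0 := by
        rw [← h0]; push_cast; ring
      exact_mod_cast h0'
  · refine Submodule.span_le.2 ?_ (Submodule.mem_map_of_mem (f := A.um Δ q) (h₀.wt_le Δ hΔ hv)
      |> fun h => by rwa [c2Part, Submodule.map_span] at h)
    rintro _ ⟨_, ⟨Δ₁, Δ₂, p, a, b, ha, hb, hp, rfl, rfl⟩, rfl⟩
    rw [show ((Δ₁ + p + Δ₂ : ℕ) : ℤ) = Δ₂ - (-(Δ₁ : ℤ) - p) by push_cast; ring]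
    refine A.um_J_mem_of_forall ha hb (A.top_le_lgen Δ₀ q N) (fun j => ?_) fun i => ?_
    · have h := A.mul_mem_lgen (A.um_mem_fil ha (-(Δ₁ : ℤ) - p - j))
        (ih Δ₂ (by omega) b hb (q - (-(Δ₁ : ℤ) - p) + j) (by omega))
      rwa [show -(Δ₁ : ℤ) - p - j + (q - (-(Δ₁ : ℤ) - p) + j) = q by ring] at h
    · rcases le_or_gt 1 i with hi | hi
      · have h := A.mul_mem_lgen (A.um_mem_fil hb (q - i)) (ih Δ₁ (by omega) a ha i hi)
        rwa [sub_add_cancel] at h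
      · rw [← sub_add_cancel (A.um Δ₂ (q - i) b * A.um Δ₁ i a)
          (A.um Δ₁ i a * A.um Δ₂ (q - i) b)]
        refine add_mem (A.um_commutator_mem hb ha (sub_add_cancel _ _) fun k w hk hw =>
          ih k (by omega) w hw q hq) ?_
        have h := A.mul_mem_lgen (A.um_mem_fil ha i) (ih Δ₂ (by omega) b hb (q - i) (by omega))
        rwa [add_sub_cancel] at h

/-- Modes of negative degree lie in the right ideal of the generating modes of negative degree, up
to arbitrarily small neighbourhoods of zero. -/
lemma um_mem_rgen {Δ₀ : ℕ} (h₀ : A.IsC2Bound Δ₀) (Δ : ℕ) :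
    ∀ v ∈ A.wt Δ, ∀ q : ℤ, 1 ≤ q → ∀ N, A.um Δ (-q) v ∈ A.rgen Δ₀ (-q) N := by
  induction Δ using Nat.strong_induction_on with
  | _ Δ ih =>
  intro v hv q hq
  rcases lt_or_ge Δ Δ₀ with hΔ | hΔ
  · induction q, hq using Int.leInduction with
    | base => exact A.um_mem_rgen_of_le hΔ hv le_rfl (by have := h₀.three_le; omega)
    | succ q hq ihq =>
      intro N
      rcases le_or_gt (q + 1) Δ₀ with h | h
      · exact A.um_mem_rgen_of_le hΔ hv (by omega) h N
      have hT : A.um 2 (-1) A.T ∈ A.rgen Δ₀ (-1) (N + q) :=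
        A.um_mem_rgen_of_le (by have := h₀.three_le; omega) A.T_mem le_rfl (by omega) _
      have hc := A.um_T_commutator hv 0 (by norm_num) (-q)
      rw [show ((0 : ℕ) : ℤ) - 1 = -1 by norm_num, show -1 + -q = -(q + 1) by ring] at hc
      have h1 := sub_mem (A.mul_mem_rgen hT (A.um_mem_fil hv (-q)) (N := N) (by omega))
        (show A.um Δ (-q) v * A.um 2 (-1) A.T ∈ A.rgen Δ₀ (-1 + -q) N by
          rw [add_comm]
          exact A.mul_mem_rgen (ihq (N + 1))
            (A.hom_le_fil _ (A.um_mem_hom (isHom_of_mem A.T_mem) (-1))) (by omega))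
      rw [show -1 + -q = -(q + 1) by ring] at h1
      rw [hc] at h1
      simp only [Nat.choose_zero_succ, Nat.cast_zero, zero_smul, add_zero] at h1
      refine (Submodule.smul_mem_iff _ ?_).1 h1
      have : ((q + 1) - (Δ : ℤ) : ℤ) ≠ 0 := by omega
      intro h0
      apply this
      have h0' : (((q + 1) - (Δ : ℤ) : ℤ) : ℂ) = 0 := by
        rw [← h0]; push_cast; ring
      exact_mod_cast h0'
  · intro N
    refine Submodule.span_le.2 ?_ (Submodule.mem_map_of_mem (f := A.um Δ (-q)) (h₀.wt_le Δ hΔ hv)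
      |> fun h => by rwa [c2Part, Submodule.map_span] at h)
    rintro _ ⟨_, ⟨Δ₁, Δ₂, p, a, b, ha, hb, hp, rfl, rfl⟩, rfl⟩
    rw [show ((Δ₁ + p + Δ₂ : ℕ) : ℤ) = Δ₂ - (-(Δ₁ : ℤ) - p) by push_cast; ring]
    refine A.um_J_mem_of_forall ha hb (A.top_le_rgen Δ₀ (-q) N) (fun j => ?_) fun i => ?_
    · have h := A.mul_mem_rgen (ih Δ₁ (by omega) a ha (Δ₁ + p + j) (by omega)
          (N - (-q - (-(Δ₁ : ℤ) - p) + j)))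
        (A.um_mem_fil hb (-q - (-(Δ₁ : ℤ) - p) + j)) (N := N) (by omega)
      rwa [show -((Δ₁ : ℤ) + p + j) + (-q - (-(Δ₁ : ℤ) - p) + j) = -q by ring,
        show -((Δ₁ : ℤ) + p + j) = -(Δ₁ : ℤ) - p - j by ring] at h
    · rcases le_or_gt 1 (q + i) with hi | hi
      · have h := A.mul_mem_rgen (ih Δ₂ (by omega) b hb (q + i) hi (N - i))
          (A.um_mem_fil ha i) (N := N) (by omega)
        rwa [show -(q + i) + i = -q by ring, show -(q + i) = -q - i by ring] at h
      · rw [← sub_add_cancel (A.um Δ₂ (-q - i) b * A.um Δ₁ i a)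
          (A.um Δ₁ i a * A.um Δ₂ (-q - i) b)]
        refine add_mem (A.um_commutator_mem hb ha (sub_add_cancel _ _) fun k w hk hw =>
          ih k (by omega) w hw q hq N) ?_
        have h := A.mul_mem_rgen (ih Δ₁ (by omega) a ha (-i) (by omega) (N - (-q - i)))
          (A.um_mem_fil hb (-q - i)) (N := N) (by omega)
        rwa [show - -i + (-q - i) = -q by ring, neg_neg] at h

lemma emb_mem_of_mem_monoSpan {r : ℕ} {d : ℤ} {x : A.Env} (hx : x ∈ A.monoSpan r d)
    {P : Submodule ℂ A.CurrentAlgebra} (hP : ∀ y, A.IsMonomial r d y → A.emb y ∈ P) :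
    A.emb x ∈ P := by
  have : A.monoSpan r d ≤ P.comap A.emb.toLinearMap := Submodule.span_le.2 hP
  exact this hx

lemma emb_mem_lgen {Δ₀ : ℕ} (h₀ : A.IsC2Bound Δ₀) (N : ℤ) (r : ℕ) :
    ∀ (d : ℤ) (x : A.Env), A.IsMonomial r d x → 1 ≤ d → A.emb x ∈ A.lgen Δ₀ d N := by
  induction r with
  | zero => rintro _ _ ⟨⟩ hd; omega
  | succ r ih =>
    rintro _ _ (_ | ⟨hv, n, hx⟩) hd
    rename_i Δ v d x
    rcases le_or_gt 1 d with h | h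
    · rw [map_mul]
      exact A.mul_mem_lgen (A.um_mem_fil hv n) (ih d x hx h)
    · rw [← sub_add_cancel (A.mode Δ n v * x) (x * A.mode Δ n v), map_add]
      refine add_mem (A.emb_mem_of_mem_monoSpan (A.mode_mul_sub_mem_monoSpan hv n hx)
        fun y hy => ih _ y hy hd) ?_
      rw [map_mul, add_comm]
      exact A.mul_mem_lgen (A.emb_mem_fil hx.mem_envFil)
        (A.um_mem_lgen h₀ N Δ v hv n (by omega))

lemma emb_mem_rgen {Δ₀ : ℕ} (h₀ : A.IsC2Bound Δ₀) (r : ℕ) :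
    ∀ (d : ℤ) (x : A.Env), A.IsMonomial r d x → d ≤ -1 → ∀ N, A.emb x ∈ A.rgen Δ₀ d N := by
  induction r with
  | zero => rintro _ _ ⟨⟩ hd; omega
  | succ r ih =>
    rintro _ _ (_ | ⟨hv, n, hx⟩) hd N
    rename_i Δ v d x
    rcases le_or_gt n (-1) with h | h
    · rw [map_mul]
      have h := A.um_mem_rgen h₀ Δ v hv (-n) (by omega) (N - d)
      rw [neg_neg] at h
      exact A.mul_mem_rgen h (A.emb_mem_fil hx.mem_envFil) (by omega)
    · rw [← sub_add_cancel (A.mode Δ n v * x) (x * A.mode Δ n v), map_add]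
      refine add_mem (A.emb_mem_of_mem_monoSpan (A.mode_mul_sub_mem_monoSpan hv n hx)
        fun y hy => ih _ y hy hd N) ?_
      rw [map_mul, add_comm]
      exact A.mul_mem_rgen (ih d x hx (by omega) (N - n)) (A.um_mem_fil hv n) (by omega)


/-! ### Neighbourhoods of zero and the left ideal `𝔍` -/

lemma exists_coeff_of_mem_iSup {Δ₀ : ℕ} {s : ℤ} {P : A.Gen Δ₀ → Submodule ℂ A.CurrentAlgebra}
    {x : A.CurrentAlgebra} (hx : x ∈ ⨆ k, P k * Submodule.span ℂ {A.gen s k}) :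
    ∃ c : A.Gen Δ₀ → A.CurrentAlgebra, (∀ k, c k ∈ P k) ∧ x = ∑ k, c k * A.gen s k := by
  classical
  induction hx using Submodule.iSup_induction' with
  | mem k x hx =>
    obtain ⟨z, hz, rfl⟩ := Submodule.mem_mul_span_singleton.1 hx
    refine ⟨Pi.single k z, fun l => ?_, ?_⟩
    · rcases eq_or_ne l k with rfl | h
      · rwa [Pi.single_eq_same]
      · rw [Pi.single_eq_of_ne h]; exact zero_mem _
    · rw [Finset.sum_eq_single k, Pi.single_eq_same]
      · intro l _ hl
        rw [Pi.single_eq_of_ne hl, zero_mul]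
      · simp
  | zero => exact ⟨0, fun _ => zero_mem _, by simp⟩
  | add x y _ _ hx hy =>
    obtain ⟨c, hc, rfl⟩ := hx
    obtain ⟨e, he, rfl⟩ := hy
    exact ⟨c + e, fun k => add_mem (hc k) (he k), by
      simp only [Pi.add_apply, add_mul, Finset.sum_add_distrib]⟩

lemma top_le_iSup_sup_top {Δ₀ : ℕ} (h₀ : A.IsC2Bound Δ₀) (q : ℤ) {n : ℤ} (hn : 1 ≤ n) :
    A.top q n ≤ (⨆ k : A.Gen Δ₀, A.top (q - k.deg) (n - Δ₀) * Submodule.span ℂ {A.gen 1 k}) ⊔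
      A.top q (n + 1) := by
  set P := (⨆ k : A.Gen Δ₀, A.top (q - k.deg) (n - Δ₀) * Submodule.span ℂ {A.gen 1 k}) ⊔
      A.top q (n + 1) with hP
  have key : A.envTop q n ≤ P.comap A.emb.toLinearMap := by
    refine iSup₂_le fun r hr => Submodule.mul_le.2 fun a ha b hb => ?_
    change A.emb (a * b) ∈ P
    obtain ⟨y, hy, z, hz, rfl⟩ := Submodule.mem_sup.1 (A.envFil_le_envPoly_sup r (max r (n + 1)) hb)
    rw [mul_add, map_add, map_mul, map_mul]
    refine add_mem ?_ (Submodule.mem_sup_right (A.top_anti_left (by omega) _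
      (A.fil_mul_fil_top (A.emb_mem_fil ha) (A.emb_mem_fil hz) (le_max_right _ _))))
    have : A.envPoly r ≤ P.comap (LinearMap.mulLeft ℂ (A.emb a) ∘ₗ A.emb.toLinearMap) := by
      refine Submodule.span_le.2 ?_
      rintro y ⟨l, e, he, hy⟩
      have hle : A.lgen Δ₀ e (n + 1) ≤ P.comap (LinearMap.mulLeft ℂ (A.emb a)) := by
        refine sup_le (iSup_le fun k => Submodule.mul_le.2 fun c hc g hg => ?_) fun t ht => ?_
        · refine Submodule.mem_sup_left (Submodule.mem_iSup_of_mem k ?_)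
          rw [LinearMap.mulLeft_apply, ← mul_assoc]
          refine Submodule.mul_mem_mul ?_ hg
          have := k.deg_le
          exact A.top_anti_left (by omega) _ (A.fil_mul_fil_top (A.emb_mem_fil ha) hc (by omega))
        · exact Submodule.mem_sup_right
            (A.top_anti_left (by omega) _ (A.fil_mul_top (A.emb_mem_fil ha) ht))
      exact hle (A.emb_mem_lgen h₀ (n + 1) l e y hy (by omega))
    exact this hy
  intro x hx
  obtain ⟨e, he, h⟩ := A.exists_emb_of_mem_top hx (n + 1)
  rw [← add_sub_cancel (A.emb e) x]
  exact add_mem (key he) (Submodule.mem_sup_right h)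

/-- Neighbourhoods of zero lie in the left ideal of the finitely many generating modes of positive
degree. Because there are finitely many of them, the coefficients can be found as limits. -/
lemma exists_coeff_of_mem_top {Δ₀ : ℕ} (h₀ : A.IsC2Bound Δ₀) {q n : ℤ} (hn : 1 ≤ n)
    {x : A.CurrentAlgebra} (hx : x ∈ A.top q n) :
    ∃ c : A.Gen Δ₀ → A.CurrentAlgebra, (∀ k, c k ∈ A.top (q - k.deg) (n - Δ₀)) ∧
      x = ∑ k, c k * A.gen 1 k := by
  have step : ∀ (i : ℕ) (y : A.CurrentAlgebra), y ∈ A.top q (n + i) →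
      ∃ c : A.Gen Δ₀ → A.CurrentAlgebra, (∀ k, c k ∈ A.top (q - k.deg) (n - Δ₀ + i)) ∧
        y - ∑ k, c k * A.gen 1 k ∈ A.top q (n + (i + 1 : ℕ)) := by
    intro i y hy
    obtain ⟨u, hu, t, ht, rfl⟩ :=
      Submodule.mem_sup.1 (A.top_le_iSup_sup_top h₀ q (n := n + i) (by omega) hy)
    obtain ⟨c, hc, rfl⟩ := A.exists_coeff_of_mem_iSup hu
    refine ⟨c, fun k => ?_, ?_⟩
    · rw [show n - (Δ₀ : ℤ) + i = n + i - Δ₀ by ring]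
      exact hc k
    · rw [add_sub_cancel_left, show n + ((i + 1 : ℕ) : ℤ) = n + i + 1 by push_cast; ring]
      exact ht
  choose! F hF hF' using step
  obtain ⟨y, hy0, hys⟩ : ∃ y : ℕ → A.CurrentAlgebra, y 0 = x ∧
      ∀ i, y (i + 1) = y i - ∑ k, F i (y i) k * A.gen 1 k :=
    ⟨Nat.rec x fun i y => y - ∑ k, F i y k * A.gen 1 k, rfl, fun _ => rfl⟩
  have hmem : ∀ i : ℕ, y i ∈ A.top q (n + i) := by
    intro i
    induction i with
    | zero => rw [hy0, Nat.cast_zero, add_zero]; exact hx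
    | succ i ih => rw [hys]; exact hF' i _ ih
  have hy : ∀ i : ℕ, x - y i = ∑ j ∈ Finset.range i, ∑ k, F j (y j) k * A.gen 1 k := by
    intro i
    induction i with
    | zero => rw [hy0, sub_self, Finset.sum_range_zero]
    | succ i ih => rw [Finset.sum_range_succ, ← ih, hys]; abel
  have hsum : ∀ k : A.Gen Δ₀, ∃ c : A.CurrentAlgebra, ∀ m : ℕ,
      c - ∑ j ∈ Finset.range m, F j (y j) k ∈ A.top (q - k.deg) (n - Δ₀ + m) := fun k =>
    A.exists_sum_of_mem_top (fun i => F i (y i) k) fun i => hF i (y i) (hmem i) k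
  choose c hc using hsum
  refine ⟨c, fun k => ?_, ?_⟩
  · have h := hc k 0
    rwa [Finset.sum_range_zero, sub_zero, Nat.cast_zero, add_zero] at h
  rw [← sub_eq_zero]
  refine A.eq_zero_of_forall_mem_top (p := q) fun N => ?_
  obtain ⟨m, hm⟩ : ∃ m : ℕ, N - n + Δ₀ ≤ m := ⟨_, Int.self_le_toNat _⟩
  have e : x - ∑ k, c k * A.gen 1 k = y m -
      ∑ k, (c k - ∑ j ∈ Finset.range m, F j (y j) k) * A.gen 1 k := by
    have := hy m
    rw [Finset.sum_comm, sub_eq_iff_eq_add] at this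
    simp only [sub_mul, Finset.sum_sub_distrib, Finset.sum_mul]
    rw [this]
    abel
  rw [e]
  refine sub_mem (A.top_anti_right q (by omega) (hmem m)) (sum_mem fun k _ => ?_)
  have h := A.top_mul_fil (hc k m) (A.gen_one_mem_fil k)
  have := k.one_le_deg
  rw [sub_add_cancel] at h
  exact A.top_anti_right q (by omega) h

lemma fil_le_leftIdealJ {p : ℤ} (hp : 1 ≤ p) {x : A.CurrentAlgebra} (hx : x ∈ A.fil p) :
    x ∈ A.leftIdealJ := Ideal.subset_span (A.fil_anti hp hx)

/-- The left ideal `𝔍` is open, in particular closed. -/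
lemma mem_leftIdealJ_of_mem_top (hA : A.IsC2Finite) {q : ℤ} {x : A.CurrentAlgebra}
    (hx : x ∈ A.top q 1) : x ∈ A.leftIdealJ := by
  obtain ⟨Δ₀, h₀⟩ := A.exists_isC2Bound hA
  obtain ⟨c, _, rfl⟩ := A.exists_coeff_of_mem_top h₀ le_rfl hx
  exact sum_mem fun k _ => Ideal.mul_mem_left _ _
    (A.fil_le_leftIdealJ k.one_le_deg (A.gen_one_mem_fil k))

/-- In negative degrees `F^p 𝒰(V)` is generated, up to small neighbourhoods of zero, by the pieces
of higher degree and the generating modes of negative degree. -/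
lemma fil_le_iSup_sup {Δ₀ : ℕ} (h₀ : A.IsC2Bound Δ₀) {p : ℤ} (hp : p ≤ -1) (N : ℤ) :
    A.fil p ≤ ((⨆ k : A.Gen Δ₀, Submodule.span ℂ {A.gen (-1) k} * A.fil (p + k.deg)) ⊔
      A.fil (p + 1)) ⊔ A.top p N := by
  refine (A.fil_le_homGe_sup p N).trans (sup_le (iSup₂_le fun d hd => ?_) le_sup_right)
  rcases hd.eq_or_lt with rfl | hd
  · refine le_trans ?_ (sup_le_sup_right le_sup_left _ : A.rgen Δ₀ p N ≤ _)
    refine Submodule.span_le.2 ?_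
    rintro _ ⟨r, y, hy, rfl⟩
    exact A.emb_mem_rgen h₀ r p y hy hp N
  · exact ((A.hom_le_fil d).trans (A.fil_anti (by omega))).trans (le_sup_right.trans le_sup_left)

/-! ### Finite dimensionality of the zero-mode algebra -/

/-- The span of the zero modes of vectors of weight at most `k`, up to a neighbourhood of zero
which is contained in `𝔍`. -/
def zeroSpan (k : ℤ) : Submodule ℂ A.CurrentAlgebra :=
  (⨆ Δ : ℕ, ⨆ _ : (Δ : ℤ) ≤ k, (A.wt Δ).map (A.um Δ 0)) ⊔ A.top 0 1

lemma zeroSpan_mono {k l : ℤ} (h : k ≤ l) : A.zeroSpan k ≤ A.zeroSpan l :=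
  sup_le_sup_right (iSup₂_le fun Δ hΔ =>
    le_iSup₂_of_le (f := fun (Δ : ℕ) (_ : (Δ : ℤ) ≤ l) => (A.wt Δ).map (A.um Δ 0))
      Δ (hΔ.trans h) le_rfl) _

lemma top_le_zeroSpan (k : ℤ) : A.top 0 1 ≤ A.zeroSpan k := le_sup_right

lemma um_zero_mem_zeroSpan {k : ℤ} {Δ : ℕ} (h : (Δ : ℤ) ≤ k) {v : V} (hv : v ∈ A.wt Δ) :
    A.um Δ 0 v ∈ A.zeroSpan k :=
  Submodule.mem_sup_left (Submodule.mem_iSup_of_mem Δ (Submodule.mem_iSup_of_mem h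
    (Submodule.mem_map_of_mem hv)))

lemma um_mul_um_mem_top {Δ₁ Δ₂ : ℕ} {a b : V} (ha : a ∈ A.wt Δ₁) (hb : b ∈ A.wt Δ₂) {m n : ℤ}
    (hmn : m + n = 0) (hn : 1 ≤ n) : A.um Δ₁ m a * A.um Δ₂ n b ∈ A.top 0 1 := by
  rw [← hmn]
  exact A.fil_mul_fil_top (A.um_mem_fil ha m) (A.um_mem_fil hb n) hn

lemma um_mul_um_mem_zeroSpan_of_ne {Δ₁ Δ₂ : ℕ} {a b : V} (ha : a ∈ A.wt Δ₁) (hb : b ∈ A.wt Δ₂)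
    {m n : ℤ} (hmn : m + n = 0) (hn : n ≠ 0) :
    A.um Δ₁ m a * A.um Δ₂ n b ∈ A.zeroSpan (Δ₁ + Δ₂ - 1) := by
  rcases lt_or_gt_of_ne hn with h | h
  · rw [← sub_add_cancel (A.um Δ₁ m a * A.um Δ₂ n b) (A.um Δ₂ n b * A.um Δ₁ m a)]
    exact add_mem (A.um_commutator_mem ha hb hmn fun k w hk hw =>
        A.um_zero_mem_zeroSpan (by omega) hw)
      (A.top_le_zeroSpan _ (A.um_mul_um_mem_top hb ha (by omega) (by omega)))
  · exact A.top_le_zeroSpan _ (A.um_mul_um_mem_top ha hb hmn h)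

lemma exists_smul_vac {a : V} (ha : a ∈ A.wt 0) : ∃ c : ℂ, c • A.vac = a := by
  obtain ⟨c, hc⟩ := (finrank_eq_one_iff_of_nonzero' (⟨A.vac, A.vac_mem⟩ : A.wt 0) (by
    intro h; exact A.vac_ne_zero (congrArg Subtype.val h))).1 A.finrank_wt_zero ⟨a, ha⟩
  exact ⟨c, congrArg Subtype.val hc⟩

/-- A product of zero modes is a zero mode modulo `𝔍`, by the associativity formula for
`J_0(J_{-Δ}(b)a)`. -/
lemma um_zero_mul_mem_zeroSpan {Δ₁ Δ₂ : ℕ} {a b : V} (ha : a ∈ A.wt Δ₁) (hb : b ∈ A.wt Δ₂) :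
    A.um Δ₁ 0 a * A.um Δ₂ 0 b ∈ A.zeroSpan (Δ₁ + Δ₂) := by
  rcases Nat.eq_zero_or_pos Δ₂ with rfl | hΔ
  · obtain ⟨c, rfl⟩ := A.exists_smul_vac hb
    rw [map_smul, mul_smul_comm, Nat.cast_zero, um_vac, mul_one]
    exact Submodule.smul_mem _ _ (A.um_zero_mem_zeroSpan (by omega) ha)
  obtain ⟨K, hK⟩ := A.um_associativity hb ha 0 (-Δ₂) 1
  have h := A.top_le_zeroSpan (Δ₁ + Δ₂) (hK _ (le_max_left K Δ₂))
  have hJ : A.um (Δ₁ - (-(Δ₂ : ℤ))) 0 (A.J (-Δ₂) b a) ∈ A.zeroSpan (Δ₁ + Δ₂) := by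
    rcases (isHom_of_mem ha).J (-Δ₂) b with ⟨l, hl, hw⟩ | h0
    · rw [← hl]
      exact A.um_zero_mem_zeroSpan (by omega) hw
    · rw [h0, map_zero]; exact zero_mem _
  rw [Submodule.sub_mem_iff_right _ hJ] at h
  -- the only term which is not covered by the previous lemmas is the one with index `Δ₂ - 1`
  have hmem : Δ₂ - 1 ∈ Finset.range (max K Δ₂) := Finset.mem_range.2 (by omega)
  rw [← Finset.add_sum_erase _ _ hmem, Submodule.add_mem_iff_left] at h
  · rw [emb_assocTerm, neg_add_cancel, zero_sub, zpow_neg_one, show -(Δ₂ : ℤ) - ((Δ₂ - 1 : ℕ) : ℤ) =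
      -(2 * Δ₂ - 1) by omega, show (0 : ℤ) + Δ₂ - ((Δ₂ - 1 : ℕ) : ℤ) - 1 = 0 by omega,
      show ((Δ₂ - 1 : ℕ) : ℤ) - Δ₂ + 1 = 0 by omega, Submodule.smul_mem_iff,
      Submodule.sub_mem_iff_right, Submodule.smul_mem_iff _ (by norm_num)] at h
    · exact h
    · exact A.top_le_zeroSpan _ (A.um_mul_um_mem_top hb ha (by omega) (by omega))
    · rw [Ring.choose_neg, add_sub_cancel_left, Ring.choose_natCast, Nat.choose_self]
      simp [Units.smul_def]
  · refine sum_mem fun j hj => ?_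
    have hj' := (Finset.mem_erase.1 hj).1
    rw [emb_assocTerm]
    refine Submodule.smul_mem _ _ (sub_mem ?_ (Submodule.smul_mem _ _ ?_))
    · exact A.top_le_zeroSpan _ (A.um_mul_um_mem_top hb ha (by omega) (by omega))
    · exact A.zeroSpan_mono (by omega)
        (A.um_mul_um_mem_zeroSpan_of_ne ha hb (by omega) (by omega))

lemma um_zero_mul_mem_of_mem_zeroSpan {Δ : ℕ} {a : V} (ha : a ∈ A.wt Δ) {k : ℤ}
    {x : A.CurrentAlgebra} (hx : x ∈ A.zeroSpan k) : A.um Δ 0 a * x ∈ A.zeroSpan (Δ + k) := by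
  have : A.zeroSpan k ≤ (A.zeroSpan (Δ + k)).comap (LinearMap.mulLeft ℂ (A.um Δ 0 a)) := by
    refine sup_le (iSup₂_le fun l hl => ?_) fun t ht => ?_
    · rintro _ ⟨b, hb, rfl⟩
      exact A.zeroSpan_mono (by omega) (A.um_zero_mul_mem_zeroSpan ha hb)
    · refine A.top_le_zeroSpan _ ?_
      have h := A.fil_mul_top (A.um_mem_fil ha 0) ht
      rwa [add_zero] at h
  exact this hx

/-- Every monomial of degree zero is a zero mode modulo `𝔍`. -/
lemma exists_emb_mem_zeroSpan (r : ℕ) :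
    ∀ x : A.Env, A.IsMonomial r 0 x → ∃ k, A.emb x ∈ A.zeroSpan k := by
  have hspan : ∀ (r : ℕ), (∀ x : A.Env, A.IsMonomial r 0 x → ∃ k, A.emb x ∈ A.zeroSpan k) →
      ∀ x ∈ A.monoSpan r 0, ∃ k, A.emb x ∈ A.zeroSpan k := by
    intro r hr x hx
    induction hx using Submodule.span_induction with
    | mem x hx => exact hr x hx
    | zero => exact ⟨0, by rw [map_zero]; exact zero_mem _⟩
    | add x y _ _ hx hy =>
      obtain ⟨k, hx⟩ := hx
      obtain ⟨l, hy⟩ := hy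
      exact ⟨max k l, by
        rw [map_add]
        exact add_mem (A.zeroSpan_mono (le_max_left _ _) hx)
          (A.zeroSpan_mono (le_max_right _ _) hy)⟩
    | smul c x _ hx =>
      obtain ⟨k, hx⟩ := hx
      exact ⟨k, by rw [map_smul]; exact Submodule.smul_mem _ _ hx⟩
  induction r with
  | zero =>
    rintro _ ⟨⟩
    refine ⟨0, ?_⟩
    have h := A.um_zero_mem_zeroSpan (k := 0) le_rfl A.vac_mem
    rwa [Nat.cast_zero, um_vac, ← map_one A.emb] at h
  | succ r ih =>
    intro y hy
    generalize hd : (0 : ℤ) = d at hy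
    obtain _ | ⟨hv, n, hx⟩ := hy
    rename_i Δ v d x
    obtain rfl : d = -n := by omega
    rcases lt_trichotomy n 0 with hn | rfl | hn
    · refine ⟨0, A.top_le_zeroSpan _ ?_⟩
      have h := A.fil_mul_fil_top (A.um_mem_fil hv n) (A.emb_mem_fil hx.mem_envFil)
        (N := 1) (by omega)
      rwa [add_neg_cancel] at h
    · rw [neg_zero] at hx
      obtain ⟨k, hk⟩ := ih x hx
      exact ⟨Δ + k, by rw [map_mul]; exact A.um_zero_mul_mem_of_mem_zeroSpan hv hk⟩
    · have h := A.mode_mul_sub_mem_monoSpan hv n hx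
      rw [add_neg_cancel] at h
      obtain ⟨k, hk⟩ := hspan r ih _ h
      refine ⟨k, ?_⟩
      rw [← sub_add_cancel (A.mode Δ n v * x) (x * A.mode Δ n v), map_add]
      refine add_mem hk (A.top_le_zeroSpan _ ?_)
      have h := A.fil_mul_fil_top (A.emb_mem_fil hx.mem_envFil) (A.um_mem_fil hv n)
        (N := 1) (by omega)
      rwa [neg_add_cancel, um_apply, ← map_mul] at h

/-- Zero modes of vectors in `C_2(V)` reduce to zero modes of lower weight modulo `𝔍`. -/
lemma zeroSpan_le {Δ₀ : ℕ} (h₀ : A.IsC2Bound Δ₀) (k : ℕ) : A.zeroSpan k ≤ A.zeroSpan Δ₀ := by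
  induction k with
  | zero => exact A.zeroSpan_mono (by omega)
  | succ k ih =>
    rcases le_or_gt (k + 1) Δ₀ with h | h
    · exact A.zeroSpan_mono (by omega)
    refine sup_le (iSup₂_le fun Δ hΔ => ?_) (A.top_le_zeroSpan _)
    rcases (show Δ ≤ k + 1 by omega).lt_or_eq with h' | rfl
    · rintro _ ⟨v, hv, rfl⟩
      exact ih (A.um_zero_mem_zeroSpan (by omega) hv)
    · refine le_trans ?_ ih
      refine (Submodule.map_mono (h₀.wt_le _ (by omega))).trans ?_
      rw [c2Part, Submodule.map_span]
      refine Submodule.span_le.2 ?_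
      rintro _ ⟨_, ⟨Δ₁, Δ₂, p, a, b, ha, hb, hp, hk, rfl⟩, rfl⟩
      rw [← hk, show ((Δ₁ + p + Δ₂ : ℕ) : ℤ) = Δ₂ - (-(Δ₁ : ℤ) - p) by push_cast; ring]
      refine A.um_J_mem_of_forall ha hb (A.top_le_zeroSpan k) (fun j => ?_) fun i => ?_
      · exact A.top_le_zeroSpan _ (A.um_mul_um_mem_top ha hb (by ring) (by omega))
      · rcases eq_or_ne i 0 with rfl | hi
        · rw [sub_zero]
          exact A.zeroSpan_mono (by omega) (A.um_zero_mul_mem_zeroSpan hb ha)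
        · exact A.zeroSpan_mono (by omega)
            (A.um_mul_um_mem_zeroSpan_of_ne hb ha (sub_add_cancel _ _) hi)

lemma exists_finiteDimensional_fil_zero_le (hA : A.IsC2Finite) :
    ∃ Z : Submodule ℂ A.CurrentAlgebra, FiniteDimensional ℂ Z ∧ A.fil 0 ≤ Z ⊔ A.top 0 1 := by
  obtain ⟨Δ₀, h₀⟩ := A.exists_isC2Bound hA
  refine ⟨⨆ Δ : Fin (Δ₀ + 1), (A.wt Δ).map (A.um Δ 0), inferInstance, ?_⟩
  have hle : A.fil 0 ≤ A.zeroSpan Δ₀ := by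
    refine (A.fil_le_homGe_sup 0 1).trans (sup_le (iSup₂_le fun d hd => ?_) (A.top_le_zeroSpan _))
    rcases hd.eq_or_lt with rfl | hd
    · refine Submodule.span_le.2 ?_
      rintro _ ⟨r, y, hy, rfl⟩
      obtain ⟨k, hk⟩ := A.exists_emb_mem_zeroSpan r y hy
      exact A.zeroSpan_le h₀ k.toNat (A.zeroSpan_mono (by omega) hk)
    · exact ((A.hom_le_fil d).trans (A.fil_le_top (by omega) (by omega))).trans
        (A.top_le_zeroSpan _)
  refine hle.trans (sup_le_sup_right (iSup₂_le fun Δ hΔ => ?_) _)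
  exact le_iSup (fun Δ : Fin (Δ₀ + 1) => (A.wt Δ).map (A.um Δ 0)) ⟨Δ, by omega⟩

/-- The zero-mode algebra of a `C_2`-finite chiral vertex operator algebra is finite
dimensional. -/
theorem finiteDimensional_zeroMode (hA : A.IsC2Finite) : FiniteDimensional ℂ A.ZeroMode := by
  obtain ⟨Z, hZ, hle⟩ := A.exists_finiteDimensional_fil_zero_le hA
  have hsurj : Function.Surjective A.toZeroMode := Ideal.Quotient.mk_surjective
  let Z' : Submodule ℂ A.filZero := Z.comap A.filZero.val.toLinearMap
  have : FiniteDimensional ℂ Z' :=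
    Module.Finite.of_injective (A.filZero.val.toLinearMap.restrict (p := Z') (q := Z) fun _ h => h)
      fun x y h => Subtype.ext (Subtype.ext (congrArg (Subtype.val (p := (· ∈ Z))) h))
  refine Module.Finite.of_surjective (A.toZeroMode.toLinearMap ∘ₗ Z'.subtype) fun x => ?_
  obtain ⟨⟨x, hx⟩, rfl⟩ := hsurj x
  obtain ⟨z, hz, t, ht, rfl⟩ := Submodule.mem_sup.1 (hle hx)
  have ht0 := A.top_le_fil _ _ ht
  have hz0 : z ∈ A.fil 0 := by simpa using (A.fil 0).sub_mem hx ht0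
  refine ⟨⟨⟨z, hz0⟩, hz⟩, ?_⟩
  change A.toZeroMode ⟨z, hz0⟩ = A.toZeroMode ⟨z + t, hx⟩
  have e : (⟨z + t, hx⟩ : A.filZero) = ⟨z, hz0⟩ + ⟨t, ht0⟩ := rfl
  rw [e, map_add, left_eq_add]
  exact Ideal.Quotient.eq_zero_iff_mem.2 (A.mem_leftIdealJ_of_mem_top hA ht)


/-! ### Modules: nilpotency of the generating modes and local finiteness -/

section Modules

variable {M : Type w} [AddCommGroup M] [Module ℂ M] [Module A.CurrentAlgebra M]
  [IsScalarTower ℂ A.CurrentAlgebra M]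

/-- The span `P X` of the products `x m` with `x ∈ P ⊆ 𝒰(V)` and `m ∈ X ⊆ M`. -/
def actOn (P : Submodule ℂ A.CurrentAlgebra) (X : Submodule ℂ M) : Submodule ℂ M :=
  Submodule.map₂ (Algebra.lsmul ℂ ℂ M).toLinearMap P X

lemma smul_mem_actOn {P : Submodule ℂ A.CurrentAlgebra} {X : Submodule ℂ M} {x : A.CurrentAlgebra}
    {m : M} (hx : x ∈ P) (hm : m ∈ X) : x • m ∈ A.actOn P X :=
  Submodule.apply_mem_map₂ _ hx hm

lemma actOn_le {P : Submodule ℂ A.CurrentAlgebra} {X Y : Submodule ℂ M} :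
    A.actOn P X ≤ Y ↔ ∀ x ∈ P, ∀ m ∈ X, x • m ∈ Y :=
  Submodule.map₂_le

lemma actOn_mono {P Q : Submodule ℂ A.CurrentAlgebra} {X Y : Submodule ℂ M} (h : P ≤ Q)
    (h' : X ≤ Y) : A.actOn P X ≤ A.actOn Q Y :=
  Submodule.map₂_le_map₂ h h'

/-- The vectors which are annihilated by all products of `s` generating modes of positive
degree. -/
def genNil (M : Type w) [AddCommGroup M] [Module ℂ M] [Module A.CurrentAlgebra M]
    [IsScalarTower ℂ A.CurrentAlgebra M] (Δ₀ : ℕ) : ℕ → Submodule ℂ M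
  | 0 => ⊥
  | s + 1 => ⨅ k : A.Gen Δ₀, (genNil M Δ₀ s).comap (Algebra.lsmul ℂ ℂ M (A.gen 1 k))

lemma mem_genNil_succ {Δ₀ s : ℕ} {m : M} :
    m ∈ A.genNil M Δ₀ (s + 1) ↔ ∀ k : A.Gen Δ₀, A.gen 1 k • m ∈ A.genNil M Δ₀ s := by
  simp [genNil]

lemma genNil_mono (Δ₀ : ℕ) : Monotone (A.genNil M Δ₀) := by
  refine monotone_nat_of_le_succ fun s => ?_
  induction s with
  | zero => exact bot_le
  | succ s ih => exact iInf_mono fun k => Submodule.comap_mono ih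

/-- Small neighbourhoods of zero annihilate the vectors on which long products of generating modes
vanish; thus such vectors are smooth although no continuity is required of a module. -/
lemma smul_eq_zero_of_mem_top {Δ₀ : ℕ} (h₀ : A.IsC2Bound Δ₀) (s : ℕ) :
    ∀ m ∈ A.genNil M Δ₀ s, ∀ (q n : ℤ), s * Δ₀ + 1 ≤ n → ∀ x ∈ A.top q n, x • m = 0 := by
  induction s with
  | zero =>
    intro m hm q n _ x _
    rw [(Submodule.mem_bot ℂ).1 hm, smul_zero]
  | succ s ih =>
    intro m hm q n hn x hx
    push_cast at hn
    obtain ⟨c, hc, rfl⟩ := A.exists_coeff_of_mem_top h₀ (by nlinarith) hx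
    rw [Finset.sum_smul]
    refine Finset.sum_eq_zero fun k _ => ?_
    rw [mul_smul]
    exact ih _ (A.mem_genNil_succ.1 hm k) _ _ (by linarith) _ (hc k)

/-- Elements of degree `d` lower the generalized eigenvalue of `T(0)` by `d`. -/
lemma smul_mem_genEigenspace {d : ℤ} {x : A.CurrentAlgebra} (hx : x ∈ A.hom d) {h h' : ℂ}
    (hh : h' = h - d) {m : M} (hm : m ∈ A.genEigenspace M h) : x • m ∈ A.genEigenspace M h' := by
  obtain ⟨k, hk⟩ := (Module.End.mem_maxGenEigenspace _ _ _).1 hm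
  have hs : SemiconjBy (Algebra.lsmul ℂ ℂ M x) (A.actT0 M - h • 1) (A.actT0 M - h' • 1) := by
    ext m
    change x • (A.um 2 0 A.T • m - h • m) = A.um 2 0 A.T • x • m - h' • x • m
    rw [← mul_smul (A.um 2 0 A.T), A.T_zero_mul_of_mem_hom hx, hh, add_smul, smul_sub, mul_smul,
      smul_assoc, smul_comm x h, sub_smul, neg_smul]
    abel
  refine (Module.End.mem_maxGenEigenspace _ _ _).2 ⟨k, ?_⟩
  have e := congrArg (fun f : Module.End ℂ M => f m) (hs.pow_right k).eq
  simp only [Module.End.mul_apply, hk, map_zero] at e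
  exact e.symm

lemma mem_genNil_of_mem_genEigenspace {Δ₀ : ℕ} {X : Submodule ℂ M}
    (hg : ∀ (k : A.Gen Δ₀), ∀ m ∈ X, A.gen 1 k • m ∈ X) (B : ℕ) :
    ∀ h : ℂ, (∀ n : ℕ, B ≤ n → X ⊓ A.genEigenspace M (h - n) = ⊥) →
      ∀ m ∈ X ⊓ A.genEigenspace M h, m ∈ A.genNil M Δ₀ B := by
  induction B with
  | zero =>
    intro h hB m hm
    have := hB 0 le_rfl
    rw [Nat.cast_zero, sub_zero] at this
    rwa [this] at hm
  | succ B ih =>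
    intro h hB m hm
    refine A.mem_genNil_succ.2 fun k => ih (h - k.deg) (fun n hn => ?_) _ ⟨hg k m hm.1, ?_⟩
    · have := k.one_le_deg
      have e := hB (k.deg.toNat + n) (by omega)
      have e' : ((k.deg.toNat : ℕ) : ℂ) = (k.deg : ℂ) := by
        have : ((k.deg.toNat : ℕ) : ℤ) = k.deg := by omega
        exact_mod_cast congrArg (Int.cast (R := ℂ)) this
      rwa [Nat.cast_add, e', ← sub_sub] at e
    · have h1 := A.gen_mem_hom 1 k
      rw [one_mul] at h1
      exact A.smul_mem_genEigenspace h1 rfl hm.2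

lemma exists_mem_genNil {Δ₀ : ℕ} {X : Submodule ℂ M}
    (hg : ∀ (k : A.Gen Δ₀), ∀ m ∈ X, A.gen 1 k • m ∈ X)
    (hX : X ≤ ⨆ h, X ⊓ A.genEigenspace M h)
    (hB : ∀ h : ℂ, ∃ B : ℕ, ∀ n : ℕ, B ≤ n → X ⊓ A.genEigenspace M (h - n) = ⊥) {m : M}
    (hm : m ∈ X) : ∃ s, m ∈ A.genNil M Δ₀ s := by
  replace hm := hX hm
  induction hm using Submodule.iSup_induction' with
  | mem h m hm =>
    obtain ⟨B, hB⟩ := hB h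
    exact ⟨B, A.mem_genNil_of_mem_genEigenspace hg B h hB m hm⟩
  | zero => exact ⟨0, zero_mem _⟩
  | add x y _ _ hx hy =>
    obtain ⟨s, hs⟩ := hx
    obtain ⟨t, ht⟩ := hy
    exact ⟨max s t, add_mem (A.genNil_mono Δ₀ (le_max_left _ _) hs)
      (A.genNil_mono Δ₀ (le_max_right _ _) ht)⟩

lemma exists_le_genNil {Δ₀ : ℕ} {X : Submodule ℂ M} [FiniteDimensional ℂ X]
    (h : ∀ m ∈ X, ∃ s, m ∈ A.genNil M Δ₀ s) : ∃ s, X ≤ A.genNil M Δ₀ s := by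
  obtain ⟨t, rfl⟩ : X.FG := (Submodule.fg_top X).1 Module.Finite.fg_top
  choose! s hs using h
  exact ⟨t.sup s, Submodule.span_le.2 fun m hm =>
    A.genNil_mono Δ₀ (Finset.le_sup hm) (hs m (Submodule.subset_span hm))⟩

lemma le_iSup_inf_genEigenspace {X : Submodule ℂ M} [FiniteDimensional ℂ X]
    (hX : ∀ m ∈ X, A.actT0 M m ∈ X) : X ≤ ⨆ h, X ⊓ A.genEigenspace M h := by
  have e := Module.End.iSup_maxGenEigenspace_eq_top ((A.actT0 M).restrict hX)
  have e' := congrArg (Submodule.map X.subtype) e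
  rw [Submodule.map_iSup, Submodule.map_top, Submodule.range_subtype] at e'
  refine e'.symm.le.trans (iSup_mono fun h => ?_)
  rw [Module.End.maxGenEigenspace, Module.End.genEigenspace_restrict, Submodule.map_comap_subtype]
  exact le_rfl

lemma finite_inf_genEigenspace_ne_bot {X : Submodule ℂ M} [FiniteDimensional ℂ X]
    (hX : ∀ m ∈ X, A.actT0 M m ∈ X) : {h | X ⊓ A.genEigenspace M h ≠ ⊥}.Finite := by
  refine (WellFoundedGT.finite_ne_bot_of_iSupIndep
    (Module.End.independent_maxGenEigenspace ((A.actT0 M).restrict hX))).subset fun h hh e => hh ?_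
  rw [Module.End.maxGenEigenspace, Module.End.genEigenspace_restrict] at e
  change Submodule.comap X.subtype (A.genEigenspace M h) = ⊥ at e
  rw [← Submodule.map_comap_subtype, e, Submodule.map_bot]

lemma exists_nat_bound {S : Set ℂ} (hS : S.Finite) (h : ℂ) :
    ∃ B : ℕ, ∀ n : ℕ, B ≤ n → h - n ∉ S := by
  have hf : {n : ℕ | h - n ∈ S}.Finite := hS.preimage fun a _ b _ e => by
    simpa using e
  obtain ⟨B, hB⟩ := hf.bddAbove
  exact ⟨B + 1, fun n hn hmem => by have := hB hmem; omega⟩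

lemma um_T_mem_fil : A.um 2 0 A.T ∈ A.fil 0 :=
  A.hom_le_fil 0 (A.um_mem_hom (isHom_of_mem A.T_mem) 0)

/-- A finite dimensional `F^0 𝒰(V)`-stable subspace is annihilated by all sufficiently long products
of generating modes of positive degree, since these modes lower the eigenvalues of `T(0)`. -/
lemma exists_le_genNil_of_actOn_le (Δ₀ : ℕ) {X : Submodule ℂ M} [FiniteDimensional ℂ X]
    (hX : A.actOn (A.fil 0) X ≤ X) : ∃ s, X ≤ A.genNil M Δ₀ s := by
  rw [actOn_le] at hX
  have hT : ∀ m ∈ X, A.actT0 M m ∈ X := hX _ A.um_T_mem_fil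
  refine A.exists_le_genNil fun m hm => A.exists_mem_genNil (fun k m hm => hX _ (A.fil_anti
    (by have := k.one_le_deg; omega) (A.gen_one_mem_fil k)) m hm)
    (A.le_iSup_inf_genEigenspace hT) (fun h => ?_) hm
  obtain ⟨B, hB⟩ := exists_nat_bound (A.finite_inf_genEigenspace_ne_bot hT) h
  exact ⟨B, fun n hn => not_not.1 (hB n hn)⟩

lemma one_mem_fil : (1 : A.CurrentAlgebra) ∈ A.fil 0 := A.filZero.one_mem

lemma mem_filZeroOrbit (m : M) : m ∈ A.filZeroOrbit m :=
  ⟨1, A.one_mem_fil, one_smul _ m⟩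

lemma smul_mem_filZeroOrbit {x : A.CurrentAlgebra} (hx : x ∈ A.fil 0) (m : M) :
    x • m ∈ A.filZeroOrbit m := ⟨x, hx, rfl⟩

lemma actOn_filZeroOrbit_le (m : M) : A.actOn (A.fil 0) (A.filZeroOrbit m) ≤ A.filZeroOrbit m := by
  refine (A.actOn_le).2 ?_
  rintro x hx _ ⟨y, hy, rfl⟩
  have h := A.mul_mem_fil hx hy
  rw [add_zero] at h
  exact ⟨x * y, h, mul_smul x y m⟩

lemma filZeroOrbit_le {X : Submodule ℂ M} (hX : A.actOn (A.fil 0) X ≤ X) {m : M} (hm : m ∈ X) :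
    A.filZeroOrbit m ≤ X := by
  rintro _ ⟨y, hy, rfl⟩
  exact hX (A.smul_mem_actOn hy hm)

/-- A module all of whose cyclic `F^0 𝒰(V)`-submodules are finite dimensional; contrary to a
`V`-module it need not be finitely generated. -/
def IsLocallyFinite (M : Type w) [AddCommGroup M] [Module ℂ M] [Module A.CurrentAlgebra M]
    [IsScalarTower ℂ A.CurrentAlgebra M] : Prop :=
  ∀ m : M, FiniteDimensional ℂ (A.filZeroOrbit m)

variable {A} in
lemma IsLocallyFinite.exists_mem_genNil (hM : A.IsLocallyFinite M) (Δ₀ : ℕ) (m : M) :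
    ∃ s, m ∈ A.genNil M Δ₀ s := by
  have := hM m
  obtain ⟨s, hs⟩ := A.exists_le_genNil_of_actOn_le Δ₀ (A.actOn_filZeroOrbit_le m)
  exact ⟨s, hs (A.mem_filZeroOrbit m)⟩

/-! ### Finite dimensional pieces of modules -/

/-- If `X` is a finite dimensional `F^0 𝒰(V)`-module, then all `F^{-n} 𝒰(V) X` are finite
dimensional. -/
lemma finiteDimensional_actOn_fil {Δ₀ : ℕ} (h₀ : A.IsC2Bound Δ₀) {X : Submodule ℂ M}
    [FiniteDimensional ℂ X] (hX : A.actOn (A.fil 0) X ≤ X) {s : ℕ} (hs : X ≤ A.genNil M Δ₀ s)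
    (n : ℕ) : ∀ p : ℤ, -n ≤ p → FiniteDimensional ℂ (A.actOn (A.fil p) X) := by
  induction n with
  | zero =>
    intro p hp
    exact Submodule.finiteDimensional_of_le ((A.actOn_mono (A.fil_anti (by omega)) le_rfl).trans hX)
  | succ n ih =>
    intro p hp
    rcases le_or_gt (-(n : ℤ)) p with h | h
    · exact ih p h
    have h1 : ∀ k : A.Gen Δ₀, FiniteDimensional ℂ (A.actOn (A.fil (p + k.deg)) X) := fun k =>
      ih _ (by have := k.one_le_deg; omega)
    have h2 := ih (p + 1) (by omega)
    refine Submodule.finiteDimensional_of_le (S₂ := (⨆ k : A.Gen Δ₀, (A.actOn (A.fil (p + k.deg))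
      X).map (Algebra.lsmul ℂ ℂ M (A.gen (-1) k))) ⊔ A.actOn (A.fil (p + 1)) X) ?_
    refine (A.actOn_le).2 fun x hx m hm => ?_
    obtain ⟨u, hu, t, ht, rfl⟩ := Submodule.mem_sup.1
      (A.fil_le_iSup_sup h₀ (p := p) (by omega) (s * Δ₀ + 1) hx)
    rw [add_smul, A.smul_eq_zero_of_mem_top h₀ s m (hs hm) _ _ le_rfl t ht, add_zero]
    obtain ⟨y, hy, z, hz, rfl⟩ := Submodule.mem_sup.1 hu
    rw [add_smul]
    refine Submodule.add_mem_sup ?_ (A.smul_mem_actOn hz hm)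
    clear hu hx
    induction hy using Submodule.iSup_induction' with
    | mem k y hy =>
      obtain ⟨z, hz, rfl⟩ := Submodule.mem_span_singleton_mul.1 hy
      refine Submodule.mem_iSup_of_mem k ⟨z • m, A.smul_mem_actOn hz hm, ?_⟩
      exact (mul_smul _ _ _).symm
    | zero => rw [zero_smul]; exact zero_mem _
    | add y z _ _ hy hz => rw [add_smul]; exact add_mem hy hz

/-- The elements of `⋃_p F^p 𝒰(V) X` form the submodule generated by `X`. -/
lemma exists_mem_actOn_fil {X : Submodule ℂ M} {m : M}
    (hm : m ∈ Submodule.span A.CurrentAlgebra (X : Set M)) :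
    ∃ n : ℕ, m ∈ A.actOn (A.fil (-n)) X := by
  induction hm using Submodule.span_induction with
  | mem m hm =>
    refine ⟨0, ?_⟩
    have h := A.smul_mem_actOn A.one_mem_fil hm
    rwa [one_smul] at h
  | zero => exact ⟨0, zero_mem _⟩
  | add x y _ _ hx hy =>
    obtain ⟨n, hx⟩ := hx
    obtain ⟨k, hy⟩ := hy
    exact ⟨max n k, add_mem (A.actOn_mono (A.fil_anti (by omega)) le_rfl hx)
      (A.actOn_mono (A.fil_anti (by omega)) le_rfl hy)⟩
  | smul u x _ hx =>
    obtain ⟨n, hx⟩ := hx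
    obtain ⟨p, hu⟩ := A.exists_mem_fil u
    refine ⟨(n - p).toNat, ?_⟩
    have : A.actOn (A.fil (-n)) X ≤
        (A.actOn (A.fil (-((n - p).toNat : ℤ))) X).comap (Algebra.lsmul ℂ ℂ M u) := by
      refine (A.actOn_le).2 fun y hy m hm => ?_
      change u • y • m ∈ A.actOn _ X
      rw [← mul_smul]
      exact A.smul_mem_actOn (A.fil_anti (by omega) (A.mul_mem_fil hu hy)) hm
    exact this hx

/-- A module generated by a finite dimensional `F^0 𝒰(V)`-submodule which is annihilated by long
products of generating modes is locally finite. -/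
lemma isLocallyFinite_of_span_eq_top {Δ₀ : ℕ} (h₀ : A.IsC2Bound Δ₀) {X : Submodule ℂ M}
    [FiniteDimensional ℂ X] (hX : A.actOn (A.fil 0) X ≤ X) {s : ℕ} (hs : X ≤ A.genNil M Δ₀ s)
    (hspan : Submodule.span A.CurrentAlgebra (X : Set M) = ⊤) : A.IsLocallyFinite M := by
  intro m
  obtain ⟨n, hn⟩ := A.exists_mem_actOn_fil (X := X) (m := m) (by rw [hspan]; trivial)
  have := A.finiteDimensional_actOn_fil h₀ hX hs n (-n) le_rfl
  refine Submodule.finiteDimensional_of_le (A.filZeroOrbit_le (X := A.actOn (A.fil (-n)) X) ?_ hn)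
  refine (A.actOn_le).2 fun x hx m hm => ?_
  have : A.actOn (A.fil (-n)) X ≤ (A.actOn (A.fil (-n)) X).comap (Algebra.lsmul ℂ ℂ M x) := by
    refine (A.actOn_le).2 fun y hy m hm => ?_
    change x • y • m ∈ A.actOn _ X
    rw [← mul_smul]
    have h := A.mul_mem_fil hx hy
    rw [zero_add] at h
    exact A.smul_mem_actOn h hm
  exact this hm

variable {A} in
/-- A `V`-module is generated by a finite dimensional `F^0 𝒰(V)`-submodule. -/
lemma IsVModule.exists_generating (hM : A.IsVModule M) :
    ∃ X : Submodule ℂ M, FiniteDimensional ℂ X ∧ A.actOn (A.fil 0) X ≤ X ∧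
      Submodule.span A.CurrentAlgebra (X : Set M) = ⊤ := by
  obtain ⟨t, ht⟩ := hM.finite.fg_top
  have := hM.finiteDimensional
  refine ⟨⨆ m : t, A.filZeroOrbit (m : M), inferInstance, ?_, ?_⟩
  · refine (A.actOn_le).2 fun x hx m hm => ?_
    induction hm using Submodule.iSup_induction' with
    | mem k y hy =>
      exact Submodule.mem_iSup_of_mem k (A.actOn_filZeroOrbit_le _ (A.smul_mem_actOn hx hy))
    | zero => rw [smul_zero]; exact zero_mem _
    | add y z _ _ hy hz => rw [smul_add]; exact add_mem hy hz
  · rw [eq_top_iff, ← ht]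
    exact Submodule.span_mono fun m hm =>
      Submodule.mem_iSup_of_mem (⟨m, hm⟩ : t) (A.mem_filZeroOrbit m)

variable {A} in
/-- In a `V`-module the generalized eigenspaces of `T(0)` are finite dimensional. -/
lemma IsVModule.finiteDimensional_genEigenspace (hA : A.IsC2Finite)
    (hM : A.IsVModule M) (h : ℂ) : FiniteDimensional ℂ (A.genEigenspace M h) := by
  obtain ⟨Δ₀, h₀⟩ := A.exists_isC2Bound hA
  obtain ⟨X, hfin, hX, hspan⟩ := hM.exists_generating
  obtain ⟨s, hs⟩ := A.exists_le_genNil_of_actOn_le Δ₀ hX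
  have hT : ∀ m ∈ X, A.actT0 M m ∈ X := A.actOn_le.1 hX _ A.um_T_mem_fil
  -- the part of generalized eigenvalue `h` which is visibly generated by `X`
  let N : ℂ → Submodule ℂ M := fun h => ⨆ (h' : ℂ) (d : ℤ) (_ : h = h' - d),
    A.actOn (A.hom d) (X ⊓ A.genEigenspace M h')
  have hN : ∀ h, N h ≤ A.genEigenspace M h := fun h => iSup_le fun h' => iSup₂_le fun d hd =>
    (A.actOn_le).2 fun x hx m hm => A.smul_mem_genEigenspace hx hd hm.2
  have hNtop : ∀ m, m ∈ ⨆ h, N h := by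
    intro m
    obtain ⟨n, hn⟩ := A.exists_mem_actOn_fil (X := X) (m := m) (by rw [hspan]; trivial)
    refine (A.actOn_le (Y := ⨆ h, N h)).2 (fun x hx y hy => ?_) hn
    obtain ⟨u, hu, t, ht, rfl⟩ := Submodule.mem_sup.1 (A.fil_le_homGe_sup _ (s * Δ₀ + 1) hx)
    rw [add_smul, A.smul_eq_zero_of_mem_top h₀ s y (hs hy) _ _ le_rfl t ht, add_zero]
    have : A.actOn (A.homGe (-n)) X ≤ ⨆ h, N h := by
      refine (A.actOn_le).2 fun u hu y hy => ?_
      replace hy := A.le_iSup_inf_genEigenspace hT hy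
      induction hy using Submodule.iSup_induction' with
      | mem h' y hy' =>
        have hle : A.homGe (-n) ≤ (⨆ h, N h).comap
            ((LinearMap.toSpanSingleton A.CurrentAlgebra M y).restrictScalars ℂ) := by
          refine iSup₂_le fun d _ v hv => ?_
          exact Submodule.mem_iSup_of_mem (h' - d) (Submodule.mem_iSup_of_mem h'
            (Submodule.mem_iSup_of_mem d (Submodule.mem_iSup_of_mem rfl
              (A.smul_mem_actOn hv hy'))))
        exact hle hu
      | zero => rw [smul_zero]; exact zero_mem _
      | add y z _ _ hy hz => rw [smul_add]; exact add_mem hy hz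
    exact this (A.smul_mem_actOn hu hy)
  have hle : A.genEigenspace M h ≤ N h := by
    intro m hm
    have hm' := hNtop m
    rw [iSup_split_single _ h] at hm'
    obtain ⟨a, ha, b, hb, rfl⟩ := Submodule.mem_sup.1 hm'
    have hb1 : b ∈ A.genEigenspace M h := by
      have := sub_mem hm (hN h ha)
      rwa [add_sub_cancel_left] at this
    have hb2 : b ∈ ⨆ (j : ℂ) (_ : j ≠ h), A.genEigenspace M j :=
      iSup₂_mono (fun j _ => hN j) hb
    have := (Submodule.disjoint_def.1 ((A.actT0 M).independent_maxGenEigenspace h)) b hb1 hb2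
    rwa [this, add_zero]
  obtain ⟨B, hB⟩ := exists_nat_bound (A.finite_inf_genEigenspace_ne_bot hT) h
  have := A.finiteDimensional_actOn_fil h₀ hX hs B (-B) le_rfl
  refine Submodule.finiteDimensional_of_le (S₂ := A.actOn (A.fil (-B)) X) (hle.trans ?_)
  refine iSup_le fun h' => iSup₂_le fun d hd => (A.actOn_le).2 fun x hx m hm => ?_
  rcases le_or_gt (-(B : ℤ)) d with hdB | hdB
  · exact A.smul_mem_actOn (A.fil_anti hdB (A.hom_le_fil d hx)) hm.1
  · have e := hB (-d).toNat (by omega)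
    have e' : (((-d).toNat : ℕ) : ℂ) = -(d : ℂ) := by
      have : (((-d).toNat : ℕ) : ℤ) = -d := by omega
      exact_mod_cast congrArg (Int.cast (R := ℂ)) this
    rw [e', hd, sub_neg_eq_add, sub_add_cancel] at e
    rw [not_not.1 e] at hm
    rw [(Submodule.mem_bot ℂ).1 hm, smul_zero]
    exact zero_mem _

end Modules


/-! ### Highest weight vectors -/

section HighestWeight

variable {M : Type w} [AddCommGroup M] [Module ℂ M] [Module A.CurrentAlgebra M]
  [IsScalarTower ℂ A.CurrentAlgebra M]

lemma gen_one_smul_of_mem_HW {Δ₀ : ℕ} (k : A.Gen Δ₀) {m : M} (hm : m ∈ A.HW M) :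
    A.gen 1 k • m = 0 :=
  hm _ _ (Subtype.property _) _ (by have := k.one_le_deg; omega)

/-- The highest weight vectors are annihilated by the left ideal `𝔍`. -/
lemma smul_eq_zero_of_mem_HW (hA : A.IsC2Finite) {m : M} (hm : m ∈ A.HW M)
    {x : A.CurrentAlgebra} (hx : x ∈ A.leftIdealJ) : x • m = 0 := by
  obtain ⟨Δ₀, h₀⟩ := A.exists_isC2Bound hA
  induction hx using Submodule.span_induction with
  | mem x hx =>
    obtain ⟨c, _, rfl⟩ := A.exists_coeff_of_mem_top h₀ le_rfl (A.fil_le_top le_rfl le_rfl hx)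
    rw [Finset.sum_smul]
    exact Finset.sum_eq_zero fun k _ => by rw [mul_smul, A.gen_one_smul_of_mem_HW k hm, smul_zero]
  | zero => exact zero_smul _ _
  | add x y _ _ hx hy => rw [add_smul, hx, hy, add_zero]
  | smul a x _ hx => rw [smul_eq_mul, mul_smul, hx, smul_zero]

lemma mem_HW_of_forall {m : M} (h : ∀ x ∈ A.fil 1, x • m = 0) : m ∈ A.HW M :=
  fun Δ v hv n hn => h _ (A.fil_anti (p := 1) (q := n) (by omega) (A.um_mem_fil hv n))

lemma smul_mem_HW (hA : A.IsC2Finite) {a : A.CurrentAlgebra} (ha : a ∈ A.fil 0) {m : M}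
    (hm : m ∈ A.HW M) : a • m ∈ A.HW M := by
  refine A.mem_HW_of_forall fun x hx => ?_
  rw [← mul_smul]
  exact A.smul_eq_zero_of_mem_HW hA hm
    (A.leftIdealJ_mul_mem (A.fil_le_leftIdealJ le_rfl hx) ha)

lemma filZeroOrbit_le_HW (hA : A.IsC2Finite) {m : M} (hm : m ∈ A.HW M) :
    A.filZeroOrbit m ≤ A.HW M := by
  rintro _ ⟨x, hx, rfl⟩
  exact A.smul_mem_HW hA hx hm

variable {A} in
/-- A nonzero locally finite module contains a nonzero highest weight vector: a nonzero element of
the last nonzero `F^p 𝒰(V) m`. -/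
lemma IsLocallyFinite.exists_mem_HW (hA : A.IsC2Finite) (hM : A.IsLocallyFinite M)
    [Nontrivial M] : ∃ m ∈ A.HW M, m ≠ 0 := by
  classical
  obtain ⟨Δ₀, h₀⟩ := A.exists_isC2Bound hA
  obtain ⟨m, hm⟩ := exists_ne (0 : M)
  obtain ⟨s, hs⟩ := hM.exists_mem_genNil Δ₀ m
  have hex : ∃ p : ℕ, ∀ x ∈ A.fil p, x • m = 0 := ⟨s * Δ₀ + 1, fun x hx =>
    A.smul_eq_zero_of_mem_top h₀ s m hs _ _ le_rfl x (A.fil_le_top le_rfl (by push_cast; rfl) hx)⟩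
  have hp := Nat.find_spec hex
  have hp0 : Nat.find hex ≠ 0 := fun h => by
    rw [h] at hp
    exact hm (by simpa using hp 1 A.one_mem_fil)
  have hlt := Nat.find_min hex (Nat.pred_lt hp0)
  push Not at hlt
  obtain ⟨x, hx, hxm⟩ := hlt
  refine ⟨x • m, A.mem_HW_of_forall fun y hy => ?_, hxm⟩
  rw [← mul_smul]
  refine hp _ ?_
  have h := A.mul_mem_fil hy hx
  rwa [show (1 : ℤ) + ((Nat.find hex).pred : ℕ) = (Nat.find hex : ℕ) by
    rw [Nat.pred_eq_sub_one]; omega] at h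

/-- The class of `T(0)` in the zero-mode algebra. -/
def zeroModeT : A.ZeroMode := A.toZeroMode ⟨A.um 2 0 A.T, A.um_T_mem_fil⟩

/-- The eigenvalues of `T(0)` in the zero-mode algebra; there are finitely many if this algebra is
finite dimensional. -/
def hwWeights : Finset ℂ := (minpoly ℂ A.zeroModeT).roots.toFinset

/-- The eigenvalues of `T(0)` on highest weight vectors are among the finitely many `hwWeights`. -/
lemma mem_hwWeights (hA : A.IsC2Finite) {m : M} (hm : m ∈ A.HW M) (hm0 : m ≠ 0) {h : ℂ}
    (hT : A.um 2 0 A.T • m = h • m) : h ∈ A.hwWeights := by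
  have := A.finiteDimensional_zeroMode hA
  have hint : IsIntegral ℂ A.zeroModeT := IsIntegral.of_finite ℂ _
  set t : A.filZero := ⟨A.um 2 0 A.T, A.um_T_mem_fil⟩ with ht
  set P := minpoly ℂ A.zeroModeT with hP
  have h1 : A.toZeroMode (Polynomial.aeval t P) = 0 := by
    rw [← Polynomial.aeval_algHom_apply]
    exact minpoly.aeval ℂ A.zeroModeT
  have h2 : A.filZero.val (Polynomial.aeval t P) ∈ A.leftIdealJ :=
    (Ideal.Quotient.eq_zero_iff_mem (I := A.idealJZero)).1 h1
  have h3 := A.smul_eq_zero_of_mem_HW hA hm h2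
  rw [← Polynomial.aeval_algHom_apply] at h3
  change Algebra.lsmul ℂ ℂ M (Polynomial.aeval (A.um 2 0 A.T) P) m = 0 at h3
  rw [← Polynomial.aeval_algHom_apply, Module.End.aeval_apply_of_hasEigenvector
    (μ := h) ⟨Module.End.mem_eigenspace_iff.2 hT, hm0⟩] at h3
  have h4 := (smul_eq_zero.1 h3).resolve_right hm0
  exact Multiset.mem_toFinset.2 ((Polynomial.mem_roots (minpoly.ne_zero hint)).2 h4)

/-- A generalized eigenvector produces an eigenvector. -/
lemma exists_eigenvector_of_inf_ne_bot {X : Submodule ℂ M} (hX : ∀ m ∈ X, A.actT0 M m ∈ X) {h : ℂ}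
    (hh : X ⊓ A.genEigenspace M h ≠ ⊥) : ∃ y ∈ X, y ≠ 0 ∧ A.um 2 0 A.T • y = h • y := by
  classical
  obtain ⟨m, ⟨hmX, hm⟩, hm0⟩ := (Submodule.ne_bot_iff _).1 hh
  have hex := (Module.End.mem_maxGenEigenspace _ _ _).1 hm
  have hk := Nat.find_spec hex
  have hk0 : Nat.find hex ≠ 0 := fun e => hm0 (by rw [e] at hk; simpa using hk)
  obtain ⟨k, e⟩ := Nat.exists_eq_succ_of_ne_zero hk0
  have hXk : ∀ k : ℕ, ((A.actT0 M - h • 1) ^ k) m ∈ X := by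
    intro k
    induction k with
    | zero => simpa using hmX
    | succ k ih =>
      rw [pow_succ', Module.End.mul_apply]
      exact sub_mem (hX _ ih) (Submodule.smul_mem _ _ ih)
  refine ⟨((A.actT0 M - h • 1) ^ k) m, hXk k, Nat.find_min hex (by omega), ?_⟩
  rw [e, Nat.succ_eq_add_one, pow_succ', Module.End.mul_apply] at hk
  exact sub_eq_zero.1 hk

lemma actT0_mem_filZeroOrbit {m y : M} (hy : y ∈ A.filZeroOrbit m) :
    A.actT0 M y ∈ A.filZeroOrbit m :=
  A.actOn_filZeroOrbit_le m (A.smul_mem_actOn A.um_T_mem_fil hy)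

variable {A} in
lemma IsLocallyFinite.HW_le (hA : A.IsC2Finite) (hM : A.IsLocallyFinite M) :
    A.HW M ≤ ⨆ h : A.hwWeights, A.genEigenspace M (h : ℂ) := by
  intro m hm
  have := hM m
  have hle := A.filZeroOrbit_le_HW hA hm
  refine (iSup_le fun h => ?_ : ⨆ h, A.filZeroOrbit m ⊓ A.genEigenspace M h ≤ _)
    (A.le_iSup_inf_genEigenspace (X := A.filZeroOrbit m) (fun y hy => A.actT0_mem_filZeroOrbit hy)
      (A.mem_filZeroOrbit m))
  by_cases hb : A.filZeroOrbit m ⊓ A.genEigenspace M h = ⊥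
  · rw [hb]; exact bot_le
  · obtain ⟨y, hy, hy0, hT⟩ := A.exists_eigenvector_of_inf_ne_bot
      (fun y hy => A.actT0_mem_filZeroOrbit hy) hb
    exact le_trans inf_le_right (le_iSup (fun h : A.hwWeights => A.genEigenspace M (h : ℂ))
      ⟨h, A.mem_hwWeights hA (hle hy) hy0 hT⟩)

variable {A} in
/-- A nonzero locally finite module contains a highest weight vector which is an eigenvector of
`T(0)`. -/
lemma IsLocallyFinite.exists_eigenvector (hA : A.IsC2Finite) (hM : A.IsLocallyFinite M)
    [Nontrivial M] : ∃ h ∈ A.hwWeights, ∃ y : M, y ≠ 0 ∧ A.um 2 0 A.T • y = h • y := by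
  obtain ⟨m, hm, hm0⟩ := hM.exists_mem_HW hA
  have := hM m
  have hle := A.filZeroOrbit_le_HW hA hm
  by_contra hcon
  push Not at hcon
  have hbot : ⨆ h, A.filZeroOrbit m ⊓ A.genEigenspace M h = ⊥ := by
    refine iSup_eq_bot.2 fun h => ?_
    by_contra hb
    obtain ⟨y, hy, hy0, hT⟩ := A.exists_eigenvector_of_inf_ne_bot
      (fun y hy => A.actT0_mem_filZeroOrbit hy) hb
    exact hcon h (A.mem_hwWeights hA (hle hy) hy0 hT) y hy0 hT
  have := A.le_iSup_inf_genEigenspace (X := A.filZeroOrbit m)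
    (fun y hy => A.actT0_mem_filZeroOrbit hy) (A.mem_filZeroOrbit m)
  rw [hbot] at this
  exact hm0 this

end HighestWeight

/-! ### Finite length -/

section FiniteLength

variable {M : Type w} [AddCommGroup M] [Module ℂ M] [Module A.CurrentAlgebra M]
  [IsScalarTower ℂ A.CurrentAlgebra M]

universe w'

variable {N : Type w'} [AddCommGroup N] [Module ℂ N] [Module A.CurrentAlgebra N]
  [IsScalarTower ℂ A.CurrentAlgebra N]

lemma map_filZeroOrbit (f : M →ₗ[A.CurrentAlgebra] N) (m : M) :
    (A.filZeroOrbit m).map (f.restrictScalars ℂ) = A.filZeroOrbit (f m) := by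
  ext y
  constructor
  · rintro ⟨_, ⟨x, hx, rfl⟩, rfl⟩
    exact ⟨x, hx, (map_smul f x m).symm⟩
  · rintro ⟨x, hx, rfl⟩
    exact ⟨_, ⟨x, hx, rfl⟩, map_smul f x m⟩

variable {A} in
lemma IsLocallyFinite.of_injective (hN : A.IsLocallyFinite N) (f : M →ₗ[A.CurrentAlgebra] N)
    (hf : Function.Injective f) : A.IsLocallyFinite M := by
  intro m
  have := hN (f m)
  rw [← map_filZeroOrbit] at this
  exact Module.Finite.equiv (Submodule.equivMapOfInjective (f.restrictScalars ℂ) hf _).symm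

variable {A} in
lemma IsLocallyFinite.of_surjective (hM : A.IsLocallyFinite M) (f : M →ₗ[A.CurrentAlgebra] N)
    (hf : Function.Surjective f) : A.IsLocallyFinite N := by
  intro n
  obtain ⟨m, rfl⟩ := hf n
  have := hM m
  rw [← map_filZeroOrbit]
  infer_instance

lemma map_mem_genEigenspace (f : M →ₗ[A.CurrentAlgebra] N) {h : ℂ} {m : M}
    (hm : m ∈ A.genEigenspace M h) : f m ∈ A.genEigenspace N h := by
  obtain ⟨k, hk⟩ := (Module.End.mem_maxGenEigenspace _ _ _).1 hm
  refine (Module.End.mem_maxGenEigenspace _ _ _).2 ⟨k, ?_⟩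
  have : ∀ k : ℕ, ((A.actT0 N - h • 1) ^ k) (f m) = f (((A.actT0 M - h • 1) ^ k) m) := by
    intro k
    induction k with
    | zero => simp
    | succ k ih =>
      rw [pow_succ', pow_succ', Module.End.mul_apply, Module.End.mul_apply, ih]
      generalize ((A.actT0 M - h • 1) ^ k) m = y
      change A.um 2 0 A.T • f y - h • f y = f (A.um 2 0 A.T • y - h • y)
      rw [map_sub, map_smul]
      exact congrArg _ ((f.restrictScalars ℂ).map_smul h y).symm
  rw [this, hk, map_zero]

variable {A} in
/-- Distinct nested submodules of a locally finite module differ in a generalized eigenspace of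
`T(0)` for one of the finitely many possible highest weights. -/
lemma IsLocallyFinite.exists_mem_genEigenspace_of_lt (hA : A.IsC2Finite)
    (hM : A.IsLocallyFinite M) {P Q : Submodule A.CurrentAlgebra M} (h : P < Q) :
    ∃ h ∈ A.hwWeights, ∃ y ∈ A.genEigenspace M h, y ∈ Q ∧ y ∉ P := by
  have hQ : A.IsLocallyFinite (Q ⧸ P.submoduleOf Q) :=
    (hM.of_injective Q.subtype Subtype.val_injective).of_surjective _
      (Submodule.mkQ_surjective (P.submoduleOf Q))
  have : Nontrivial (Q ⧸ P.submoduleOf Q) := by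
    refine Submodule.Quotient.nontrivial_iff.2 fun e => h.not_ge ?_
    exact Submodule.comap_subtype_eq_top.1 e
  obtain ⟨μ, hμ, y, hy0, hT⟩ := hQ.exists_eigenvector hA
  obtain ⟨⟨y, hyQ⟩, rfl⟩ := Submodule.mkQ_surjective _ y
  have hyP : y ∉ P := fun hy => hy0 ((Submodule.Quotient.mk_eq_zero _).2 hy)
  have hTP : A.um 2 0 A.T • y - μ • y ∈ P := by
    have e := sub_eq_zero.2 hT
    rw [← map_smul] at e
    exact (Submodule.Quotient.mk_eq_zero (P.submoduleOf Q)).1 e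
  refine ⟨μ, hμ, ?_⟩
  have := hM y
  -- the components of `y` lie in `Q`; only that of eigenvalue `μ` survives modulo `P`
  have hy := A.le_iSup_inf_genEigenspace (X := A.filZeroOrbit y)
    (fun y hy => A.actT0_mem_filZeroOrbit hy) (A.mem_filZeroOrbit y)
  rw [iSup_split_single _ μ] at hy
  obtain ⟨a, ha, b, hb, hab⟩ := Submodule.mem_sup.1 hy
  have haQ : a ∈ Q := by
    obtain ⟨x, _, rfl⟩ := ha.1
    exact Q.smul_mem x hyQ
  refine ⟨a, ha.2, haQ, fun haP => hyP ?_⟩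
  have h1 : P.mkQ y ∈ A.genEigenspace (M ⧸ P) μ := by
    refine (Module.End.mem_maxGenEigenspace _ _ _).2 ⟨1, ?_⟩
    rw [pow_one]
    exact (Submodule.Quotient.mk_eq_zero P).2 hTP
  have h2 : P.mkQ y ∈ ⨆ (j : ℂ) (_ : j ≠ μ), A.genEigenspace (M ⧸ P) j := by
    rw [← hab, map_add, show P.mkQ a = 0 from (Submodule.Quotient.mk_eq_zero P).2 haP, zero_add]
    refine (iSup₂_le fun j hj => ?_ : (⨆ (j : ℂ) (_ : j ≠ μ), A.filZeroOrbit y ⊓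
      A.genEigenspace M j) ≤ (⨆ (j : ℂ) (_ : j ≠ μ), A.genEigenspace (M ⧸ P) j).comap
        (P.mkQ.restrictScalars ℂ)) hb
    exact fun z hz => Submodule.mem_iSup_of_mem j (Submodule.mem_iSup_of_mem hj
      (A.map_mem_genEigenspace P.mkQ hz.2))
  exact (Submodule.Quotient.mk_eq_zero P).1 (Submodule.disjoint_def.1
    (Module.End.independent_maxGenEigenspace (A.actT0 (M ⧸ P)) μ) _ h1 h2)

variable {A} in
/-- A locally finite module with finite dimensional generalized eigenspaces of `T(0)` has finite
length. -/
lemma IsLocallyFinite.isNoetherian_isArtinian (hA : A.IsC2Finite) (hM : A.IsLocallyFinite M)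
    (hfin : ∀ h, FiniteDimensional ℂ (A.genEigenspace M h)) :
    IsNoetherian A.CurrentAlgebra M ∧ IsArtinian A.CurrentAlgebra M := by
  let K : Submodule ℂ M := ⨆ h : A.hwWeights, A.genEigenspace M (h : ℂ)
  have hK : FiniteDimensional ℂ K := inferInstanceAs (FiniteDimensional ℂ
    (⨆ h : A.hwWeights, A.genEigenspace M (h : ℂ) : Submodule ℂ M))
  let φ : Submodule A.CurrentAlgebra M → Submodule ℂ K := fun P =>
    (P.restrictScalars ℂ).comap K.subtype
  have hφ : StrictMono φ := by
    intro P Q h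
    obtain ⟨μ, hμ, y, hy, hyQ, hyP⟩ := hM.exists_mem_genEigenspace_of_lt hA h
    have hyK : y ∈ K := Submodule.mem_iSup_of_mem (⟨μ, hμ⟩ : A.hwWeights) hy
    exact lt_of_le_of_ne (fun x hx => h.le hx) fun e =>
      hyP ((SetLike.ext_iff.1 e ⟨y, hyK⟩).2 hyQ)
  exact ⟨isNoetherian_iff'.2 hφ.wellFoundedGT, hφ.wellFoundedLT⟩

variable {A} in
lemma IsVModule.isNoetherian_isArtinian (hA : A.IsC2Finite) (hM : A.IsVModule M) :
    IsNoetherian A.CurrentAlgebra M ∧ IsArtinian A.CurrentAlgebra M :=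
  IsLocallyFinite.isNoetherian_isArtinian hA hM.finiteDimensional
    (hM.finiteDimensional_genEigenspace hA)

variable {A} in
lemma IsVModule.submodule (hA : A.IsC2Finite) (hM : A.IsVModule M)
    (P : Submodule A.CurrentAlgebra M) : A.IsVModule P := by
  have := (hM.isNoetherian_isArtinian hA).1
  exact ⟨inferInstance, IsLocallyFinite.of_injective hM.finiteDimensional P.subtype
    Subtype.val_injective⟩

variable {A} in
lemma IsVModule.of_surjective (hM : A.IsVModule M) (f : M →ₗ[A.CurrentAlgebra] N)
    (hf : Function.Surjective f) : A.IsVModule N := by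
  have := hM.finite
  exact ⟨Module.Finite.of_surjective f hf, IsLocallyFinite.of_surjective hM.finiteDimensional f hf⟩

variable {A} in
lemma IsVModule.finiteDimensional_HW (hA : A.IsC2Finite) (hM : A.IsVModule M) :
    FiniteDimensional ℂ (A.HW M) := by
  have := hM.finiteDimensional_genEigenspace hA
  exact Submodule.finiteDimensional_of_le (IsLocallyFinite.HW_le hA hM.finiteDimensional)

variable {A} in
theorem IsVModule.exists_compositionSeries (hA : A.IsC2Finite) (hM : A.IsVModule M) :
    ∃ (n : ℕ) (F : Fin (n + 1) → Submodule A.CurrentAlgebra M),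
      F 0 = ⊥ ∧ F (Fin.last n) = ⊤ ∧ (∀ i, A.IsVModule (F i)) ∧
      ∀ i : Fin n, F i.castSucc < F i.succ ∧
        A.IsSimpleVModule (F i.succ ⧸ (F i.castSucc).submoduleOf (F i.succ)) := by
  obtain ⟨h1, h2⟩ := hM.isNoetherian_isArtinian hA
  obtain ⟨s, hs0, hs1⟩ :=
    exists_compositionSeries_of_isNoetherian_isArtinian A.CurrentAlgebra M
  refine ⟨s.length, s, hs0, hs1, fun i => hM.submodule hA _, fun i => ⟨(s.step i).lt, ?_, ?_⟩⟩
  · exact (hM.submodule hA _).of_surjective _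
      (Submodule.mkQ_surjective ((s i.castSucc).submoduleOf (s i.succ)))
  · exact (covBy_iff_quot_is_simple (s.step i).le).1 (s.step i)

/-! ### Graded modules -/

lemma exists_nat_bound_cone (S : Finset ℂ) (h : ℂ) : ∃ B : ℕ, ∀ n : ℕ, B ≤ n → h - n ∉ cone S := by
  have hf : {n : ℕ | h - n ∈ cone S}.Finite := by
    refine (S.finite_toSet.biUnion (t := fun s => {n : ℕ | ∃ k : ℕ, h - n = s + k})
      fun s _ => ?_).subset fun n ⟨s, hs, k, hk⟩ => Set.mem_biUnion hs ⟨k, hk⟩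
    by_cases hN : ∃ N : ℕ, h - s = N
    · obtain ⟨N, hN⟩ := hN
      refine (Set.finite_Iic N).subset fun n ⟨k, hk⟩ => ?_
      have e : (N : ℂ) = ((n + k : ℕ) : ℂ) := by
        rw [← hN]; push_cast; linear_combination hk
      have e' : N = n + k := by exact_mod_cast e
      exact Set.mem_Iic.2 (by omega)
    · refine Set.finite_empty.subset fun n ⟨k, hk⟩ => hN ⟨n + k, ?_⟩
      push_cast
      linear_combination hk
  obtain ⟨B, hB⟩ := hf.bddAbove
  exact ⟨B + 1, fun n hn hmem => by have := hB hmem; omega⟩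

variable {A} in
/-- A graded module with finite dimensional pieces is locally finite. -/
lemma IsGradedModule.isLocallyFinite (hA : A.IsC2Finite) (hM : A.IsGradedModule M)
    (hfin : ∀ h, FiniteDimensional ℂ (A.genEigenspace M h)) : A.IsLocallyFinite M := by
  obtain ⟨S, -, hS⟩ := hM
  obtain ⟨Δ₀, h₀⟩ := A.exists_isC2Bound hA
  have htop := hS.submodule_iSup_eq_top
  have hbot : ∀ h ∉ cone S, A.genEigenspace M h = ⊥ := by
    intro h hh
    have hd : Disjoint (A.genEigenspace M h) (⨆ (j : ℂ) (_ : j ≠ h), A.genEigenspace M j) :=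
      Module.End.independent_maxGenEigenspace (A.actT0 M) h
    have : (⨆ (j : ℂ) (_ : j ≠ h), A.genEigenspace M j) = ⊤ := by
      rw [eq_top_iff, ← htop]
      exact iSup_le fun j => le_iSup₂_of_le (f := fun (j : ℂ) (_ : j ≠ h) => A.genEigenspace M j)
        (j : ℂ) (fun e => hh (e ▸ j.2)) le_rfl
    rwa [this, disjoint_top] at hd
  intro m
  have hm : m ∈ ⨆ h : cone S, A.genEigenspace M (h : ℂ) := by rw [htop]; trivial
  induction hm using Submodule.iSup_induction' with
  | mem h m hm =>
    obtain ⟨s, hs⟩ : ∃ s, m ∈ A.genNil M Δ₀ s := by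
      obtain ⟨B, hB⟩ := exists_nat_bound_cone S h
      exact ⟨B, A.mem_genNil_of_mem_genEigenspace (X := ⊤) (fun _ _ _ => trivial) B h
        (fun n hn => by rw [hbot _ (hB n hn), inf_bot_eq]) m ⟨trivial, hm⟩⟩
    refine Submodule.finiteDimensional_of_le
      (S₂ := ⨆ d : Fin (s * Δ₀ + 1), A.genEigenspace M (h - (d : ℕ))) ?_
    rintro _ ⟨x, hx, rfl⟩
    change x • m ∈ _
    obtain ⟨u, hu, t, ht, rfl⟩ := Submodule.mem_sup.1 (A.fil_le_homGe_sup 0 (s * Δ₀ + 1) hx)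
    rw [add_smul, A.smul_eq_zero_of_mem_top h₀ s m hs _ _ le_rfl t ht, add_zero]
    refine (iSup₂_le fun d hd v hv => ?_ : A.homGe 0 ≤ (⨆ d : Fin (s * Δ₀ + 1),
      A.genEigenspace M ((h : ℂ) - (d : ℕ))).comap
        ((LinearMap.toSpanSingleton A.CurrentAlgebra M m).restrictScalars ℂ)) hu
    change v • m ∈ (⨆ d : Fin (s * Δ₀ + 1), A.genEigenspace M ((h : ℂ) - (d : ℕ)))
    rcases lt_or_ge d (s * Δ₀ + 1) with hd' | hd'
    · lift d to ℕ using hd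
      exact Submodule.mem_iSup_of_mem (⟨d, by exact_mod_cast hd'⟩ : Fin (s * Δ₀ + 1))
        (A.smul_mem_genEigenspace hv (by simp) hm)
    · rw [A.smul_eq_zero_of_mem_top h₀ s m hs d _ le_rfl v
        (A.fil_le_top le_rfl hd' (A.hom_le_fil d hv))]
      exact zero_mem _
  | zero =>
    refine Submodule.finiteDimensional_of_le (S₂ := (⊥ : Submodule ℂ M)) ?_
    rintro _ ⟨x, _, rfl⟩
    exact smul_zero x
  | add y z _ _ hy hz =>
    refine Submodule.finiteDimensional_of_le (S₂ := A.filZeroOrbit y ⊔ A.filZeroOrbit z) ?_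
    rintro _ ⟨x, hx, rfl⟩
    change x • (y + z) ∈ _
    rw [smul_add]
    exact Submodule.add_mem_sup (A.smul_mem_filZeroOrbit hx y) (A.smul_mem_filZeroOrbit hx z)

variable {A} in
theorem IsGradedModule.isVModule_iff (hA : A.IsC2Finite) (hM : A.IsGradedModule M) :
    A.IsVModule M ↔ ∀ h : ℂ, FiniteDimensional ℂ (A.genEigenspace M h) := by
  refine ⟨fun h => h.finiteDimensional_genEigenspace hA, fun h => ?_⟩
  have hl := hM.isLocallyFinite hA h
  have := (hl.isNoetherian_isArtinian hA h).1
  exact ⟨inferInstance, hl⟩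

end FiniteLength

/-! ### The functor of highest weight vectors -/

section HighestWeightFunctor

variable (M : Type w) [AddCommGroup M] [Module ℂ M] [Module A.CurrentAlgebra M]
  [IsScalarTower ℂ A.CurrentAlgebra M]

/-- The action of the zero-mode algebra on the highest weight vectors. -/
def zeroModeAct (hA : A.IsC2Finite) : A.ZeroMode →+* Module.End ℂ (A.HW M) :=
  Ideal.Quotient.lift A.idealJZero
    { toFun := fun a => (Algebra.lsmul ℂ ℂ M (a : A.CurrentAlgebra)).restrict
        fun _ hm => A.smul_mem_HW hA a.2 hm
      map_one' := by ext m; exact one_smul A.CurrentAlgebra (m : M)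
      map_mul' := fun a b => by
        ext m; exact mul_smul (a : A.CurrentAlgebra) (b : A.CurrentAlgebra) (m : M)
      map_zero' := by ext m; exact zero_smul A.CurrentAlgebra (m : M)
      map_add' := fun a b => by
        ext m; exact add_smul (a : A.CurrentAlgebra) (b : A.CurrentAlgebra) (m : M) }
    fun a ha => by ext m; exact A.smul_eq_zero_of_mem_HW hA m.2 ha

/-- The space of highest weight vectors as a module over the zero-mode algebra. -/
def HWSpace (_ : A.IsC2Finite) : Type w := A.HW M

instance (hA : A.IsC2Finite) : AddCommGroup (A.HWSpace M hA) :=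
  inferInstanceAs (AddCommGroup (A.HW M))

instance (hA : A.IsC2Finite) : Module A.ZeroMode (A.HWSpace M hA) :=
  Module.compHom (A.HW M) (A.zeroModeAct M hA)

variable {M} in
/-- The inclusion of the highest weight vectors. -/
def HWSpace.val {hA : A.IsC2Finite} : A.HWSpace M hA →+ M := (A.HW M).subtype.toAddMonoidHom

variable {M} in
lemma HWSpace.val_injective {hA : A.IsC2Finite} :
    Function.Injective (HWSpace.val A : A.HWSpace M hA →+ M) := Subtype.val_injective

variable {M} in
lemma HWSpace.val_smul {hA : A.IsC2Finite} (a : A.filZero) (x : A.HWSpace M hA) :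
    HWSpace.val A (A.toZeroMode a • x) = (a : A.CurrentAlgebra) • HWSpace.val A x := rfl

variable {M} {N : Type w} [AddCommGroup N] [Module ℂ N] [Module A.CurrentAlgebra N]
  [IsScalarTower ℂ A.CurrentAlgebra N]

lemma map_mem_HW (f : M →ₗ[A.CurrentAlgebra] N) {m : M} (hm : m ∈ A.HW M) : f m ∈ A.HW N :=
  fun Δ v hv n hn => by rw [← map_smul, hm Δ v hv n hn, map_zero]

/-- The restriction of a homomorphism to highest weight vectors. -/
def HWSpace.map (hA : A.IsC2Finite) (f : M →ₗ[A.CurrentAlgebra] N) :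
    A.HWSpace M hA →ₗ[A.ZeroMode] A.HWSpace N hA where
  toFun x := ⟨f x.1, A.map_mem_HW f x.2⟩
  map_add' x y := Subtype.ext (f.map_add x.1 y.1)
  map_smul' a x := by
    obtain ⟨a, rfl⟩ := Ideal.Quotient.mk_surjective a
    exact Subtype.ext (f.map_smul (a : A.CurrentAlgebra) x.1)

/-- The complex structure of `HW(M)` obtained from the zero-mode algebra is the given one. -/
lemma algebraMap_smul_HWSpace {hA : A.IsC2Finite} (c : ℂ) (x : A.HWSpace M hA) :
    HWSpace.val A (algebraMap ℂ A.ZeroMode c • x) = c • HWSpace.val A x := by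
  rw [← A.toZeroMode.commutes c, HWSpace.val_smul]
  exact algebraMap_smul A.CurrentAlgebra c (HWSpace.val A x)

end HighestWeightFunctor

/-- A criterion for finite dimensionality in terms of the complex structure which an object of the
category of modules gets from the zero-mode algebra. -/
lemma finiteDimensional_of_injective_addHom (W : ModuleCat.{w} A.ZeroMode) {X : Type*}
    [AddCommGroup X] [Module ℂ X] [FiniteDimensional ℂ X] (f : W →+ X)
    (hf : Function.Injective f) (h : ∀ (c : ℂ) (x : W),
      f (algebraMap ℂ A.ZeroMode c • x) = c • f x) : FiniteDimensional ℂ W :=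
  FiniteDimensional.of_injective (V₂ := X) { f with map_smul' := h } hf


/-- The functor `HW` from `V`-modules to finite dimensional modules over the zero-mode algebra. -/
def hwFunctor (hA : A.IsC2Finite) : A.VModCat.{u, w} ⥤ A.ZeroModCat.{u, w} where
  obj M := ⟨ModuleCat.of A.ZeroMode (A.HWSpace M.obj hA), by
    have := M.property.finiteDimensional_HW hA
    exact A.finiteDimensional_of_injective_addHom (ModuleCat.of A.ZeroMode (A.HWSpace M.obj hA))
      (X := A.HW M.obj) (AddMonoidHom.id (A.HW M.obj)) (fun _ _ h => h)
      fun c x => Subtype.ext (A.algebraMap_smul_HWSpace (hA := hA) c x)⟩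
  map f := ObjectProperty.homMk (ModuleCat.ofHom (HWSpace.map A hA f.hom.hom))

lemma exists_hwFunctor (hA : A.IsC2Finite) :
    ∃ (Φ : A.VModCat.{u, w} ⥤ A.ZeroModCat.{u, w})
      (ι : ∀ M : A.VModCat.{u, w}, (Φ.obj M).obj →ₗ[ℂ] M.obj),
      (∀ M, Function.Injective (ι M)) ∧
      (∀ M, LinearMap.range (ι M) = A.HW M.obj) ∧
      (∀ M (a : A.filZero) (x : (Φ.obj M).obj),
        ι M (A.toZeroMode a • x) = (a : A.CurrentAlgebra) • ι M x) ∧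
      (∀ (M N : A.VModCat.{u, w}) (f : M ⟶ N) (x : (Φ.obj M).obj),
        ι N ((Φ.map f).hom x) = f.hom (ι M x)) := by
  refine ⟨A.hwFunctor hA, fun M =>
    { toFun := fun x : A.HWSpace M.obj hA => HWSpace.val A x
      map_add' := fun _ _ => rfl
      map_smul' := fun c x => A.algebraMap_smul_HWSpace c x },
    fun M => Subtype.val_injective, fun M => ?_, fun M a x => rfl, fun M N f x => rfl⟩
  ext m
  exact ⟨fun ⟨x, hx⟩ => hx ▸ x.2, fun hm => ⟨⟨m, hm⟩, rfl⟩⟩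

/-! ### Simple modules over the zero-mode algebra -/

lemma isSimpleModule_obj (W : A.ZeroModCat.{u, w}) [Simple W] :
    IsSimpleModule A.ZeroMode W.obj := by
  have hnt : Nontrivial W.obj := by
    by_contra h
    rw [not_nontrivial_iff_subsingleton] at h
    refine id_nonzero W (ObjectProperty.hom_ext _ ?_)
    ext x
    exact Subsingleton.elim _ _
  refine (isSimpleModule_iff ..).2 { eq_bot_or_eq_top := fun N => ?_ }
  have := W.property
  let N' : A.ZeroModCat.{u, w} := ⟨ModuleCat.of A.ZeroMode N,
    A.finiteDimensional_of_injective_addHom (ModuleCat.of A.ZeroMode N) (X := W.obj)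
      N.subtype.toAddMonoidHom N.injective_subtype fun c x => rfl⟩
  let f : N' ⟶ W := ObjectProperty.homMk (ModuleCat.ofHom N.subtype)
  have : Mono f := (ObjectProperty.ι _).mono_of_mono_map
    ((ModuleCat.mono_iff_injective (ModuleCat.ofHom N.subtype)).2 N.injective_subtype)
  by_cases hf : f = 0
  · left
    refine (Submodule.eq_bot_iff _).2 fun x hx => ?_
    have h : f.hom.hom (⟨x, hx⟩ : N) = (0 : N' ⟶ W).hom.hom (⟨x, hx⟩ : N) := by rw [hf]
    exact h
  · right
    have : IsIso f := isIso_of_mono_of_nonzero hf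
    have : IsIso f.hom := (ObjectProperty.isIso_hom_iff f).2 this
    rw [Submodule.eq_top_iff']
    intro x
    obtain ⟨y, hy⟩ := ((ConcreteCategory.isIso_iff_bijective f.hom).1 this).2 x
    exact hy ▸ (show N from y).2

/-- Up to isomorphism, a module of finite length has finitely many simple quotients: they occur
among the factors of a composition series. -/
lemma exists_factor_equiv {R M W : Type*} [Ring R] [AddCommGroup M] [Module R M] [AddCommGroup W]
    [Module R W] [IsSimpleModule R W] (s : CompositionSeries (Submodule R M)) (h₀ : s.head = ⊥)
    (h₁ : s.last = ⊤) (f : M →ₗ[R] W) (hf : f ≠ 0) :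
    ∃ i : Fin s.length, Nonempty
      (W ≃ₗ[R] (s i.succ) ⧸ (s i.castSucc).submoduleOf (s i.succ)) := by
  obtain ⟨i, hi, hi'⟩ : ∃ i : Fin s.length, s i.castSucc ≤ LinearMap.ker f ∧
      ¬ s i.succ ≤ LinearMap.ker f := by
    by_contra! h
    have hle : ∀ i, s i ≤ LinearMap.ker f := fun i => by
      induction i using Fin.induction with
      | zero => exact h₀.le.trans bot_le
      | succ i ih => exact h i ih
    exact hf (LinearMap.ker_eq_top.1 (top_le_iff.1 (h₁ ▸ hle (Fin.last _))))
  have : IsSimpleModule R (s i.succ ⧸ (s i.castSucc).submoduleOf (s i.succ)) :=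
    (covBy_iff_quot_is_simple (s.step i).le).1 (s.step i)
  refine ⟨i, ⟨(LinearEquiv.ofBijective (((s i.castSucc).submoduleOf (s i.succ)).liftQ
    (f.domRestrict (s i.succ)) fun x hx => hi hx) (LinearMap.bijective_of_ne_zero ?_)).symm⟩⟩
  intro h0
  refine hi' fun x hx => ?_
  exact LinearMap.congr_fun h0 (Submodule.Quotient.mk ⟨x, hx⟩)

lemma exists_simple_zeroModCat (hA : A.IsC2Finite) :
    ∃ (r : ℕ) (S : Fin r → A.ZeroModCat.{u, w}), (∀ i, Simple (S i)) ∧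
      ∀ W : A.ZeroModCat.{u, w}, Simple W → ∃ i, Nonempty (W ≅ S i) := by
  classical
  have := A.finiteDimensional_zeroMode hA
  have : IsNoetherian A.ZeroMode A.ZeroMode := isNoetherian_of_tower ℂ inferInstance
  have : IsArtinian A.ZeroMode A.ZeroMode := isArtinian_of_tower ℂ inferInstance
  obtain ⟨s, h₀, h₁⟩ :=
    exists_compositionSeries_of_isNoetherian_isArtinian A.ZeroMode A.ZeroMode
  let P (i : Fin s.length) (W : A.ZeroModCat.{u, w}) : Prop := Nonempty
    (W.obj ≃ₗ[A.ZeroMode] (s i.succ) ⧸ (s i.castSucc).submoduleOf (s i.succ))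
  -- representatives of those factors which are modules in the given universe
  let I := {i : Fin s.length // ∃ W, Simple W ∧ P i W}
  let S : I → A.ZeroModCat.{u, w} := fun i => i.2.choose
  refine ⟨Fintype.card I, S ∘ (Fintype.equivFin I).symm,
    fun i => ((Fintype.equivFin I).symm i).2.choose_spec.1, fun W hW => ?_⟩
  have := A.isSimpleModule_obj W
  have := IsSimpleModule.nontrivial A.ZeroMode W.obj
  obtain ⟨x, hx⟩ := exists_ne (0 : W.obj)
  obtain ⟨i, hi⟩ := exists_factor_equiv s h₀ h₁ (LinearMap.toSpanSingleton A.ZeroMode W.obj x)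
    fun h => hx (by simpa using LinearMap.congr_fun h 1)
  let j : I := ⟨i, W, hW, hi⟩
  refine ⟨Fintype.equivFin I j, ?_⟩
  obtain ⟨e⟩ := hi
  obtain ⟨e'⟩ := j.2.choose_spec.2
  rw [Function.comp_apply, Equiv.symm_apply_apply]
  exact ⟨ObjectProperty.isoMk _ (e.trans e'.symm).toModuleIso⟩

/-! ### The projection to the zero-mode algebra -/

/-- The subspace of `𝒰(V)` spanned by `𝔍` and the monomials of negative degree. It is a complement
of `A_0(V)` in the sense that `𝒰(V) = F^0 𝒰(V) + K` and `F^0 𝒰(V) ∩ K = 𝔍⁰`. -/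
def negPart : Submodule ℂ A.CurrentAlgebra :=
  (⨆ n : ℕ, A.hom (-(n + 1))) ⊔ A.leftIdealJ.restrictScalars ℂ

lemma leftIdealJ_le_negPart : A.leftIdealJ.restrictScalars ℂ ≤ A.negPart := le_sup_right

lemma hom_le_negPart (n : ℕ) : A.hom (-(n + 1)) ≤ A.negPart :=
  le_trans (le_iSup (fun n : ℕ => A.hom (-(n + 1))) n) le_sup_left

lemma negPart_le {P : Submodule ℂ A.CurrentAlgebra} (h : ∀ n : ℕ, A.hom (-(n + 1)) ≤ P)
    (h' : ∀ x ∈ A.leftIdealJ, x ∈ P) : A.negPart ≤ P :=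
  sup_le (iSup_le h) h'

lemma fil_zero_le (hA : A.IsC2Finite) :
    A.fil 0 ≤ A.hom 0 ⊔ A.leftIdealJ.restrictScalars ℂ := by
  refine (A.fil_le_homGe_sup 0 1).trans (sup_le (iSup₂_le fun d hd => ?_)
    (le_trans (fun x hx => A.mem_leftIdealJ_of_mem_top hA hx) le_sup_right))
  rcases hd.eq_or_lt with rfl | h
  · exact le_sup_left
  · exact le_trans (fun x hx => A.fil_le_leftIdealJ (p := d) (by omega) (A.hom_le_fil d hx))
      le_sup_right

/-- The degrees of the monomials which matter modulo `𝔍` are not positive. -/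
lemma mem_iSup_hom_sup (hA : A.IsC2Finite) (u : A.CurrentAlgebra) :
    u ∈ (⨆ n : ℕ, A.hom (-n)) ⊔ A.leftIdealJ.restrictScalars ℂ := by
  obtain ⟨p, hp⟩ := A.exists_mem_fil u
  refine ((A.fil_le_homGe_sup p 1).trans (sup_le (iSup₂_le fun d _ => ?_)
    (le_trans (fun x hx => A.mem_leftIdealJ_of_mem_top hA hx) le_sup_right))) hp
  rcases le_or_gt d 0 with h | h
  · obtain ⟨n, hn⟩ := Int.eq_ofNat_of_zero_le (show 0 ≤ -d by omega)
    rw [show d = -(n : ℤ) by omega]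
    exact le_trans (le_iSup (fun n : ℕ => A.hom (-n)) n) le_sup_left
  · exact le_trans (fun x hx => A.fil_le_leftIdealJ (p := d) (by omega) (A.hom_le_fil d hx))
      le_sup_right

lemma exists_sub_mem_negPart (hA : A.IsC2Finite) (u : A.CurrentAlgebra) :
    ∃ a : A.filZero, u - a ∈ A.negPart := by
  obtain ⟨x, hx, y, hy, rfl⟩ := Submodule.mem_sup.1 (A.mem_iSup_hom_sup hA u)
  induction hx using Submodule.iSup_induction' with
  | mem n x hx =>
    cases n with
    | zero =>
      refine ⟨⟨x, A.hom_le_fil 0 (by simpa using hx)⟩, ?_⟩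
      rw [add_sub_cancel_left]
      exact A.leftIdealJ_le_negPart hy
    | succ n =>
      refine ⟨0, ?_⟩
      rw [ZeroMemClass.coe_zero, sub_zero]
      exact add_mem (A.hom_le_negPart n (by exact_mod_cast hx)) (A.leftIdealJ_le_negPart hy)
  | zero =>
    refine ⟨0, ?_⟩
    rw [ZeroMemClass.coe_zero, sub_zero, zero_add]
    exact A.leftIdealJ_le_negPart hy
  | add x x' _ _ hx hx' =>
    obtain ⟨a, ha⟩ := hx
    obtain ⟨b, hb⟩ := hx'
    refine ⟨a + b, ?_⟩
    have h := sub_mem (add_mem ha hb) (A.leftIdealJ_le_negPart hy)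
    convert h using 1
    push_cast
    abel

lemma T_mul_mem_leftIdealJ {x : A.CurrentAlgebra} (hx : x ∈ A.leftIdealJ) :
    A.um 2 0 A.T * x - x * A.um 2 0 A.T ∈ A.leftIdealJ :=
  sub_mem (Ideal.mul_mem_left _ _ hx) (A.leftIdealJ_mul_mem hx A.um_T_mem_fil)

/-- The endomorphism of `𝒰(V) / 𝔍` induced by `ad T(0)`. -/
def adT : Module.End ℂ (A.CurrentAlgebra ⧸ A.leftIdealJ.restrictScalars ℂ) :=
  Submodule.mapQ _ _ (LinearMap.mulLeft ℂ (A.um 2 0 A.T) - LinearMap.mulRight ℂ (A.um 2 0 A.T))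
    fun _ hx => A.T_mul_mem_leftIdealJ hx

lemma mk_mem_eigenspace_adT {d : ℤ} {x : A.CurrentAlgebra} (hx : x ∈ A.hom d) :
    Submodule.mkQ (A.leftIdealJ.restrictScalars ℂ) x ∈ Module.End.eigenspace A.adT (-d) := by
  rw [Module.End.mem_eigenspace_iff, ← map_smul]
  change Submodule.mkQ _ (A.um 2 0 A.T * x - x * A.um 2 0 A.T) = _
  rw [A.T_zero_mul_of_mem_hom hx, add_sub_cancel_left]

lemma mem_leftIdealJ_of_mem_negPart (hA : A.IsC2Finite) {x : A.CurrentAlgebra} (hx : x ∈ A.fil 0)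
    (hx' : x ∈ A.negPart) : x ∈ A.leftIdealJ := by
  set q := Submodule.mkQ (A.leftIdealJ.restrictScalars ℂ)
  have hJ : ∀ y ∈ A.leftIdealJ, q y = 0 := fun y hy => (Submodule.Quotient.mk_eq_zero _).2 hy
  have h0 : q x ∈ Module.End.eigenspace A.adT 0 := by
    have : A.fil 0 ≤ (Module.End.eigenspace A.adT 0).comap q := by
      refine (A.fil_zero_le hA).trans (sup_le (fun y hy => ?_) fun y hy => ?_)
      · have h := A.mk_mem_eigenspace_adT hy
        rwa [Int.cast_zero, neg_zero] at h
      · rw [Submodule.mem_comap, hJ y hy]; exact zero_mem _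
    exact this hx
  have h1 : q x ∈ ⨆ c : ℂ, ⨆ _ : c ≠ 0, Module.End.eigenspace A.adT c := by
    have : A.negPart ≤ (⨆ c : ℂ, ⨆ _ : c ≠ 0, Module.End.eigenspace A.adT c).comap q := by
      refine A.negPart_le (fun n y hy => ?_) fun y hy => ?_
      · refine Submodule.mem_iSup_of_mem _ (Submodule.mem_iSup_of_mem ?_
          (A.mk_mem_eigenspace_adT hy))
        push_cast
        rw [neg_neg]
        exact Nat.cast_add_one_ne_zero n
      · rw [Submodule.mem_comap, hJ y hy]; exact zero_mem _
    exact this hx'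
  have h := Submodule.disjoint_def.1 ((Module.End.eigenspaces_iSupIndep A.adT) 0) _ h0 h1
  exact (Submodule.Quotient.mk_eq_zero _).1 h

lemma mul_mem_negPart (hA : A.IsC2Finite) {x a : A.CurrentAlgebra} (hx : x ∈ A.negPart)
    (ha : a ∈ A.fil 0) : x * a ∈ A.negPart := by
  obtain ⟨b, hb, y, hy, rfl⟩ := Submodule.mem_sup.1 (A.fil_zero_le hA ha)
  have hb' := A.hom_le_fil 0 hb
  have : A.negPart ≤ A.negPart.comap (LinearMap.mulRight ℂ b) := by
    refine A.negPart_le (fun n x hx => A.hom_le_negPart n ?_) fun x hx =>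
      A.leftIdealJ_le_negPart (A.leftIdealJ_mul_mem hx hb')
    simpa using A.mul_mem_hom hx hb
  rw [mul_add]
  exact add_mem (this hx) (A.leftIdealJ_le_negPart (Ideal.mul_mem_left _ _ hy))

lemma toZeroMode_eq_zero_iff {a : A.filZero} :
    A.toZeroMode a = 0 ↔ (a : A.CurrentAlgebra) ∈ A.leftIdealJ :=
  Ideal.Quotient.eq_zero_iff_mem (I := A.idealJZero)

lemma toZeroMode_eq_of_sub_mem (hA : A.IsC2Finite) {u : A.CurrentAlgebra} {a b : A.filZero}
    (ha : u - a ∈ A.negPart) (hb : u - b ∈ A.negPart) : A.toZeroMode a = A.toZeroMode b := by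
  rw [← sub_eq_zero, ← map_sub, toZeroMode_eq_zero_iff]
  refine A.mem_leftIdealJ_of_mem_negPart hA (a - b).2 ?_
  have h := sub_mem hb ha
  rwa [sub_sub_sub_cancel_left] at h

/-- The projection of `𝒰(V)` to `A_0(V)` with kernel spanned by `𝔍` and the monomials of negative
degree. -/
def proj (hA : A.IsC2Finite) : A.CurrentAlgebra →+ A.ZeroMode where
  toFun u := A.toZeroMode (A.exists_sub_mem_negPart hA u).choose
  map_zero' := by
    rw [← map_zero A.toZeroMode]
    exact A.toZeroMode_eq_of_sub_mem hA (A.exists_sub_mem_negPart hA 0).choose_spec (by simp)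
  map_add' u v := by
    rw [← map_add]
    refine A.toZeroMode_eq_of_sub_mem hA (A.exists_sub_mem_negPart hA (u + v)).choose_spec ?_
    rw [AddMemClass.coe_add, add_sub_add_comm]
    exact add_mem (A.exists_sub_mem_negPart hA u).choose_spec
      (A.exists_sub_mem_negPart hA v).choose_spec

lemma proj_eq (hA : A.IsC2Finite) {u : A.CurrentAlgebra} {a : A.filZero}
    (ha : u - a ∈ A.negPart) : A.proj hA u = A.toZeroMode a :=
  A.toZeroMode_eq_of_sub_mem hA (A.exists_sub_mem_negPart hA u).choose_spec ha

lemma proj_coe (hA : A.IsC2Finite) (a : A.filZero) :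
    A.proj hA a = A.toZeroMode a :=
  A.proj_eq hA (by rw [sub_self]; exact zero_mem _)

lemma proj_mul (hA : A.IsC2Finite) (u : A.CurrentAlgebra) (b : A.filZero) :
    A.proj hA (u * b) = A.proj hA u * A.toZeroMode b := by
  obtain ⟨a, ha⟩ := A.exists_sub_mem_negPart hA u
  rw [A.proj_eq hA ha, ← map_mul]
  refine A.proj_eq hA ?_
  rw [MulMemClass.coe_mul, ← sub_mul]
  exact A.mul_mem_negPart hA ha b.2

/-! ### Eigenspaces of `T(0)` -/

section Eigenspaces

variable {M : Type w} [AddCommGroup M] [Module ℂ M] [Module A.CurrentAlgebra M]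
  [IsScalarTower ℂ A.CurrentAlgebra M]

lemma hom_smul_mem_eigenspace {d : ℤ} {x : A.CurrentAlgebra} (hx : x ∈ A.hom d) {μ : ℂ} {m : M}
    (hm : m ∈ Module.End.eigenspace (A.actT0 M) μ) :
    x • m ∈ Module.End.eigenspace (A.actT0 M) (μ - d) := by
  rw [Module.End.mem_eigenspace_iff] at hm ⊢
  change A.um 2 0 A.T • m = _ at hm
  change A.um 2 0 A.T • x • m = _
  rw [← mul_smul, A.T_zero_mul_of_mem_hom hx, add_smul, mul_smul, hm, smul_assoc,
    sub_eq_add_neg, add_smul]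
  congr 1
  rw [← algebraMap_smul A.CurrentAlgebra μ m, ← mul_smul, ← Algebra.commutes, mul_smul,
    algebraMap_smul]

variable (M) in
/-- The sum of the eigenspaces of `T(0)` for the eigenvalues `h + 1, h + 2, …`. -/
def posPart (h : ℂ) : Submodule ℂ M :=
  ⨆ n : ℕ, Module.End.eigenspace (A.actT0 M) (h + (n + 1))

lemma hom_smul_mem_posPart {n : ℕ} {x : A.CurrentAlgebra} (hx : x ∈ A.hom (-n)) {h : ℂ} {m : M}
    (hm : m ∈ A.posPart M h) : x • m ∈ A.posPart M h := by
  have : A.posPart M h ≤ (A.posPart M h).comap (Algebra.lsmul ℂ ℂ M x) := by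
    refine iSup_le fun k m hm => Submodule.mem_iSup_of_mem (k + n) ?_
    have e := A.hom_smul_mem_eigenspace hx hm
    push_cast at e ⊢
    rwa [show h + ((k : ℂ) + n + 1) = h + (k + 1) - -n by ring]
  exact this hm

lemma smul_mem_posPart (hA : A.IsC2Finite) (u : A.CurrentAlgebra) {h : ℂ} {m : M}
    (hm : m ∈ A.posPart M h) (hm' : m ∈ A.HW M) : u • m ∈ A.posPart M h := by
  have : (⨆ n : ℕ, A.hom (-n)) ⊔ A.leftIdealJ.restrictScalars ℂ ≤
      (A.posPart M h).comap ((Algebra.lsmul ℂ ℂ M).toLinearMap.flip m) := by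
    refine sup_le (iSup_le fun n x hx => A.hom_smul_mem_posPart hx hm) fun x hx => ?_
    change x • m ∈ A.posPart M h
    rw [A.smul_eq_zero_of_mem_HW hA hm' hx]
    exact zero_mem _
  exact this (A.mem_iSup_hom_sup hA u)

lemma negPart_smul_mem_posPart (hA : A.IsC2Finite) {u : A.CurrentAlgebra} (hu : u ∈ A.negPart)
    {h : ℂ} {m : M} (hm : m ∈ Module.End.eigenspace (A.actT0 M) h) (hm' : m ∈ A.HW M) :
    u • m ∈ A.posPart M h := by
  have : A.negPart ≤ (A.posPart M h).comap ((Algebra.lsmul ℂ ℂ M).toLinearMap.flip m) := by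
    refine A.negPart_le (fun n x hx => ?_) fun x hx => ?_
    · have e := A.hom_smul_mem_eigenspace hx hm
      rw [Int.cast_neg, sub_neg_eq_add] at e
      exact Submodule.mem_iSup_of_mem n (by exact_mod_cast e)
    · change x • m ∈ A.posPart M h
      rw [A.smul_eq_zero_of_mem_HW hA hm' hx]
      exact zero_mem _
  exact this hu

lemma eq_zero_of_mem_posPart {h : ℂ} {m : M} (hm : m ∈ Module.End.eigenspace (A.actT0 M) h)
    (hm' : m ∈ A.posPart M h) : m = 0 := by
  refine Submodule.disjoint_def.1 ((Module.End.eigenspaces_iSupIndep (A.actT0 M)) h) _ hm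
    ((iSup_le fun n => ?_ : A.posPart M h ≤ _) hm')
  refine le_iSup₂_of_le (h + (n + 1)) ?_ le_rfl
  simpa using Nat.cast_add_one_ne_zero (R := ℂ) n

variable {N : Type*} [AddCommGroup N] [Module ℂ N] [Module A.CurrentAlgebra N]
  [IsScalarTower ℂ A.CurrentAlgebra N]

lemma map_mem_eigenspace (f : M →ₗ[A.CurrentAlgebra] N) {h : ℂ} {m : M}
    (hm : m ∈ Module.End.eigenspace (A.actT0 M) h) :
    f m ∈ Module.End.eigenspace (A.actT0 N) h := by
  rw [Module.End.mem_eigenspace_iff] at hm ⊢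
  change A.um 2 0 A.T • m = _ at hm
  change A.um 2 0 A.T • f m = _
  rw [← map_smul, hm]
  exact (f.restrictScalars ℂ).map_smul h m

lemma map_mem_posPart (f : M →ₗ[A.CurrentAlgebra] N) {h : ℂ} {m : M}
    (hm : m ∈ A.posPart M h) : f m ∈ A.posPart N h := by
  have : A.posPart M h ≤ (A.posPart N h).comap (f.restrictScalars ℂ) :=
    iSup_le fun n m hm => Submodule.mem_iSup_of_mem n (A.map_mem_eigenspace f hm)
  exact this hm

end Eigenspaces

/-! ### Induced modules -/

section InducedModule

variable (W : Type w) [AddCommGroup W] [Module A.ZeroMode W]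

/-- The map `w ↦ 1 ⊗ w` from `W` to the induced module. -/
def unit : W →+ A.Induced W :=
  ((A.inducedRel W).mkQ.toAddMonoidHom).comp
    (TensorProduct.mk ℤ A.CurrentAlgebra W 1).toAddMonoidHom

variable {W}

lemma smul_unit (u : A.CurrentAlgebra) (x : W) :
    u • A.unit W x = (A.inducedRel W).mkQ (u ⊗ₜ[ℤ] x) := by
  change u • (A.inducedRel W).mkQ (1 ⊗ₜ[ℤ] x) = _
  rw [← map_smul, TensorProduct.smul_tmul', smul_eq_mul, mul_one]

lemma coe_smul_unit (a : A.filZero) (x : W) :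
    (a : A.CurrentAlgebra) • A.unit W x = A.unit W (A.toZeroMode a • x) := by
  rw [smul_unit]
  change _ = (A.inducedRel W).mkQ (1 ⊗ₜ[ℤ] (A.toZeroMode a • x))
  rw [← sub_eq_zero, ← map_sub, Submodule.mkQ_apply, Submodule.Quotient.mk_eq_zero]
  exact Submodule.subset_span ⟨1, a, x, by rw [one_mul]⟩

lemma unit_algebraMap_smul (c : ℂ) (x : W) :
    A.unit W (algebraMap ℂ A.ZeroMode c • x) = c • A.unit W x := by
  rw [← A.toZeroMode.commutes c, ← A.coe_smul_unit]
  exact algebraMap_smul A.CurrentAlgebra c (A.unit W x)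

@[elab_as_elim]
lemma Induced.induction {p : A.Induced W → Prop} (m : A.Induced W)
    (smul_unit : ∀ (u : A.CurrentAlgebra) (x : W), p (u • A.unit W x))
    (add : ∀ m n, p m → p n → p (m + n)) : p m := by
  obtain ⟨t, rfl⟩ := (A.inducedRel W).mkQ_surjective m
  induction t using TensorProduct.induction_on with
  | zero => simpa using smul_unit 0 0
  | tmul u x => rw [← A.smul_unit]; exact smul_unit u x
  | add s t hs ht => rw [map_add]; exact add _ _ hs ht

lemma unit_mem_HW (x : W) : A.unit W x ∈ A.HW (A.Induced W) := by
  refine A.mem_HW_of_forall fun u hu => ?_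
  have h := A.coe_smul_unit ⟨u, A.fil_anti zero_le_one hu⟩ x
  rwa [A.toZeroMode_eq_zero_iff.2 (A.fil_le_leftIdealJ le_rfl hu), zero_smul, map_zero] at h

/-- The universal property of the induced module. -/
lemma exists_lift {M : Type*} [AddCommGroup M] [Module A.CurrentAlgebra M] (g : W →+ M)
    (hg : ∀ (a : A.filZero) (x : W), g (A.toZeroMode a • x) = (a : A.CurrentAlgebra) • g x) :
    ∃ f : A.Induced W →ₗ[A.CurrentAlgebra] M, ∀ x, f (A.unit W x) = g x := by
  refine ⟨(A.inducedRel W).liftQ (TensorProduct.AlgebraTensorModule.lift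
    (LinearMap.toSpanSingleton A.CurrentAlgebra (W →ₗ[ℤ] M) g.toIntLinearMap)) ?_, fun x => ?_⟩
  · refine Submodule.span_le.2 ?_
    rintro _ ⟨u, a, y, rfl⟩
    simp [mul_smul, hg]
  · exact one_smul A.CurrentAlgebra (g x)

variable (W) in
/-- The projection `u ⊗ w ↦ π(u) w` of the induced module to `W`, where `π` is the projection of
`𝒰(V)` to `A_0(V)`. -/
def inducedProj (hA : A.IsC2Finite) : A.Induced W →+ W :=
  let f : A.CurrentAlgebra ⊗[ℤ] W →+ W := TensorProduct.liftAddHom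
    ((smulAddHom A.ZeroMode W).comp (A.proj hA)) fun r u x => by
      change A.proj hA (r • u) • x = A.proj hA u • r • x
      rw [map_zsmul, smul_assoc, smul_comm]
  QuotientAddGroup.lift (A.inducedRel W).toAddSubgroup f fun t ht => by
    have h : ∀ t ∈ A.inducedRel W, ∀ u : A.CurrentAlgebra, f (u • t) = 0 := by
      intro t ht
      induction ht using Submodule.span_induction with
      | mem t ht =>
        obtain ⟨v, a, y, rfl⟩ := ht
        intro u
        rw [smul_sub, map_sub, TensorProduct.smul_tmul', TensorProduct.smul_tmul', smul_eq_mul,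
          smul_eq_mul, ← mul_assoc]
        change A.proj hA (u * v * a) • y - A.proj hA (u * v) • A.toZeroMode a • y = 0
        rw [A.proj_mul, mul_smul, sub_self]
      | zero => intro u; rw [smul_zero, map_zero]
      | add s t _ _ hs ht => intro u; rw [smul_add, map_add, hs, ht, add_zero]
      | smul v t _ ht => intro u; rw [← mul_smul]; exact ht _
    simpa using h t ht 1

lemma inducedProj_smul_unit (hA : A.IsC2Finite) (u : A.CurrentAlgebra) (x : W) :
    A.inducedProj W hA (u • A.unit W x) = A.proj hA u • x := by
  rw [smul_unit]
  rfl

lemma inducedProj_unit (hA : A.IsC2Finite) (x : W) : A.inducedProj W hA (A.unit W x) = x := by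
  have h := A.inducedProj_smul_unit hA ((1 : A.filZero) : A.CurrentAlgebra) x
  rwa [A.proj_coe, map_one, one_smul, OneMemClass.coe_one, one_smul] at h

end InducedModule

/-! ### Induced modules of simple modules -/

section SimpleInduced

variable (W : Type w) [AddCommGroup W] [Module A.ZeroMode W] [IsSimpleModule A.ZeroMode W]

lemma zeroModeT_mul_comm (hA : A.IsC2Finite) (a : A.ZeroMode) :
    A.zeroModeT * a = a * A.zeroModeT := by
  obtain ⟨a, rfl⟩ := Ideal.Quotient.mk_surjective a
  change A.toZeroMode _ * A.toZeroMode a = A.toZeroMode a * A.toZeroMode _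
  rw [← map_mul, ← map_mul, ← sub_eq_zero, ← map_sub, toZeroMode_eq_zero_iff]
  obtain ⟨b, hb, y, hy, h⟩ := Submodule.mem_sup.1 (A.fil_zero_le hA a.2)
  change A.um 2 0 A.T * (a : A.CurrentAlgebra) - a * A.um 2 0 A.T ∈ A.leftIdealJ
  rw [← h, mul_add, add_mul, A.T_zero_mul_of_mem_hom hb, Int.cast_zero, neg_zero, zero_smul,
    add_zero, add_sub_add_left_eq_sub]
  exact A.T_mul_mem_leftIdealJ hy

/-- Schur's lemma: the central element `T(0)` of the zero-mode algebra acts by a scalar. -/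
lemma exists_zeroModeT_smul_eq (hA : A.IsC2Finite) :
    ∃ h : ℂ, ∀ x : W, A.zeroModeT • x = algebraMap ℂ A.ZeroMode h • x := by
  let : Module ℂ W := Module.compHom W (algebraMap ℂ A.ZeroMode)
  have : IsScalarTower ℂ A.ZeroMode W := ⟨fun c a x => by
    rw [Algebra.smul_def, mul_smul]; rfl⟩
  have := A.finiteDimensional_zeroMode hA
  have : FiniteDimensional ℂ W := Module.Finite.trans A.ZeroMode W
  let f : Module.End A.ZeroMode W :=
    { toFun := fun x => A.zeroModeT • x
      map_add' := smul_add _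
      map_smul' := fun a x => by
        rw [RingHom.id_apply, ← mul_smul, ← mul_smul, A.zeroModeT_mul_comm hA] }
  obtain ⟨h, hh⟩ := (IsSimpleModule.algebraMap_end_bijective_of_isAlgClosed (A := A.ZeroMode)
    (V := W) ℂ).2 f
  exact ⟨h, fun x => (LinearMap.congr_fun hh x).symm⟩

/-- The eigenvalue of `T(0)` on a simple module over the zero-mode algebra. -/
def weight (hA : A.IsC2Finite) : ℂ := (A.exists_zeroModeT_smul_eq W hA).choose

lemma zeroModeT_smul (hA : A.IsC2Finite) (x : W) :
    A.zeroModeT • x = algebraMap ℂ A.ZeroMode (A.weight W hA) • x :=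
  (A.exists_zeroModeT_smul_eq W hA).choose_spec x

variable {W}

lemma unit_mem_eigenspace (hA : A.IsC2Finite) (x : W) :
    A.unit W x ∈ Module.End.eigenspace (A.actT0 (A.Induced W)) (A.weight W hA) := by
  rw [Module.End.mem_eigenspace_iff, ← A.unit_algebraMap_smul,
    ← A.zeroModeT_smul W hA]
  exact A.coe_smul_unit ⟨A.um 2 0 A.T, A.um_T_mem_fil⟩ x

lemma sub_unit_inducedProj_mem (hA : A.IsC2Finite) (m : A.Induced W) :
    m - A.unit W (A.inducedProj W hA m) ∈ A.posPart (A.Induced W) (A.weight W hA) := by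
  induction m using Induced.induction with
  | smul_unit u x =>
    obtain ⟨a, ha⟩ := A.exists_sub_mem_negPart hA u
    rw [A.inducedProj_smul_unit, A.proj_eq hA ha, ← A.coe_smul_unit, ← sub_smul]
    exact A.negPart_smul_mem_posPart hA ha (A.unit_mem_eigenspace hA x) (A.unit_mem_HW x)
  | add m n hm hn =>
    rw [map_add, map_add, add_sub_add_comm]
    exact add_mem hm hn

/-- A simple module generates the induced module from any of its nonzero elements. -/
lemma eq_top_of_unit_mem {N : Submodule A.CurrentAlgebra (A.Induced W)} {x : W} (hx : x ≠ 0)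
    (h : A.unit W x ∈ N) : N = ⊤ := by
  rw [Submodule.eq_top_iff']
  intro m
  induction m using Induced.induction with
  | smul_unit u y =>
    obtain ⟨a, rfl⟩ := IsSimpleModule.toSpanSingleton_surjective A.ZeroMode hx y
    obtain ⟨a, rfl⟩ := Ideal.Quotient.mk_surjective a
    refine N.smul_mem u ?_
    change A.unit W (A.toZeroMode a • x) ∈ N
    rw [← A.coe_smul_unit]
    exact N.smul_mem _ h
  | add m n hm hn => exact N.add_mem hm hn

/-- Proper submodules of the induced module are contained in the kernel of the projection to `W`,
since they contain the components of their elements for the eigenvalues of `T(0)`. -/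
lemma inducedProj_eq_zero (hA : A.IsC2Finite) {N : Submodule A.CurrentAlgebra (A.Induced W)}
    (hN : N ≠ ⊤) {m : A.Induced W} (hm : m ∈ N) : A.inducedProj W hA m = 0 := by
  by_contra h
  refine hN (A.eq_top_of_unit_mem h ?_)
  set y := A.unit W (A.inducedProj W hA m) with hy
  rw [← Submodule.Quotient.mk_eq_zero, ← Submodule.mkQ_apply]
  refine A.eq_zero_of_mem_posPart (h := A.weight W hA)
    (A.map_mem_eigenspace N.mkQ (A.unit_mem_eigenspace hA _)) ?_
  have e := A.map_mem_posPart N.mkQ (A.sub_unit_inducedProj_mem hA m)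
  rw [map_sub, Submodule.mkQ_apply, (Submodule.Quotient.mk_eq_zero N).2 hm, zero_sub] at e
  exact neg_mem_iff.1 e

variable (W) in
lemma isVModule_induced (hA : A.IsC2Finite) : A.IsVModule (A.Induced W) := by
  obtain ⟨Δ₀, h₀⟩ := A.exists_isC2Bound hA
  have := A.finiteDimensional_zeroMode hA
  have := IsSimpleModule.nontrivial A.ZeroMode W
  obtain ⟨x, hx⟩ := exists_ne (0 : W)
  have htop : Submodule.span A.CurrentAlgebra {A.unit W x} = ⊤ :=
    A.eq_top_of_unit_mem hx (Submodule.mem_span_singleton_self _)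
  let f : A.ZeroMode →ₗ[ℂ] A.Induced W :=
    { toFun := fun a => A.unit W (a • x)
      map_add' := fun a b => by rw [add_smul, map_add]
      map_smul' := fun c a => by
        rw [Algebra.smul_def, mul_smul, A.unit_algebraMap_smul, RingHom.id_apply] }
  refine ⟨⟨⟨{A.unit W x}, by simpa using htop⟩⟩,
    A.isLocallyFinite_of_span_eq_top h₀ (X := LinearMap.range f) (s := 1) ?_ ?_ ?_⟩
  · refine A.actOn_le.2 ?_
    rintro a ha _ ⟨b, rfl⟩
    exact ⟨A.toZeroMode ⟨a, ha⟩ * b, by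
      change A.unit W _ = a • A.unit W (b • x)
      rw [mul_smul, ← A.coe_smul_unit]⟩
  · rintro _ ⟨b, rfl⟩
    exact A.mem_genNil_succ.2 fun k => by
      rw [show A.gen 1 k • f b = 0 from A.gen_one_smul_of_mem_HW k (A.unit_mem_HW _)]
      exact zero_mem _
  · rw [← top_le_iff, ← htop]
    refine Submodule.span_mono (Set.singleton_subset_iff.2 ⟨1, ?_⟩)
    exact congrArg (A.unit W) (one_smul A.ZeroMode x)

variable (W) in
lemma isProperVSubmodule_iff (hA : A.IsC2Finite) {N : Submodule A.CurrentAlgebra (A.Induced W)} :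
    A.IsProperVSubmodule W N ↔ N ≠ ⊤ :=
  ⟨fun h => h.2, fun h => ⟨(A.isVModule_induced W hA).submodule hA N, h⟩⟩

variable (W) in
lemma inducedProj_eq_zero_of_mem_maxSub (hA : A.IsC2Finite) {m : A.Induced W}
    (hm : m ∈ A.maxSub W) : A.inducedProj W hA m = 0 := by
  -- the largest submodule contained in the kernel of the projection
  let P : Submodule A.CurrentAlgebra (A.Induced W) :=
    { carrier := {m | ∀ u : A.CurrentAlgebra, A.inducedProj W hA (u • m) = 0}
      zero_mem' := fun u => by rw [smul_zero, map_zero]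
      add_mem' := fun hm hn u => by rw [smul_add, map_add, hm u, hn u, add_zero]
      smul_mem' := fun c m hm u => by rw [← mul_smul]; exact hm _ }
  have h : A.maxSub W ≤ P := sSup_le fun N hN m hm u =>
    A.inducedProj_eq_zero hA hN.2 (N.smul_mem u hm)
  simpa using h hm 1

variable (W) in
lemma maxSub_ne_top (hA : A.IsC2Finite) : A.maxSub W ≠ ⊤ := by
  intro h
  have := IsSimpleModule.nontrivial A.ZeroMode W
  obtain ⟨x, hx⟩ := exists_ne (0 : W)
  refine hx ?_
  rw [← A.inducedProj_unit hA x]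
  exact A.inducedProj_eq_zero_of_mem_maxSub W hA (h ▸ Submodule.mem_top)

lemma le_maxSub (hA : A.IsC2Finite) {N : Submodule A.CurrentAlgebra (A.Induced W)}
    (hN : N ≠ ⊤) : N ≤ A.maxSub W :=
  le_sSup ((A.isProperVSubmodule_iff W hA).2 hN)

variable (W) in
lemma isGreatest_maxSub (hA : A.IsC2Finite) :
    IsGreatest {N | A.IsProperVSubmodule W N} (A.maxSub W) :=
  ⟨(A.isProperVSubmodule_iff W hA).2 (A.maxSub_ne_top W hA), fun _ hN => le_sSup hN⟩

variable (W) in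
lemma isSimpleVModule_LMod (hA : A.IsC2Finite) : A.IsSimpleVModule (A.LMod W) where
  isVModule := (A.isVModule_induced W hA).of_surjective _ (A.maxSub W).mkQ_surjective
  isSimple := isSimpleModule_iff_isCoatom.2 ⟨A.maxSub_ne_top W hA, fun _ hN => by
    by_contra h
    exact hN.not_ge (A.le_maxSub hA h)⟩

/-- A simple quotient of the induced module is isomorphic to `L(W)`. -/
lemma nonempty_LMod_equiv (hA : A.IsC2Finite) {M : Type*} [AddCommGroup M]
    [Module A.CurrentAlgebra M] [IsSimpleModule A.CurrentAlgebra M] (g : W →+ M)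
    (hg : ∀ (a : A.filZero) (x : W), g (A.toZeroMode a • x) = (a : A.CurrentAlgebra) • g x)
    (hg0 : g ≠ 0) : Nonempty (A.LMod W ≃ₗ[A.CurrentAlgebra] M) := by
  obtain ⟨f, hf⟩ := A.exists_lift g hg
  have hf0 : f ≠ 0 := by
    rintro rfl
    exact hg0 (AddMonoidHom.ext fun x => (hf x).symm)
  have hs := LinearMap.surjective_of_ne_zero hf0
  have hker := LinearMap.isCoatom_ker_of_surjective hs
  have e : A.maxSub W = LinearMap.ker f :=
    (hker.le_iff.1 (A.le_maxSub hA hker.1)).resolve_left (A.maxSub_ne_top W hA)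
  exact ⟨(Submodule.quotEquivOfEq _ _ e).trans (f.quotKerEquivOfSurjective hs)⟩

/-! ### Highest weight vectors of simple modules -/

/-- The highest weight vectors of `L(W)` are the classes of the elements `1 ⊗ w`. -/
lemma exists_unit_of_mem_HW (hA : A.IsC2Finite) {x : A.LMod W} (hx : x ∈ A.HW (A.LMod W)) :
    ∃ y : W, (A.maxSub W).mkQ (A.unit W y) = x := by
  obtain ⟨m, rfl⟩ := (A.maxSub W).mkQ_surjective x
  have hU (y : W) : (A.maxSub W).mkQ (A.unit W y) ∈ A.HW (A.LMod W) :=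
    A.map_mem_HW _ (A.unit_mem_HW y)
  have hE (y : W) := A.map_mem_eigenspace (A.maxSub W).mkQ (A.unit_mem_eigenspace hA y)
  refine ⟨A.inducedProj W hA m, ?_⟩
  have h1 := A.map_mem_posPart (A.maxSub W).mkQ (A.sub_unit_inducedProj_mem hA m)
  rw [map_sub] at h1
  have h2 := sub_mem hx (hU (A.inducedProj W hA m))
  by_contra hne
  have hS := (A.isSimpleVModule_LMod W hA).isSimple
  -- a nonzero highest weight vector in the positive part would generate a proper submodule
  refine A.maxSub_ne_top W hA ?_
  have := IsSimpleModule.nontrivial A.ZeroMode W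
  obtain ⟨y, hy⟩ := exists_ne (0 : W)
  refine A.eq_top_of_unit_mem hy ?_
  obtain ⟨u, hu⟩ := IsSimpleModule.toSpanSingleton_surjective A.CurrentAlgebra
    (sub_ne_zero.2 (Ne.symm hne)) ((A.maxSub W).mkQ (A.unit W y))
  rw [← Submodule.Quotient.mk_eq_zero, ← Submodule.mkQ_apply]
  refine A.eq_zero_of_mem_posPart (hE y) ?_
  rw [← hu]
  exact A.smul_mem_posPart hA u h1 h2

variable (W) in
/-- The map which sends `w` to the class of `1 ⊗ w` in `HW(L(W))`. -/
def toHWSpace (hA : A.IsC2Finite) : W →ₗ[A.ZeroMode] A.HWSpace (A.LMod W) hA where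
  toFun x := ⟨(A.maxSub W).mkQ (A.unit W x), A.map_mem_HW _ (A.unit_mem_HW x)⟩
  map_add' x y := HWSpace.val_injective A (by
    change (A.maxSub W).mkQ (A.unit W (x + y)) =
      (A.maxSub W).mkQ (A.unit W x) + (A.maxSub W).mkQ (A.unit W y)
    rw [map_add, map_add])
  map_smul' a x := by
    obtain ⟨a, rfl⟩ := Ideal.Quotient.mk_surjective a
    refine HWSpace.val_injective A ?_
    change (A.maxSub W).mkQ (A.unit W (A.toZeroMode a • x)) =
      (a : A.CurrentAlgebra) • (A.maxSub W).mkQ (A.unit W x)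
    rw [← A.coe_smul_unit, map_smul]

variable (W) in
/-- The isomorphism of `W` with the highest weight vectors of `L(W)`. -/
def equivHWSpace (hA : A.IsC2Finite) : W ≃ₗ[A.ZeroMode] A.HWSpace (A.LMod W) hA :=
  LinearEquiv.ofBijective (A.toHWSpace W hA)
    ⟨by
      refine (injective_iff_map_eq_zero _).2 fun x hx => ?_
      have h : (A.maxSub W).mkQ (A.unit W x) = 0 := congrArg Subtype.val hx
      rw [← A.inducedProj_unit hA x]
      exact A.inducedProj_eq_zero_of_mem_maxSub W hA ((Submodule.Quotient.mk_eq_zero _).1 h),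
    fun x => by
      obtain ⟨y, hy⟩ := A.exists_unit_of_mem_HW hA x.2
      exact ⟨y, Subtype.ext hy⟩⟩

lemma nonempty_LMod_equiv_iff (hA : A.IsC2Finite) {W' : Type w} [AddCommGroup W']
    [Module A.ZeroMode W'] [IsSimpleModule A.ZeroMode W'] :
    Nonempty (A.LMod W ≃ₗ[A.CurrentAlgebra] A.LMod W') ↔ Nonempty (W ≃ₗ[A.ZeroMode] W') := by
  constructor
  · rintro ⟨e⟩
    let e' : A.HWSpace (A.LMod W) hA ≃ₗ[A.ZeroMode] A.HWSpace (A.LMod W') hA :=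
      { HWSpace.map A hA e.toLinearMap with
        invFun := HWSpace.map A hA e.symm.toLinearMap
        left_inv := fun x => Subtype.ext (e.symm_apply_apply x.1)
        right_inv := fun x => Subtype.ext (e.apply_symm_apply x.1) }
    exact ⟨(A.equivHWSpace W hA).trans (e'.trans (A.equivHWSpace W' hA).symm)⟩
  · rintro ⟨e⟩
    have := (A.isSimpleVModule_LMod W' hA).isSimple
    let g : W →+ A.LMod W' := (HWSpace.val A).comp
      ((A.equivHWSpace W' hA).toLinearMap.comp e.toLinearMap).toAddMonoidHom
    refine A.nonempty_LMod_equiv hA g (fun a x => ?_) ?_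
    · change HWSpace.val A (A.equivHWSpace W' hA (e (A.toZeroMode a • x))) =
        (a : A.CurrentAlgebra) • HWSpace.val A (A.equivHWSpace W' hA (e x))
      rw [map_smul, map_smul, HWSpace.val_smul]
    · intro h
      have := IsSimpleModule.nontrivial A.ZeroMode W
      obtain ⟨x, hx⟩ := exists_ne (0 : W)
      refine hx ((e.trans (A.equivHWSpace W' hA)).injective (HWSpace.val_injective A ?_))
      rw [map_zero, map_zero]
      exact DFunLike.congr_fun h x

end SimpleInduced

lemma exists_LMod_equiv (hA : A.IsC2Finite) (M : Type w) [AddCommGroup M] [Module ℂ M]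
    [Module A.CurrentAlgebra M] [IsScalarTower ℂ A.CurrentAlgebra M] (hM : A.IsSimpleVModule M) :
    ∃ W : A.ZeroModCat.{u, w}, IsSimpleModule A.ZeroMode W.obj ∧
      Nonempty (A.LMod W.obj ≃ₗ[A.CurrentAlgebra] M) := by
  have := hM.isSimple
  have := IsSimpleModule.nontrivial A.CurrentAlgebra M
  have := hM.isVModule.finiteDimensional_HW hA
  have := A.finiteDimensional_zeroMode hA
  obtain ⟨m, hm, hm0⟩ := IsLocallyFinite.exists_mem_HW hA hM.isVModule.finiteDimensional
  -- the highest weight vectors form a module of finite length, which has a simple submodule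
  let y : A.HWSpace M hA := ⟨m, hm⟩
  let P : Submodule A.ZeroMode (A.HWSpace M hA) := Submodule.span A.ZeroMode {y}
  have : IsArtinian A.ZeroMode A.ZeroMode := isArtinian_of_tower ℂ inferInstance
  have : IsArtinian A.ZeroMode P :=
    isArtinian_of_fg_of_artinian P (Submodule.fg_span_singleton y)
  have : Nontrivial P := ⟨⟨⟨y, Submodule.mem_span_singleton_self y⟩, 0, fun h =>
    hm0 (congrArg (fun z : P => HWSpace.val A z.1) h)⟩⟩
  obtain ⟨Q, hQ⟩ := IsAtomic.exists_atom (Submodule A.ZeroMode P)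
  have hQs : IsSimpleModule A.ZeroMode Q := isSimpleModule_iff_isAtom.2 hQ
  let i : Q →+ A.HWSpace M hA := P.subtype.toAddMonoidHom.comp Q.subtype.toAddMonoidHom
  have hi : Function.Injective i := P.injective_subtype.comp Q.injective_subtype
  refine ⟨⟨ModuleCat.of A.ZeroMode Q, A.finiteDimensional_of_injective_addHom
    (ModuleCat.of A.ZeroMode Q) (X := A.HW M) i hi
    fun c x => Subtype.ext (A.algebraMap_smul_HWSpace (hA := hA) c (i x))⟩, hQs, ?_⟩
  refine A.nonempty_LMod_equiv (W := Q) hA ((HWSpace.val A).comp i) (fun a x => rfl) fun h => ?_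
  have := IsSimpleModule.nontrivial A.ZeroMode Q
  obtain ⟨x, hx⟩ := exists_ne (0 : Q)
  exact hx (hi (HWSpace.val_injective A (DFunLike.congr_fun h x)))

end ChiralVOA

end

theorem mainTheorem10 {V : Type u} [AddCommGroup V] [Module ℂ V] (A : ChiralVOA V)
    (hA : A.IsC2Finite) :
    -- (1) the zero-mode algebra is finite dimensional
    FiniteDimensional ℂ A.ZeroMode ∧
    -- (2) up to isomorphism there are finitely many simple objects
    (∃ (r : ℕ) (S : Fin r → A.ZeroModCat.{u, w}), (∀ i, Simple (S i)) ∧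
      ∀ W : A.ZeroModCat.{u, w}, Simple W → ∃ i, Nonempty (W ≅ S i)) ∧
    -- (3) the highest weight spaces are finite dimensional and form a functor, where
    -- `A_0(V)` acts through the action of `F^0 𝒰(V)` and morphisms act by restriction
    (∀ (M : Type w) [AddCommGroup M] [Module ℂ M] [Module A.CurrentAlgebra M]
      [IsScalarTower ℂ A.CurrentAlgebra M], A.IsVModule M → FiniteDimensional ℂ (A.HW M)) ∧
    (∃ (Φ : A.VModCat.{u, w} ⥤ A.ZeroModCat.{u, w})
      (ι : ∀ M : A.VModCat.{u, w}, (Φ.obj M).obj →ₗ[ℂ] M.obj),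
      (∀ M, Function.Injective (ι M)) ∧
      (∀ M, LinearMap.range (ι M) = A.HW M.obj) ∧
      (∀ M (a : A.filZero) (x : (Φ.obj M).obj),
        ι M (A.toZeroMode a • x) = (a : A.CurrentAlgebra) • ι M x) ∧
      (∀ (M N : A.VModCat.{u, w}) (f : M ⟶ N) (x : (Φ.obj M).obj),
        ι N ((Φ.map f).hom x) = f.hom (ι M x))) ∧
    -- (4) the induced module of a simple module, its largest proper submodule and its quotient
    (∀ (W : Type w) [AddCommGroup W] [Module A.ZeroMode W], IsSimpleModule A.ZeroMode W →
      A.IsVModule (A.Induced W) ∧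
      (∃! N : Submodule A.CurrentAlgebra (A.Induced W),
        Maximal (A.IsProperVSubmodule W) N) ∧
      Maximal (A.IsProperVSubmodule W) (A.maxSub W) ∧
      A.IsSimpleVModule (A.LMod W)) ∧
    -- (5) `W ↦ L(W)` is well defined and injective on isomorphism classes, and surjective
    (∀ W W' : A.ZeroModCat.{u, w},
      IsSimpleModule A.ZeroMode W.obj → IsSimpleModule A.ZeroMode W'.obj →
      (Nonempty (A.LMod W.obj ≃ₗ[A.CurrentAlgebra] A.LMod W'.obj) ↔
        Nonempty (W.obj ≃ₗ[A.ZeroMode] W'.obj))) ∧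
    (∀ (M : Type w) [AddCommGroup M] [Module ℂ M] [Module A.CurrentAlgebra M]
      [IsScalarTower ℂ A.CurrentAlgebra M], A.IsSimpleVModule M →
      ∃ W : A.ZeroModCat.{u, w}, IsSimpleModule A.ZeroMode W.obj ∧
        Nonempty (A.LMod W.obj ≃ₗ[A.CurrentAlgebra] M)) ∧
    -- (6) characterization of `V`-modules by finite dimensional generalized eigenspaces
    (∀ (M : Type w) [AddCommGroup M] [Module ℂ M] [Module A.CurrentAlgebra M]
      [IsScalarTower ℂ A.CurrentAlgebra M], A.IsGradedModule M →
      (A.IsVModule M ↔ ∀ h : ℂ, FiniteDimensional ℂ (A.genEigenspace M h))) ∧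
    -- (7) composition series
    (∀ (M : Type w) [AddCommGroup M] [Module ℂ M] [Module A.CurrentAlgebra M]
      [IsScalarTower ℂ A.CurrentAlgebra M], A.IsVModule M →
      ∃ (n : ℕ) (F : Fin (n + 1) → Submodule A.CurrentAlgebra M),
        F 0 = ⊥ ∧ F (Fin.last n) = ⊤ ∧ (∀ i, A.IsVModule (F i)) ∧
        ∀ i : Fin n, F i.castSucc < F i.succ ∧
          A.IsSimpleVModule (F i.succ ⧸ (F i.castSucc).submoduleOf (F i.succ))) := by
  refine ⟨A.finiteDimensional_zeroMode hA, A.exists_simple_zeroModCat hA,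
    fun M _ _ _ _ hM => hM.finiteDimensional_HW hA, A.exists_hwFunctor hA, fun W _ _ hW => ?_,
    fun W W' _ _ => A.nonempty_LMod_equiv_iff hA, fun M _ _ _ _ hM => A.exists_LMod_equiv hA M hM,
    fun M _ _ _ _ hM => hM.isVModule_iff hA, fun M _ _ _ _ hM => hM.exists_compositionSeries hA⟩
  have hmax := A.isGreatest_maxSub W hA
  have hmax' : Maximal (A.IsProperVSubmodule W) (A.maxSub W) := ⟨hmax.1, fun _ hN _ => hmax.2 hN⟩
  exact ⟨A.isVModule_induced W hA,
    ⟨A.maxSub W, hmax', fun N hN => hN.eq_of_le hmax.1 (hmax.2 hN.1)⟩,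
    hmax', A.isSimpleVModule_LMod W hA⟩
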